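/- Let $n\ge 0$ be an integer, let $\lambda_1\ge\lambda_2\ge\dots\ge\lambda_n$ be real numbers, and let $\mathcal{O}_\lambda$ be the set of all Hermitian $n\times n$ matrices of the form $U\,\mathrm{diag}(\lambda_1,\dots,\lambda_n)\,U^*$ with $U\in U(n)$. This is a co-adjoint orbit of $U(n)$ with tangent spaces $T_h\mathcal{O}_\lambda=\{[X,h] : X\in\mathfrak{u}(n)\}$; equip it with the Kirillov–Kostant–Souriau symplectic form $$\omega_h([X,h],[Y,h])=\mathrm{tr}\bigl(i\,h\,[X,Y]\bigr),\qquad h\in\mathcal{O}_\lambda,\ X,Y\in\mathfrak{u}(n).$$ Let $\Phi_\lambda=(\Phi_\lambda^{i,j})$, indexed by the integers $i,j\ge1$ with $i+j\le n+1$, be the Gelfand–Cetlin system on $\mathcal{O}_\lambda$: $\Phi_\lambda^{i,j}(x)$ is the $i$-th largest eigenvalue, counted with multiplicity, of the leading principal $(i+j-1)\times(i+j-1)$ submatrix of $x$. If $\mathcal{O}_\lambda$ is not diffeomorphic to any complex projective space $\mathbb{C}P^m$, $m\ge0$ (where $\mathbb{C}P^0$ is a point), then $\Phi_\lambda$ has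 a non-torus Lagrangian fiber: there is a nonempty fiber $\Phi_\lambda^{-1}(u)$ that is an embedded Lagrangian submanifold of $(\mathcal{O}_\lambda,\omega)$ and that is not homeomorphic (so in particular not diffeomorphic) to the torus $(S^1)^d$, where $d$ is its dimension. -/

import Mathlib

open scoped ContDiff Topology

noncomputable section GelfandCetlinDefs

/-! ### Smooth maps between subsets, embedded submanifolds, tangent vectors -/

/-- `f` is smooth on the subset `X` of the normed space `E`: near every point of `X` it coincides
on `X` with a smooth function defined on an open subset of `E`. -/
def SmoothMapOn {E F : Type*} [NormedAddCommGroup E] [NormedSpace ℝ E]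
    [NormedAddCommGroup F] [NormedSpace ℝ F] (f : E → F) (X : Set E) : Prop :=
  ∀ x ∈ X, ∃ U : Set E, IsOpen U ∧ x ∈ U ∧
    ∃ g : E → F, ContDiffOn ℝ ∞ g U ∧ Set.EqOn f g (X ∩ U)

/-- Diffeomorphic subsets of normed spaces: there are mutually inverse smooth maps. -/
def Diffeomorphic {E F : Type*} [NormedAddCommGroup E] [NormedSpace ℝ E]
    [NormedAddCommGroup F] [NormedSpace ℝ F] (X : Set E) (Y : Set F) : Prop :=
  ∃ (f : E → F) (g : F → E), SmoothMapOn f X ∧ SmoothMapOn g Y ∧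
    Set.MapsTo f X Y ∧ Set.MapsTo g Y X ∧ Set.LeftInvOn g f X ∧ Set.RightInvOn g f Y

/-- `X` is a `d`-dimensional (embedded, smooth) submanifold: every point of `X` has an open
neighbourhood in `X` that is diffeomorphic to an open subset of `ℝ ^ d`. -/
def IsSubmanifold {E : Type*} [NormedAddCommGroup E] [NormedSpace ℝ E]
    (X : Set E) (d : ℕ) : Prop :=
  ∀ x ∈ X, ∃ V : Set E, IsOpen V ∧ x ∈ V ∧
    ∃ W : Set (EuclideanSpace ℝ (Fin d)), IsOpen W ∧ Diffeomorphic (X ∩ V) W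

/-- The tangent space of `X` at `x`, as the set of velocities of smooth curves in `X`. -/
def tangentVectors {E : Type*} [NormedAddCommGroup E] [NormedSpace ℝ E]
    (X : Set E) (x : E) : Set E :=
  {v | ∃ γ : ℝ → E, ContDiffAt ℝ ∞ γ 0 ∧ (∀ᶠ t in 𝓝 0, γ t ∈ X) ∧ γ 0 = x ∧ HasDerivAt γ v 0}

/-! ### Co-adjoint orbits of the unitary group

The dual of `𝔲(n)` is identified with the Hermitian matrices. The norm on matrices is the
entrywise supremum norm; on this finite-dimensional space it only serves to speak of
smoothness, which does not depend on it. -/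

attribute [local instance] Matrix.normedAddCommGroup Matrix.normedSpace

/-- The orbit of `diag(l 0, …, l (n - 1))` under conjugation by unitary matrices. -/
def coadjointOrbit {n : ℕ} (l : Fin n → ℝ) : Set (Matrix (Fin n) (Fin n) ℂ) :=
  {x | ∃ U ∈ Matrix.unitaryGroup (Fin n) ℂ,
    x = U * Matrix.diagonal (fun i => (l i : ℂ)) * U.conjTranspose}

theorem coadjointOrbit_isHermitian {n : ℕ} {l : Fin n → ℝ} {x : Matrix (Fin n) (Fin n) ℂ}
    (hx : x ∈ coadjointOrbit l) : x.IsHermitian := by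
  obtain ⟨U, -, rfl⟩ := hx
  apply Matrix.isHermitian_mul_mul_conjTranspose
  rw [Matrix.isHermitian_diagonal_iff]
  intro i
  simp [isSelfAdjoint_iff]

/-- The skew-Hermitian matrices, i.e. the Lie algebra `𝔲(n)`. -/
def skewHermitian (n : ℕ) : Set (Matrix (Fin n) (Fin n) ℂ) :=
  {X | X.conjTranspose = -X}

/-- The form `(X, Y) ↦ tr(i h [X, Y])` on `𝔲(n)`; the trace is real. The tangent space of the orbit
at `h` is `{[X, h] | X ∈ 𝔲(n)}`, and the Kirillov-Kostant-Souriau symplectic form is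
`ω_h([X, h], [Y, h]) = kks h X Y`. -/
def kks {n : ℕ} (h X Y : Matrix (Fin n) (Fin n) ℂ) : ℝ :=
  (Complex.I * (h * ⁅X, Y⁆).trace).re

/-- A subset `L` of a co-adjoint orbit is a Lagrangian submanifold of dimension `d`: it is a
submanifold and each of its tangent spaces is its own orthogonal complement, with respect to the
Kirillov-Kostant-Souriau form, in the tangent space of the orbit. -/
def IsLagrangianIn {n : ℕ} (l : Fin n → ℝ) (L : Set (Matrix (Fin n) (Fin n) ℂ)) (d : ℕ) : Prop :=
  L ⊆ coadjointOrbit l ∧ IsSubmanifold L d ∧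
    ∀ h ∈ L, ∀ X ∈ skewHermitian n,
      (⁅X, h⁆ ∈ tangentVectors L h ↔
        ∀ Y ∈ skewHermitian n, ⁅Y, h⁆ ∈ tangentVectors L h → kks h X Y = 0)

/-! ### The Gelfand-Cetlin system -/

/-- The index set `{(i, j) | i, j ≥ 1, i + j ≤ n + 1}`. -/
abbrev GCIndex (n : ℕ) : Type :=
  {p : ℕ × ℕ // 1 ≤ p.1 ∧ 1 ≤ p.2 ∧ p.1 + p.2 ≤ n + 1}

/-- The leading principal `k × k` submatrix. -/
def leadingBlock {n : ℕ} (x : Matrix (Fin n) (Fin n) ℂ) (k : ℕ) (hk : k ≤ n) :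
    Matrix (Fin k) (Fin k) ℂ :=
  x.submatrix (Fin.castLE hk) (Fin.castLE hk)

theorem leadingBlock_isHermitian {n : ℕ} {x : Matrix (Fin n) (Fin n) ℂ} (hx : x.IsHermitian)
    (k : ℕ) (hk : k ≤ n) : (leadingBlock x k hk).IsHermitian :=
  hx.submatrix _

/-- The Gelfand-Cetlin system: its component at `(i, j)` sends `x` to the `i`-th largest eigenvalue
(with multiplicity) of the leading principal submatrix of size `i + j - 1`. Mathlib's
`eigenvalues₀` lists the eigenvalues in decreasing order, counting from `0`. -/
def gelfandCetlin {n : ℕ} (l : Fin n → ℝ) (x : coadjointOrbit l) : GCIndex n → ℝ :=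
  fun p =>
    (leadingBlock_isHermitian (coadjointOrbit_isHermitian x.2) (p.1.1 + p.1.2 - 1)
      (by have := p.2; omega)).eigenvalues₀
      ⟨p.1.1 - 1, by have := p.2; rw [Fintype.card_fin]; omega⟩

/-- The fiber of the Gelfand-Cetlin system over `u`. -/
def gcFiber {n : ℕ} (l : Fin n → ℝ) (u : GCIndex n → ℝ) : Set (Matrix (Fin n) (Fin n) ℂ) :=
  {x | ∃ hx : x ∈ coadjointOrbit l, gelfandCetlin l ⟨x, hx⟩ = u}

/-! ### Complex projective spaces -/

/-- The matrix `v v* / (v* v)` of the orthogonal projection onto the line `ℓ = ℂ v`. -/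
def lineProjector {m : ℕ} (ℓ : Projectivization ℂ (Fin (m + 1) → ℂ)) :
    Matrix (Fin (m + 1)) (Fin (m + 1)) ℂ :=
  (star ℓ.rep ⬝ᵥ ℓ.rep)⁻¹ • Matrix.vecMulVec ℓ.rep (star ℓ.rep)

/-- The complex projective space `ℂP^m`, as the image of its standard smooth embedding into the
Hermitian matrices that sends a line to the orthogonal projection onto it. -/
def complexProjectiveSpace (m : ℕ) : Set (Matrix (Fin (m + 1)) (Fin (m + 1)) ℂ) :=
  Set.range lineProjector

/-- The co-adjoint orbit is diffeomorphic to a complex projective space (possibly a point). -/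
def OrbitIsProjectiveSpace {n : ℕ} (l : Fin n → ℝ) : Prop :=
  ∃ m : ℕ, Diffeomorphic (coadjointOrbit l) (complexProjectiveSpace m)

end GelfandCetlinDefs

/-!
The fiber of the Gelfand–Cetlin system through `h` consists of the Hermitian matrices all of whose
leading principal blocks are unitarily similar to those of `h`. The orbit is a projective space as
soon as some `n - 1` of the `l i` coincide; otherwise interlacing leaves enough room to choose `h`
in the orbit such that its `2 × 2` block is scalar, its `3 × 3` block is not, and every eigenvalue
of each larger block has an eigenvector whose last coordinate does not vanish.

The fiber through such an `h` is `S³ × (S¹)^ι`. Indeed, the first two entries of the third column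
form a vector of prescribed nonzero norm, which gives `S³`, and each later column is determined,
relative to an eigenbasis of the block it borders, by the phases of its nonzero entries, so that it
contributes circles only.

Any Hermitian matrix that pairs to zero with all `Y` for which `[Y, h]` is tangent to the fiber is
itself infinitesimally in the fiber, by duality of linear systems: the fiber is coisotropic. The
condition on the blocks of `h` makes the fiber isotropic, by induction: a tangent vector `[X, h]`
whose upper left block is tangent to the orbit of that block can be written with `X` supported in
the upper left block.

Finally, let `κ` have more elements than `ι`. The coordinates of a homeomorphism
`S³ × (S¹)^ι ≃ (S¹)^κ` have real logarithms on `S³ × ℝ^ι`, whose periods modulo 2 are `card κ`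
vectors in `(ℤ/2)^ι`, so that some nonempty subproduct of the coordinates has a continuous square
root. This is impossible, as it would give a continuous square root on the circle.
-/

open scoped ContDiff Topology
open Matrix

namespace GelfandCetlin

/-! ### Unitary similarity -/

section UnitarySimilarity

variable {m : Type*} [DecidableEq m]

theorem isHermitian_diagonal_ofReal (d : m → ℝ) :
    (diagonal fun i => (d i : ℂ)).IsHermitian :=
  isHermitian_diagonal_of_self_adjoint _ (funext fun i => Complex.conj_ofReal (d i))

variable [Fintype m]

theorem conjTranspose_mul_self_of_mem_unitaryGroup {U : Matrix m m ℂ}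
    (hU : U ∈ unitaryGroup m ℂ) : Uᴴ * U = 1 :=
  mem_unitaryGroup_iff'.1 hU

theorem mul_conjTranspose_self_of_mem_unitaryGroup {U : Matrix m m ℂ}
    (hU : U ∈ unitaryGroup m ℂ) : U * Uᴴ = 1 :=
  mem_unitaryGroup_iff.1 hU

theorem conjTranspose_mem_unitaryGroup {U : Matrix m m ℂ} (hU : U ∈ unitaryGroup m ℂ) :
    Uᴴ ∈ unitaryGroup m ℂ :=
  Unitary.star_mem hU

theorem conjTranspose_mul_conj_mul {U : Matrix m m ℂ} (hU : U ∈ unitaryGroup m ℂ)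
    (x : Matrix m m ℂ) : Uᴴ * (U * x * Uᴴ) * U = x := by
  have hUU := conjTranspose_mul_self_of_mem_unitaryGroup hU
  calc Uᴴ * (U * x * Uᴴ) * U = (Uᴴ * U) * x * (Uᴴ * U) := by simp only [mul_assoc]
    _ = x := by rw [hUU, one_mul, mul_one]

/-- Unitary similarity of complex square matrices. -/
def UnitarilySimilar (x y : Matrix m m ℂ) : Prop :=
  ∃ U ∈ unitaryGroup m ℂ, x = U * y * Uᴴ

namespace UnitarilySimilar

variable {x y z : Matrix m m ℂ}

theorem refl (x : Matrix m m ℂ) : UnitarilySimilar x x :=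
  ⟨1, one_mem _, by simp⟩

theorem symm (hxy : UnitarilySimilar x y) : UnitarilySimilar y x := by
  obtain ⟨U, hU, rfl⟩ := hxy
  exact ⟨Uᴴ, conjTranspose_mem_unitaryGroup hU, by
    rw [conjTranspose_conjTranspose, conjTranspose_mul_conj_mul hU]⟩

theorem trans (hxy : UnitarilySimilar x y) (hyz : UnitarilySimilar y z) :
    UnitarilySimilar x z := by
  obtain ⟨U, hU, rfl⟩ := hxy
  obtain ⟨V, hV, rfl⟩ := hyz
  exact ⟨U * V, mul_mem hU hV, by simp only [conjTranspose_mul, mul_assoc]⟩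

theorem isHermitian (hxy : UnitarilySimilar x y) (hy : y.IsHermitian) : x.IsHermitian := by
  obtain ⟨U, -, rfl⟩ := hxy
  exact isHermitian_mul_mul_conjTranspose _ hy

theorem charpoly_eq (hxy : UnitarilySimilar x y) : x.charpoly = y.charpoly := by
  obtain ⟨U, hU, rfl⟩ := hxy
  rw [charpoly_mul_comm, ← mul_assoc, conjTranspose_mul_self_of_mem_unitaryGroup hU, one_mul]

theorem trace_eq (hxy : UnitarilySimilar x y) : x.trace = y.trace := by
  obtain ⟨U, hU, rfl⟩ := hxy
  rw [trace_mul_comm, ← mul_assoc, conjTranspose_mul_self_of_mem_unitaryGroup hU, one_mul]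

theorem eq_smul_one {c : ℂ} (hx : UnitarilySimilar x (c • 1)) : x = c • 1 := by
  obtain ⟨U, hU, rfl⟩ := hx
  simp [mul_conjTranspose_self_of_mem_unitaryGroup hU]

end UnitarilySimilar

theorem unitarilySimilar_diagonal_eigenvalues {x : Matrix m m ℂ} (hx : x.IsHermitian) :
    UnitarilySimilar x (diagonal fun i => (hx.eigenvalues i : ℂ)) :=
  ⟨hx.eigenvectorUnitary, hx.eigenvectorUnitary.2, hx.spectral_theorem⟩

theorem unitarilySimilar_iff_charpoly_eq {x y : Matrix m m ℂ} (hx : x.IsHermitian)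
    (hy : y.IsHermitian) : UnitarilySimilar x y ↔ x.charpoly = y.charpoly := by
  refine ⟨UnitarilySimilar.charpoly_eq, fun hxy => ?_⟩
  have hx_diag := unitarilySimilar_diagonal_eigenvalues hx
  rw [(hx.eigenvalues_eq_eigenvalues_iff hy).2 hxy] at hx_diag
  exact hx_diag.trans (unitarilySimilar_diagonal_eigenvalues hy).symm

theorem unitarilySimilar_iff_eigenvalues₀_eq {x y : Matrix m m ℂ} (hx : x.IsHermitian)
    (hy : y.IsHermitian) : UnitarilySimilar x y ↔ hx.eigenvalues₀ = hy.eigenvalues₀ := by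
  rw [unitarilySimilar_iff_charpoly_eq hx hy, ← hx.eigenvalues_eq_eigenvalues_iff hy]
  exact (Fintype.equivOfCardEq (Fintype.card_fin _)).symm.surjective.injective_comp_right.eq_iff

end UnitarySimilarity

/-! ### Bordered matrices -/

section Bordered

variable {R : Type*} {n : ℕ}

/-- The `(n + 1) × (n + 1)` matrix with upper left block `y`, last column `(v, t)` and last row
`(w, t)`. Every square matrix of positive size is bordered, which is how inductions on the size of
a matrix proceed below. -/
def bordered (y : Matrix (Fin n) (Fin n) R) (v w : Fin n → R) (t : R) :
    Matrix (Fin (n + 1)) (Fin (n + 1)) R :=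
  of (Fin.snoc (α := fun _ => Fin (n + 1) → R)
    (fun i => Fin.snoc (α := fun _ => R) (y i) (v i)) (Fin.snoc (α := fun _ => R) w t))

/-- The block of a square matrix obtained by deleting its last row and its last column. -/
def initBlock (x : Matrix (Fin (n + 1)) (Fin (n + 1)) R) : Matrix (Fin n) (Fin n) R :=
  x.submatrix Fin.castSucc Fin.castSucc

/-- The last column of a square matrix, without its last entry. -/
def lastCol (x : Matrix (Fin (n + 1)) (Fin (n + 1)) R) : Fin n → R := fun i =>
  x i.castSucc (Fin.last n)

section Apply

variable (y : Matrix (Fin n) (Fin n) R) (v w : Fin n → R) (t : R) (i j : Fin n)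

@[simp] theorem bordered_castSucc_castSucc : bordered y v w t i.castSucc j.castSucc = y i j := by
  simp [bordered]

@[simp] theorem bordered_castSucc_last : bordered y v w t i.castSucc (Fin.last n) = v i := by
  simp [bordered]

@[simp] theorem bordered_last_castSucc : bordered y v w t (Fin.last n) j.castSucc = w j := by
  simp [bordered]

@[simp] theorem bordered_last_last : bordered y v w t (Fin.last n) (Fin.last n) = t := by
  simp [bordered]

@[simp] theorem initBlock_apply (x : Matrix (Fin (n + 1)) (Fin (n + 1)) R) :
    initBlock x i j = x i.castSucc j.castSucc := rfl

@[simp] theorem lastCol_apply (x : Matrix (Fin (n + 1)) (Fin (n + 1)) R) :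
    lastCol x i = x i.castSucc (Fin.last n) := rfl

@[simp] theorem initBlock_bordered : initBlock (bordered y v w t) = y := by
  ext i j; simp

@[simp] theorem lastCol_bordered : lastCol (bordered y v w t) = v := by
  ext i; simp

end Apply

theorem bordered_ext {x y : Matrix (Fin (n + 1)) (Fin (n + 1)) R}
    (hblock : ∀ i j : Fin n, x i.castSucc j.castSucc = y i.castSucc j.castSucc)
    (hcol : ∀ i : Fin n, x i.castSucc (Fin.last n) = y i.castSucc (Fin.last n))
    (hrow : ∀ i : Fin n, x (Fin.last n) i.castSucc = y (Fin.last n) i.castSucc)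
    (hcorner : x (Fin.last n) (Fin.last n) = y (Fin.last n) (Fin.last n)) : x = y := by
  ext i j
  induction i using Fin.lastCases with
  | last => induction j using Fin.lastCases with
    | last => exact hcorner
    | cast j => exact hrow j
  | cast i => induction j using Fin.lastCases with
    | last => exact hcol i
    | cast j => exact hblock i j

theorem eq_bordered (x : Matrix (Fin (n + 1)) (Fin (n + 1)) R) :
    x = bordered (initBlock x) (lastCol x) (fun j => x (Fin.last n) j.castSucc)
      (x (Fin.last n) (Fin.last n)) :=
  bordered_ext (by simp) (by simp) (by simp) (by simp)

theorem eq_bordered_of_isHermitian [Star R] {x : Matrix (Fin (n + 1)) (Fin (n + 1)) R}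
    (hx : x.IsHermitian) :
    x = bordered (initBlock x) (lastCol x) (star (lastCol x)) (x (Fin.last n) (Fin.last n)) :=
  bordered_ext (by simp) (by simp) (fun i => by simpa using (hx.apply _ i.castSucc).symm) (by simp)

theorem bordered_conjTranspose [Star R] (y : Matrix (Fin n) (Fin n) R) (v w : Fin n → R) (t : R) :
    (bordered y v w t)ᴴ = bordered yᴴ (star w) (star v) (star t) :=
  bordered_ext (by simp) (by simp) (by simp) (by simp)

theorem initBlock_isHermitian [Star R] {x : Matrix (Fin (n + 1)) (Fin (n + 1)) R}
    (hx : x.IsHermitian) : (initBlock x).IsHermitian := hx.submatrix _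

theorem trace_bordered [AddCommMonoid R] (y : Matrix (Fin n) (Fin n) R) (v w : Fin n → R) (t : R) :
    (bordered y v w t).trace = y.trace + t := by
  simp [trace, Fin.sum_univ_castSucc]

theorem trace_eq_trace_initBlock_add [AddCommMonoid R]
    (x : Matrix (Fin (n + 1)) (Fin (n + 1)) R) :
    x.trace = (initBlock x).trace + x (Fin.last n) (Fin.last n) := by
  simp [trace, Fin.sum_univ_castSucc]

theorem bordered_one [Zero R] [One R] : bordered (1 : Matrix (Fin n) (Fin n) R) 0 0 1 = 1 :=
  bordered_ext (by simp [one_apply]) (by simp [one_apply])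
    (by simp [one_apply, fun i : Fin n => (Fin.castSucc_ne_last i).symm]) (by simp)

variable [CommRing R]

theorem bordered_add (y y' : Matrix (Fin n) (Fin n) R) (v w v' w' : Fin n → R) (t t' : R) :
    bordered y v w t + bordered y' v' w' t' = bordered (y + y') (v + v') (w + w') (t + t') :=
  bordered_ext (by simp) (by simp) (by simp) (by simp)

theorem bordered_sub (y y' : Matrix (Fin n) (Fin n) R) (v w v' w' : Fin n → R) (t t' : R) :
    bordered y v w t - bordered y' v' w' t' = bordered (y - y') (v - v') (w - w') (t - t') :=
  bordered_ext (by simp) (by simp) (by simp) (by simp)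

theorem bordered_mul (y y' : Matrix (Fin n) (Fin n) R) (v w v' w' : Fin n → R) (t t' : R) :
    bordered y v w t * bordered y' v' w' t' =
      bordered (y * y' + vecMulVec v w') (y *ᵥ v' + t' • v) (w ᵥ* y' + t • w')
        (w ⬝ᵥ v' + t * t') := by
  refine bordered_ext (fun i j => ?_) (fun i => ?_) (fun i => ?_) ?_ <;>
  simp [mul_apply, Fin.sum_univ_castSucc, vecMulVec_apply, mulVec, vecMul, dotProduct, mul_comm]

theorem bordered_mulVec_snoc (y : Matrix (Fin n) (Fin n) R) (v w : Fin n → R) (t : R)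
    (u : Fin n → R) (a : R) :
    bordered y v w t *ᵥ (Fin.snoc u a : Fin (n + 1) → R) =
      (Fin.snoc (y *ᵥ u + a • v) (w ⬝ᵥ u + t * a) : Fin (n + 1) → R) := by
  ext i
  induction i using Fin.lastCases with
  | last => simp [mulVec, dotProduct, Fin.sum_univ_castSucc]
  | cast i => simp [mulVec, dotProduct, Fin.sum_univ_castSucc, mul_comm]

/-- The block diagonal matrix `g ⊕ 1`. -/
abbrev extendOne (g : Matrix (Fin n) (Fin n) R) : Matrix (Fin (n + 1)) (Fin (n + 1)) R :=
  bordered g 0 0 1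

/-- The block diagonal matrix `A ⊕ 0`. -/
abbrev extendZero (A : Matrix (Fin n) (Fin n) R) : Matrix (Fin (n + 1)) (Fin (n + 1)) R :=
  bordered A 0 0 0

theorem extendZero_lie (A y : Matrix (Fin n) (Fin n) R) (v w : Fin n → R) (t : R) :
    ⁅extendZero A, bordered y v w t⁆ = bordered ⁅A, y⁆ (A *ᵥ v) (-(w ᵥ* A)) 0 := by
  rw [Ring.lie_def, Ring.lie_def, bordered_mul, bordered_mul, bordered_sub]
  simp

theorem initBlock_extendZero_lie (A : Matrix (Fin n) (Fin n) R)
    (x : Matrix (Fin (n + 1)) (Fin (n + 1)) R) :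
    initBlock ⁅extendZero A, x⁆ = ⁅A, initBlock x⁆ := by
  conv_lhs => rw [eq_bordered x]
  rw [extendZero_lie, initBlock_bordered]

variable [StarRing R]

theorem extendOne_conj (g y : Matrix (Fin n) (Fin n) R) (v w : Fin n → R) (t : R) :
    extendOne g * bordered y v w t * (extendOne g)ᴴ =
      bordered (g * y * gᴴ) (g *ᵥ v) (w ᵥ* gᴴ) t := by
  rw [bordered_conjTranspose, bordered_mul, bordered_mul]
  simp

theorem initBlock_extendOne_conj (g : Matrix (Fin n) (Fin n) R)
    (x : Matrix (Fin (n + 1)) (Fin (n + 1)) R) :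
    initBlock (extendOne g * x * (extendOne g)ᴴ) = g * initBlock x * gᴴ := by
  conv_lhs => rw [eq_bordered x]
  rw [extendOne_conj, initBlock_bordered]

theorem lastCol_extendOne_conj (g : Matrix (Fin n) (Fin n) R)
    (x : Matrix (Fin (n + 1)) (Fin (n + 1)) R) :
    lastCol (extendOne g * x * (extendOne g)ᴴ) = g *ᵥ lastCol x := by
  conv_lhs => rw [eq_bordered x]
  rw [extendOne_conj, lastCol_bordered]

theorem extendOne_mem_unitaryGroup {g : Matrix (Fin n) (Fin n) R}
    (hg : g ∈ unitaryGroup (Fin n) R) : extendOne g ∈ unitaryGroup (Fin (n + 1)) R := by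
  have hgg : gᴴ * g = 1 := mem_unitaryGroup_iff'.1 hg
  rw [mem_unitaryGroup_iff', star_eq_conjTranspose, bordered_conjTranspose, bordered_mul]
  simp [hgg, bordered_one]

end Bordered

/-! ### The fibers of the Gelfand–Cetlin system -/

section SpectralFiber

variable {n : ℕ}

/-- The matrices all of whose leading principal submatrices are unitarily similar to the
corresponding ones of `h`; for `h` in a co-adjoint orbit, this is the Gelfand–Cetlin fiber
through `h`. -/
def spectralFiber (h : Matrix (Fin n) (Fin n) ℂ) : Set (Matrix (Fin n) (Fin n) ℂ) :=
  {x | ∀ k (hk : k ≤ n), UnitarilySimilar (leadingBlock x k hk) (leadingBlock h k hk)}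

theorem self_mem_spectralFiber (h : Matrix (Fin n) (Fin n) ℂ) : h ∈ spectralFiber h :=
  fun _ _ => .refl _

theorem spectralFiber_eq_of_mem {h x : Matrix (Fin n) (Fin n) ℂ} (hx : x ∈ spectralFiber h) :
    spectralFiber x = spectralFiber h :=
  Set.ext fun _ => ⟨fun hy k hk => (hy k hk).trans (hx k hk),
    fun hy k hk => (hy k hk).trans (hx k hk).symm⟩

theorem unitarilySimilar_of_mem_spectralFiber {h x : Matrix (Fin n) (Fin n) ℂ}
    (hx : x ∈ spectralFiber h) : UnitarilySimilar x h :=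
  hx n le_rfl

theorem mem_spectralFiber_succ {h x : Matrix (Fin (n + 1)) (Fin (n + 1)) ℂ} :
    x ∈ spectralFiber h ↔ UnitarilySimilar x h ∧ initBlock x ∈ spectralFiber (initBlock h) := by
  refine ⟨fun hx => ⟨hx _ le_rfl, fun k hk => hx k (hk.trans n.le_succ)⟩, ?_⟩
  rintro ⟨hxh, hx⟩ k hk
  obtain rfl | hk' := Nat.of_le_succ hk |>.symm
  · exact hxh
  · exact hx k hk'

theorem gcFiber_gelfandCetlin {l : Fin n → ℝ} {h : Matrix (Fin n) (Fin n) ℂ}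
    (hh : h ∈ coadjointOrbit l) : gcFiber l (gelfandCetlin l ⟨h, hh⟩) = spectralFiber h := by
  ext x
  constructor
  · rintro ⟨hx, hxh⟩ k hk
    rw [unitarilySimilar_iff_eigenvalues₀_eq
      (leadingBlock_isHermitian (coadjointOrbit_isHermitian hx) k hk)
      (leadingBlock_isHermitian (coadjointOrbit_isHermitian hh) k hk)]
    ext ⟨i, hi⟩
    rw [Fintype.card_fin] at hi
    obtain ⟨j, rfl⟩ : ∃ j, k = i + 1 + (j + 1) - 1 := ⟨k - i - 1, by omega⟩
    exact congrFun hxh ⟨(i + 1, j + 1), by omega, by omega, by omega⟩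
  · intro hx
    have hx_mem : x ∈ coadjointOrbit l := (unitarilySimilar_of_mem_spectralFiber hx).trans hh
    refine ⟨hx_mem, funext fun p => ?_⟩
    exact congrFun ((unitarilySimilar_iff_eigenvalues₀_eq
      (leadingBlock_isHermitian (coadjointOrbit_isHermitian hx_mem) _ _)
      (leadingBlock_isHermitian (coadjointOrbit_isHermitian hh) _ _)).1 (hx _ _)) _

end SpectralFiber

/-! ### Tangent spaces of co-adjoint orbits and of fibers -/

section Bracket

variable {n : ℕ}

theorem add_mem_skewHermitian {A B : Matrix (Fin n) (Fin n) ℂ} (hA : A ∈ skewHermitian n)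
    (hB : B ∈ skewHermitian n) : A + B ∈ skewHermitian n :=
  (skewAdjoint (Matrix (Fin n) (Fin n) ℂ)).add_mem hA hB

theorem sub_mem_skewHermitian {A B : Matrix (Fin n) (Fin n) ℂ} (hA : A ∈ skewHermitian n)
    (hB : B ∈ skewHermitian n) : A - B ∈ skewHermitian n :=
  (skewAdjoint (Matrix (Fin n) (Fin n) ℂ)).sub_mem hA hB

theorem zero_mem_skewHermitian : (0 : Matrix (Fin n) (Fin n) ℂ) ∈ skewHermitian n :=
  (skewAdjoint (Matrix (Fin n) (Fin n) ℂ)).zero_mem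

theorem conj_mem_skewHermitian {X : Matrix (Fin n) (Fin n) ℂ} (hX : X ∈ skewHermitian n)
    (U : Matrix (Fin n) (Fin n) ℂ) : U * X * Uᴴ ∈ skewHermitian n :=
  skewAdjoint.conjugate hX U

theorem extendZero_mem_skewHermitian {A : Matrix (Fin n) (Fin n) ℂ} (hA : A ∈ skewHermitian n) :
    extendZero A ∈ skewHermitian (n + 1) := by
  change (extendZero A)ᴴ = -extendZero A
  rw [bordered_conjTranspose, show Aᴴ = -A from hA]
  exact bordered_ext (by simp) (by simp) (by simp) (by simp)

theorem isHermitian_lie {X h : Matrix (Fin n) (Fin n) ℂ} (hX : X ∈ skewHermitian n)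
    (hh : h.IsHermitian) : ⁅X, h⁆.IsHermitian := by
  rw [IsHermitian, Ring.lie_def, conjTranspose_sub, conjTranspose_mul, conjTranspose_mul,
    show Xᴴ = -X from hX, hh.eq]
  noncomm_ring

theorem lie_swap {R : Type*} [Ring R] (x y : R) : ⁅x, y⁆ = -⁅y, x⁆ := by
  simp only [Ring.lie_def, neg_sub]

theorem conj_lie_conj {m : Type*} [Fintype m] [DecidableEq m] {U : Matrix m m ℂ}
    (hU : U ∈ unitaryGroup m ℂ) (X h : Matrix m m ℂ) :
    ⁅U * X * Uᴴ, U * h * Uᴴ⁆ = U * ⁅X, h⁆ * Uᴴ := by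
  have conj_mul_conj (A B : Matrix m m ℂ) : U * A * Uᴴ * (U * B * Uᴴ) = U * (A * B) * Uᴴ :=
    (map_mul (Unitary.conjStarAlgAut ℂ _ ⟨U, hU⟩) A B).symm
  rw [Ring.lie_def, Ring.lie_def, conj_mul_conj, conj_mul_conj, mul_sub, sub_mul]

theorem lie_diagonal_apply {R m : Type*} [CommRing R] [Fintype m] [DecidableEq m]
    (X : Matrix m m R) (d : m → R) (i j : m) :
    ⁅X, diagonal d⁆ i j = X i j * (d j - d i) := by
  simp [Ring.lie_def, mul_diagonal, diagonal_mul]; ring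

theorem trace_lie_mul {R m : Type*} [CommRing R] [Fintype m] (X h Y : Matrix m m R) :
    (⁅X, h⁆ * Y).trace = (X * ⁅h, Y⁆).trace := by
  simp only [Ring.lie_def, mul_sub, sub_mul, trace_sub]
  rw [mul_assoc h X Y, trace_mul_comm h (X * Y)]
  simp only [mul_assoc]

/-- The tangent space `{[X, h] | X ∈ 𝔲(n)}` at `h` of the co-adjoint orbit through `h`. -/
def orbitTangent (h : Matrix (Fin n) (Fin n) ℂ) : Set (Matrix (Fin n) (Fin n) ℂ) :=
  {δ | ∃ X ∈ skewHermitian n, δ = ⁅X, h⁆}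

theorem zero_mem_orbitTangent (h : Matrix (Fin n) (Fin n) ℂ) : 0 ∈ orbitTangent h :=
  ⟨0, zero_mem_skewHermitian, by simp [Ring.lie_def]⟩

theorem conj_mem_orbitTangent {U h δ : Matrix (Fin n) (Fin n) ℂ}
    (hU : U ∈ unitaryGroup (Fin n) ℂ) (hδ : δ ∈ orbitTangent h) :
    U * δ * Uᴴ ∈ orbitTangent (U * h * Uᴴ) := by
  obtain ⟨X, hX, rfl⟩ := hδ
  exact ⟨U * X * Uᴴ, conj_mem_skewHermitian hX U, (conj_lie_conj hU X h).symm⟩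

theorem mem_orbitTangent_diagonal {δ : Matrix (Fin n) (Fin n) ℂ} {d : Fin n → ℝ}
    (hδ : δ.IsHermitian) (hzero : ∀ i j, d i = d j → δ i j = 0) :
    δ ∈ orbitTangent (diagonal fun i => (d i : ℂ)) := by
  refine ⟨of fun i j => δ i j / ((d j : ℂ) - d i), ?_, ?_⟩
  · ext i j
    simp only [conjTranspose_apply, of_apply, star_div₀, hδ.apply, star_sub, Complex.star_def,
      Complex.conj_ofReal]
    change _ = -(δ i j / ((d j : ℂ) - d i))
    rw [← div_neg, neg_sub]
  · ext i j
    rw [lie_diagonal_apply, of_apply]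
    by_cases hij : d i = d j
    · rw [hzero i j hij, zero_div, zero_mul]
    · rw [div_mul_cancel₀ _ (sub_ne_zero.2 (Complex.ofReal_injective.ne (Ne.symm hij)))]

theorem mem_orbitTangent_of_conj {U h δ : Matrix (Fin n) (Fin n) ℂ}
    (hU : U ∈ unitaryGroup (Fin n) ℂ) (hδ : Uᴴ * δ * U ∈ orbitTangent h) :
    δ ∈ orbitTangent (U * h * Uᴴ) := by
  have hUδ := conj_mem_orbitTangent hU hδ
  have hUδU := conjTranspose_mul_conj_mul (conjTranspose_mem_unitaryGroup hU) δ
  rw [conjTranspose_conjTranspose] at hUδU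
  rwa [hUδU] at hUδ

open scoped ComplexOrder in
/-- Test against `Z = i P`, where `P` is the block diagonal part of `δ`: then `tr (δ Z)` is
`i tr (P* P)`. -/
theorem mem_orbitTangent_diagonal_of_trace_mul_eq_zero {δ : Matrix (Fin n) (Fin n) ℂ}
    {d : Fin n → ℝ} (hδ : δ.IsHermitian)
    (htrace : ∀ Z ∈ skewHermitian n, ⁅Z, diagonal fun i => (d i : ℂ)⁆ = 0 → (δ * Z).trace = 0) :
    δ ∈ orbitTangent (diagonal fun i => (d i : ℂ)) := by
  let P : Matrix (Fin n) (Fin n) ℂ := of fun i j => if d i = d j then δ i j else 0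
  have hP : P.IsHermitian := by
    ext i j
    by_cases hij : d i = d j
    · simp [P, hij, hδ.apply]
    · simp [P, hij, Ne.symm hij]
  have hP_skew : Complex.I • P ∈ skewHermitian n := by
    change (Complex.I • P)ᴴ = _
    rw [conjTranspose_smul, hP.eq]; simp
  have hP_comm : ⁅Complex.I • P, diagonal fun i => (d i : ℂ)⁆ = 0 := by
    ext i j
    rw [lie_diagonal_apply]
    by_cases hij : d i = d j <;> simp [P, hij]
  have hPP : (δ * P).trace = (Pᴴ * P).trace := by
    simp only [trace, diag_apply, mul_apply, hP.eq]
    refine Finset.sum_congr rfl fun i _ => Finset.sum_congr rfl fun j _ => ?_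
    by_cases hij : d i = d j
    · simp [P, hij]
    · simp [P, hij, Ne.symm hij]
  have hP_zero : P = 0 := by
    have hI := htrace _ hP_skew hP_comm
    rw [Matrix.mul_smul, trace_smul, smul_eq_zero_iff_right Complex.I_ne_zero, hPP] at hI
    exact trace_conjTranspose_mul_self_eq_zero_iff.1 hI
  refine mem_orbitTangent_diagonal hδ fun i j hij => ?_
  simpa [P, hij] using congrFun₂ hP_zero i j

theorem mem_orbitTangent_of_trace_mul_eq_zero {h δ : Matrix (Fin n) (Fin n) ℂ}
    (hh : h.IsHermitian) (hδ : δ.IsHermitian)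
    (htrace : ∀ Z ∈ skewHermitian n, ⁅Z, h⁆ = 0 → (δ * Z).trace = 0) : δ ∈ orbitTangent h := by
  obtain ⟨U, hU, hUh⟩ := unitarilySimilar_diagonal_eigenvalues hh
  rw [hUh]
  refine mem_orbitTangent_of_conj hU (mem_orbitTangent_diagonal_of_trace_mul_eq_zero
    (isHermitian_conjTranspose_mul_mul U hδ) fun Z hZ hZd => ?_)
  have hUZ := htrace _ (conj_mem_skewHermitian hZ U) (by
    rw [hUh, conj_lie_conj hU, hZd, mul_zero, zero_mul])
  rw [← hUZ, mul_assoc, mul_assoc, trace_mul_comm Uᴴ]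
  simp only [mul_assoc]

theorem kks_eq_im_trace (h X Y : Matrix (Fin n) (Fin n) ℂ) :
    kks h X Y = (⁅X, h⁆ * Y).trace.im := by
  rw [kks, ← trace_lie_mul, lie_swap h X, neg_mul, trace_neg]
  simp

theorem kks_swap (h X Y : Matrix (Fin n) (Fin n) ℂ) : kks h X Y = -kks h Y X := by
  rw [kks, kks, lie_swap X Y, mul_neg, trace_neg, mul_neg, Complex.neg_re]

theorem kks_congr {h X Y X' Y' : Matrix (Fin n) (Fin n) ℂ} (hX : ⁅X, h⁆ = ⁅X', h⁆)
    (hY : ⁅Y, h⁆ = ⁅Y', h⁆) : kks h X Y = kks h X' Y' := by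
  rw [kks_eq_im_trace, hX, ← kks_eq_im_trace, kks_swap, kks_eq_im_trace, hY, ← kks_eq_im_trace,
    ← kks_swap]

theorem kks_extendZero (h : Matrix (Fin (n + 1)) (Fin (n + 1)) ℂ)
    (A B : Matrix (Fin n) (Fin n) ℂ) :
    kks h (extendZero A) (extendZero B) = kks (initBlock h) A B := by
  rw [kks_eq_im_trace, kks_eq_im_trace, eq_bordered h, extendZero_lie, bordered_mul,
    trace_bordered, initBlock_bordered]
  simp

theorem re_trace_mul_eq_zero {δ Y : Matrix (Fin n) (Fin n) ℂ} (hδ : δ.IsHermitian)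
    (hY : Y ∈ skewHermitian n) : (δ * Y).trace.re = 0 := by
  have hstar : star (δ * Y).trace = -(δ * Y).trace := by
    rw [← trace_conjTranspose, conjTranspose_mul, show Yᴴ = -Y from hY, hδ.eq, neg_mul, trace_neg,
      trace_mul_comm]
  have hre := congrArg Complex.re hstar
  rw [Complex.star_def, Complex.conj_re, Complex.neg_re] at hre
  linarith

/-- The matrices all of whose leading principal submatrices are tangent to the co-adjoint orbits
through the corresponding ones of `h`. It contains the tangent space at `h` of `spectralFiber h`,
and is equal to it when `h` is nondegenerate. -/
def infinitesimalFiber (h : Matrix (Fin n) (Fin n) ℂ) : Set (Matrix (Fin n) (Fin n) ℂ) :=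
  {δ | ∀ k (hk : k ≤ n), leadingBlock δ k hk ∈ orbitTangent (leadingBlock h k hk)}

theorem zero_mem_infinitesimalFiber (h : Matrix (Fin n) (Fin n) ℂ) : 0 ∈ infinitesimalFiber h :=
  fun _ _ => zero_mem_orbitTangent _

theorem mem_infinitesimalFiber_succ {h δ : Matrix (Fin (n + 1)) (Fin (n + 1)) ℂ} :
    δ ∈ infinitesimalFiber h ↔
      δ ∈ orbitTangent h ∧ initBlock δ ∈ infinitesimalFiber (initBlock h) := by
  refine ⟨fun hδ => ⟨hδ _ le_rfl, fun k hk => hδ k (hk.trans n.le_succ)⟩, ?_⟩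
  rintro ⟨hδh, hδ⟩ k hk
  obtain rfl | hk' := Nat.of_le_succ hk |>.symm
  · exact hδh
  · exact hδ k hk'

theorem mem_infinitesimalFiber_of_trace_mul_eq_zero {n : ℕ} {h δ : Matrix (Fin n) (Fin n) ℂ}
    (hh : h.IsHermitian) (hδ : δ.IsHermitian)
    (htrace : ∀ Y ∈ skewHermitian n, ⁅Y, h⁆ ∈ infinitesimalFiber h → (δ * Y).trace = 0) :
    δ ∈ infinitesimalFiber h := by
  induction n with
  | zero =>
    intro k hk
    obtain rfl := Nat.le_zero.1 hk
    exact ⟨0, zero_mem_skewHermitian, Subsingleton.elim _ _⟩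
  | succ n ih =>
    refine mem_infinitesimalFiber_succ.2
      ⟨mem_orbitTangent_of_trace_mul_eq_zero hh hδ fun Z hZ hZh => htrace Z hZ ?_,
        ih (initBlock_isHermitian hh) (initBlock_isHermitian hδ) fun Y hY hYh => ?_⟩
    · rw [hZh]; exact zero_mem_infinitesimalFiber h
    · have hδY := htrace (extendZero Y) (extendZero_mem_skewHermitian hY)
        (mem_infinitesimalFiber_succ.2 ⟨⟨_, extendZero_mem_skewHermitian hY, rfl⟩, by
          rwa [initBlock_extendZero_lie]⟩)
      rw [eq_bordered δ, bordered_mul, trace_bordered] at hδY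
      simpa using hδY

end Bracket

/-! ### Nondegenerate matrices and isotropy -/

section SpectralProjections

open Polynomial

variable {m : Type*} [Fintype m] [DecidableEq m]

theorem aeval_conj_diagonal {U : Matrix m m ℂ} (hU : U ∈ unitaryGroup m ℂ) (d : m → ℝ)
    (p : ℝ[X]) :
    aeval (U * diagonal (fun i => (d i : ℂ)) * Uᴴ) p =
      U * diagonal (fun i => ((p.eval (d i) : ℝ) : ℂ)) * Uᴴ := by
  let conj : Matrix m m ℂ ≃⋆ₐ[ℝ] Matrix m m ℂ := Unitary.conjStarAlgAut ℝ _ ⟨U, hU⟩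
  have haeval : aeval (conj (diagonalAlgHom ℝ fun i => (d i : ℂ))) p =
      conj (diagonalAlgHom ℝ (aeval (fun i => (d i : ℂ)) p)) := by
    rw [← aeval_algHom_apply, ← aeval_algHom_apply]
  have heval : aeval (fun i => (d i : ℂ)) p = fun i => ((p.eval (d i) : ℝ) : ℂ) := by
    ext i
    rw [aeval_pi_apply₂, ← Complex.coe_algebraMap, aeval_algebraMap_apply, coe_aeval_eq_eval]
  rw [heval] at haeval
  exact haeval

theorem aeval_eq_of_eval_eigenvalues_eq {y : Matrix m m ℂ} (hy : y.IsHermitian) {p q : ℝ[X]}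
    (hpq : ∀ i, p.eval (hy.eigenvalues i) = q.eval (hy.eigenvalues i)) :
    aeval y p = aeval y q := by
  obtain ⟨U, hU, hUy⟩ := unitarilySimilar_diagonal_eigenvalues hy
  rw [hUy, aeval_conj_diagonal hU, aeval_conj_diagonal hU]
  simp only [hpq]

theorem isHermitian_aeval {y : Matrix m m ℂ} (hy : y.IsHermitian) (p : ℝ[X]) :
    (aeval y p).IsHermitian := by
  obtain ⟨U, hU, hUy⟩ := unitarilySimilar_diagonal_eigenvalues hy
  rw [hUy, aeval_conj_diagonal hU]
  exact isHermitian_mul_mul_conjTranspose _ (isHermitian_diagonal_ofReal _)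

/-- The spectral projections of a Hermitian matrix are real polynomials in it, namely the Lagrange
basis polynomials of its spectrum. -/
theorem exists_spectral_projections {y : Matrix m m ℂ} (hy : y.IsHermitian) :
    ∃ (s : Finset ℝ) (q : ℝ → ℝ[X]), ∑ θ ∈ s, aeval y (q θ) = 1 ∧ ∀ θ ∈ s, (q θ).eval θ = 1 ∧
      aeval y (q θ) * aeval y (q θ) = aeval y (q θ) ∧
      y * aeval y (q θ) = (θ : ℂ) • aeval y (q θ) := by
  let s := Finset.univ.image hy.eigenvalues
  let q := Lagrange.basis s id
  have eval_self : ∀ θ ∈ s, (q θ).eval θ = 1 := fun θ hθ =>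
    Lagrange.eval_basis_self (Set.injOn_id _) hθ
  have eval_of_ne : ∀ θ, ∀ η ∈ s, η ≠ θ → (q θ).eval η = 0 := fun θ η hη hne =>
    Lagrange.eval_basis_of_ne (v := id) hne.symm hη
  have mem_s : ∀ i, hy.eigenvalues i ∈ s := fun i => Finset.mem_image_of_mem _ (Finset.mem_univ i)
  refine ⟨s, q, ?_, fun θ hθ => ⟨eval_self θ hθ, ?_, ?_⟩⟩
  · rw [← map_sum, ← map_one (aeval (R := ℝ) y)]
    refine aeval_eq_of_eval_eigenvalues_eq hy fun i => ?_
    rw [eval_finsetSum, Finset.sum_eq_single_of_mem _ (mem_s i)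
      fun θ _ hne => eval_of_ne θ _ (mem_s i) hne.symm, eval_self _ (mem_s i), eval_one]
  · rw [← map_mul]
    refine aeval_eq_of_eval_eigenvalues_eq hy fun i => ?_
    by_cases hi : hy.eigenvalues i = θ
    · rw [eval_mul, hi, eval_self θ hθ, one_mul]
    · rw [eval_mul, eval_of_ne θ _ (mem_s i) hi, zero_mul]
  · have hXq : aeval y (X * q θ) = aeval y (C θ * q θ) := by
      refine aeval_eq_of_eval_eigenvalues_eq hy fun i => ?_
      by_cases hi : hy.eigenvalues i = θ
      · rw [eval_mul, eval_mul, eval_X, eval_C, hi]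
      · rw [eval_mul, eval_mul, eval_of_ne θ _ (mem_s i) hi, mul_zero, mul_zero]
    rw [map_mul, aeval_X, map_mul, aeval_C] at hXq
    rw [hXq, Algebra.algebraMap_eq_smul_one, smul_mul_assoc, one_mul, Complex.coe_smul]

theorem aeval_mulVec_of_mulVec_eq {y : Matrix m m ℂ} {u : m → ℂ} {θ : ℝ}
    (hu : y *ᵥ u = (θ : ℂ) • u) (p : ℝ[X]) : aeval y p *ᵥ u = ((p.eval θ : ℝ) : ℂ) • u := by
  induction p using Polynomial.induction_on' with
  | add p q hp hq => rw [map_add, add_mulVec, hp, hq, eval_add, Complex.ofReal_add, add_smul]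
  | monomial k a =>
    have hpow : y ^ k *ᵥ u = (θ : ℂ) ^ k • u := by
      induction k with
      | zero => simp
      | succ k ih => rw [pow_succ, ← mulVec_mulVec, hu, mulVec_smul, ih, smul_smul, pow_succ']
    rw [aeval_monomial, ← mulVec_mulVec, hpow, eval_monomial, Algebra.algebraMap_eq_smul_one,
      smul_mulVec, one_mulVec, ← Complex.coe_smul, smul_smul, Complex.ofReal_mul,
      Complex.ofReal_pow]

open scoped ComplexOrder in
theorem exists_skewAdjoint_mulVec_eq {ι : Type*} [Fintype ι] {v w : ι → ℂ} (hvw : v = 0 → w = 0)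
    (hre : (star w ⬝ᵥ v).re = 0) : ∃ A : Matrix ι ι ℂ, Aᴴ = -A ∧ A *ᵥ v = w := by
  set N : ℂ := star v ⬝ᵥ v with hN
  set S : ℂ := star w ⬝ᵥ v with hS
  have hN_star : star N = N := (star_dotProduct v v).symm
  have hS_star : star S = -S := by
    apply Complex.ext <;> simp [hre]
  refine ⟨N⁻¹ • (vecMulVec w (star v) - vecMulVec v (star w)) +
    (S * N⁻¹ ^ 2) • vecMulVec v (star v), ?_, ?_⟩
  · simp only [conjTranspose_add, conjTranspose_smul, conjTranspose_sub, conjTranspose_vecMulVec,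
      star_star, star_mul', star_pow, star_inv₀, hN_star, hS_star]
    module
  · rw [add_mulVec, smul_mulVec, smul_mulVec, sub_mulVec, vecMulVec_mulVec, vecMulVec_mulVec,
      vecMulVec_mulVec, ← hN, ← hS]
    by_cases hv : v = 0
    · simp [hv, hvw hv]
    · have hN_ne : N ≠ 0 := fun h => hv (dotProduct_star_self_eq_zero.1 h)
      simp only [op_smul_eq_smul, smul_sub, smul_smul]
      rw [inv_mul_cancel₀ hN_ne, show S * N⁻¹ ^ 2 * N = N⁻¹ * S by field_simp]
      module

end SpectralProjections

section Nondegenerate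

open Polynomial

variable {n : ℕ}

/-- Nondegeneracy of the last step of the sequence of leading principal submatrices: every
eigenvalue of the upper left block either has an eigenvector pairing nontrivially with the last
column, or has an eigenvector of the whole matrix with nonzero last coordinate. -/
def IsNondegenerateAt (h : Matrix (Fin (n + 1)) (Fin (n + 1)) ℂ) : Prop :=
  ∀ (θ : ℝ) (u : Fin n → ℂ), u ≠ 0 → initBlock h *ᵥ u = (θ : ℂ) • u →
    (∃ u', initBlock h *ᵥ u' = (θ : ℂ) • u' ∧ star (lastCol h) ⬝ᵥ u' ≠ 0) ∨
    ∃ p : Fin n → ℂ, h *ᵥ (Fin.snoc p 1 : Fin (n + 1) → ℂ) =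
      (θ : ℂ) • (Fin.snoc p 1 : Fin (n + 1) → ℂ)

/-- Nondegeneracy of every step of the sequence of leading principal submatrices. It makes the
fiber through `h` isotropic. -/
def IsNondegenerate (h : Matrix (Fin n) (Fin n) ℂ) : Prop :=
  ∀ k (hk : k + 1 ≤ n), IsNondegenerateAt (leadingBlock h (k + 1) hk)

theorem isNondegenerate_succ {h : Matrix (Fin (n + 1)) (Fin (n + 1)) ℂ} :
    IsNondegenerate h ↔ IsNondegenerateAt h ∧ IsNondegenerate (initBlock h) := by
  refine ⟨fun hh => ⟨hh n le_rfl, fun k hk => hh k (hk.trans n.le_succ)⟩, ?_⟩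
  rintro ⟨hn, hh⟩ k hk
  obtain rfl | hk' := (Nat.le_of_succ_le_succ hk).eq_or_lt
  · exact hn
  · exact hh k hk'

theorem exists_commute_lastCol_eq {h : Matrix (Fin (n + 1)) (Fin (n + 1)) ℂ}
    (hh : h.IsHermitian) (q : ℝ[X]) :
    ∃ B : Matrix (Fin (n + 1)) (Fin (n + 1)) ℂ, B.IsHermitian ∧ Commute h B ∧
      lastCol B = aeval (initBlock h) q *ᵥ lastCol h := by
  induction q using Polynomial.induction_on with
  | C a =>
    refine ⟨a • h, hh.smul (IsSelfAdjoint.all a), (Commute.refl h).smul_right a, ?_⟩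
    rw [aeval_C, Algebra.algebraMap_eq_smul_one, smul_mulVec, one_mulVec]
    rfl
  | add p q hp hq =>
    obtain ⟨B, hB, hB_comm, hB_col⟩ := hp
    obtain ⟨C, hC, hC_comm, hC_col⟩ := hq
    refine ⟨B + C, hB.add hC, hB_comm.add_right hC_comm, ?_⟩
    rw [map_add, add_mulVec, ← hB_col, ← hC_col]
    rfl
  | monomial k a ih =>
    obtain ⟨B, hB, hB_comm, hB_col⟩ := ih
    let t := B (Fin.last n) (Fin.last n)
    have ht : star t = t := hB.apply _ _
    refine ⟨h * B - t • h, ?_, ((Commute.refl h).mul_right hB_comm).sub_right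
      ((Commute.refl h).smul_right t), ?_⟩
    · rw [IsHermitian, conjTranspose_sub, conjTranspose_mul, conjTranspose_smul, hB.eq, hh.eq, ht,
        hB_comm.eq]
    · have hmul : lastCol (h * B) = initBlock h *ᵥ lastCol B + t • lastCol h := by
        conv_lhs => rw [eq_bordered h, eq_bordered B, bordered_mul, lastCol_bordered]
      change lastCol (h * B) - t • lastCol h = _
      rw [hmul, add_sub_cancel_right, hB_col, mulVec_mulVec, pow_succ', mul_left_comm,
        map_mul _ X, aeval_X]

theorem re_dotProduct_aeval_mulVec_eq_zero {X h : Matrix (Fin (n + 1)) (Fin (n + 1)) ℂ}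
    {w : Fin n → ℂ} (hh : h.IsHermitian) (hX : ⁅X, h⁆ = bordered 0 w (star w) 0) (q : ℝ[X]) :
    (star w ⬝ᵥ aeval (initBlock h) q *ᵥ lastCol h).re = 0 := by
  obtain ⟨B, hB, hB_comm, hB_col⟩ := exists_commute_lastCol_eq hh q
  have htrace : (⁅X, h⁆ * B).trace = 0 := by
    rw [trace_lie_mul, Ring.lie_def, hB_comm.eq, sub_self, mul_zero, trace_zero]
  rw [hX, eq_bordered_of_isHermitian hB, bordered_mul, trace_bordered, hB_col] at htrace
  simp only [zero_mul, zero_add, add_zero, trace_vecMulVec] at htrace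
  rw [dotProduct_comm, star_dotProduct] at htrace
  have hre := congrArg Complex.re htrace
  rw [Complex.add_re, Complex.star_def, Complex.conj_re, Complex.zero_re] at hre
  linarith

theorem smul_snoc (c a : ℂ) (p : Fin n → ℂ) :
    c • (Fin.snoc p a : Fin (n + 1) → ℂ) = (Fin.snoc (c • p) (c * a) : Fin (n + 1) → ℂ) := by
  ext j; induction j using Fin.lastCases <;> simp

theorem mulVec_snoc_of_isHermitian {h : Matrix (Fin (n + 1)) (Fin (n + 1)) ℂ}
    (hh : h.IsHermitian) (p : Fin n → ℂ) (a : ℂ) :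
    h *ᵥ (Fin.snoc p a : Fin (n + 1) → ℂ) =
      (Fin.snoc (initBlock h *ᵥ p + a • lastCol h)
        (star (lastCol h) ⬝ᵥ p + h (Fin.last n) (Fin.last n) * a) : Fin (n + 1) → ℂ) := by
  conv_lhs => rw [eq_bordered_of_isHermitian hh]
  rw [bordered_mulVec_snoc]

theorem mulVec_snoc_zero_eq_smul {h : Matrix (Fin (n + 1)) (Fin (n + 1)) ℂ}
    (hh : h.IsHermitian) {θ : ℝ} {u : Fin n → ℂ} (hu : initBlock h *ᵥ u = (θ : ℂ) • u)
    (hu_col : star (lastCol h) ⬝ᵥ u = 0) :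
    h *ᵥ (Fin.snoc u 0 : Fin (n + 1) → ℂ) = (θ : ℂ) • (Fin.snoc u 0 : Fin (n + 1) → ℂ) := by
  rw [mulVec_snoc_of_isHermitian hh, hu, hu_col, smul_snoc, zero_smul, add_zero, mul_zero,
    mul_zero, add_zero]

/-- Pairing `[X, h]` with the eigenvectors `(u, 0)` and `(p, 1)` of `h` for the same eigenvalue. -/
theorem star_dotProduct_eq_zero_of_eigenvectors {X h : Matrix (Fin (n + 1)) (Fin (n + 1)) ℂ}
    {u w p : Fin n → ℂ} {θ : ℝ} (hh : h.IsHermitian) (hX : ⁅X, h⁆ = bordered 0 w (star w) 0)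
    (hu : initBlock h *ᵥ u = (θ : ℂ) • u) (hu_col : star (lastCol h) ⬝ᵥ u = 0)
    (hp : h *ᵥ (Fin.snoc p 1 : Fin (n + 1) → ℂ) = (θ : ℂ) • (Fin.snoc p 1 : Fin (n + 1) → ℂ)) :
    star u ⬝ᵥ w = 0 := by
  set u₀ : Fin (n + 1) → ℂ := Fin.snoc u 0 with hu₀
  have hu₀_right : h *ᵥ u₀ = (θ : ℂ) • u₀ := mulVec_snoc_zero_eq_smul hh hu hu_col
  have hu₀_left : star u₀ ᵥ* h = (θ : ℂ) • star u₀ := by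
    have hstar := congrArg star hu₀_right
    rw [star_mulVec, hh.eq, star_smul] at hstar
    rw [hstar, Complex.star_def, Complex.conj_ofReal]
  have hpair : star u₀ ⬝ᵥ (⁅X, h⁆ *ᵥ (Fin.snoc p 1 : Fin (n + 1) → ℂ)) = 0 := by
    rw [Ring.lie_def, sub_mulVec, dotProduct_sub, ← mulVec_mulVec, ← mulVec_mulVec, hp,
      dotProduct_mulVec _ h, hu₀_left, mulVec_smul, dotProduct_smul, smul_dotProduct, sub_self]
  rw [hX, bordered_mulVec_snoc] at hpair
  simpa [hu₀, dotProduct, Fin.sum_univ_castSucc] using hpair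

open scoped ComplexOrder in
theorem mulVec_eq_zero_of_isNondegenerateAt {X h : Matrix (Fin (n + 1)) (Fin (n + 1)) ℂ}
    {P : Matrix (Fin n) (Fin n) ℂ} {w : Fin n → ℂ} {θ : ℝ} (hh : h.IsHermitian)
    (hnd : IsNondegenerateAt h) (hX : ⁅X, h⁆ = bordered 0 w (star w) 0) (hP : P.IsHermitian)
    (hPP : P * P = P) (hP_left : initBlock h * P = (θ : ℂ) • P)
    (hP_fix : ∀ u, initBlock h *ᵥ u = (θ : ℂ) • u → P *ᵥ u = u) (hPv : P *ᵥ lastCol h = 0) :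
    P *ᵥ w = 0 := by
  have hv : ∀ u, P *ᵥ u = u → star (lastCol h) ⬝ᵥ u = 0 := fun u hu => by
    rw [← hu, dotProduct_mulVec, ← hP.eq, ← star_mulVec, hPv, star_zero, zero_dotProduct]
  by_contra hPw
  have hPPw : P *ᵥ (P *ᵥ w) = P *ᵥ w := by rw [mulVec_mulVec, hPP]
  have heigen : initBlock h *ᵥ (P *ᵥ w) = (θ : ℂ) • (P *ᵥ w) := by
    rw [mulVec_mulVec, hP_left, smul_mulVec]
  obtain ⟨u, hu, hu_ne⟩ | ⟨p, hp⟩ := hnd θ _ hPw heigen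
  · exact hu_ne (hv u (hP_fix u hu))
  · have hzero := star_dotProduct_eq_zero_of_eigenvectors hh hX heigen (hv _ hPPw) hp
    refine hPw (dotProduct_star_self_eq_zero.1 ?_)
    rw [dotProduct_mulVec, star_mulVec, hP.eq, vecMul_vecMul, hPP, ← hzero,
      star_mulVec, hP.eq]

/-- `A` is put together from skew-Hermitian maps of the eigenspaces of `initBlock h`. -/
theorem exists_skewHermitian_commute_mulVec_lastCol_eq
    {X h : Matrix (Fin (n + 1)) (Fin (n + 1)) ℂ} {w : Fin n → ℂ} (hh : h.IsHermitian)
    (hnd : IsNondegenerateAt h) (hX : ⁅X, h⁆ = bordered 0 w (star w) 0) :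
    ∃ A ∈ skewHermitian n, ⁅A, initBlock h⁆ = 0 ∧ A *ᵥ lastCol h = w := by
  have hy := initBlock_isHermitian hh
  obtain ⟨s, q, hsum, hq⟩ := exists_spectral_projections hy
  let P : ℝ → Matrix (Fin n) (Fin n) ℂ := fun θ => aeval (initBlock h) (q θ)
  have hP : ∀ θ, (P θ).IsHermitian := fun θ => isHermitian_aeval hy _
  have hP_right : ∀ θ ∈ s, P θ * initBlock h = (θ : ℂ) • P θ := fun θ hθ => by
    rw [← (hq θ hθ).2.2]
    simpa only [map_mul, aeval_X] using congrArg (aeval (initBlock h)) (mul_comm (q θ) .X)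
  have hblock : ∀ θ ∈ s, ∃ K : Matrix (Fin n) (Fin n) ℂ,
      Kᴴ = -K ∧ K *ᵥ (P θ *ᵥ lastCol h) = P θ *ᵥ w := fun θ hθ => by
    obtain ⟨hq_eval, hPP, hP_left⟩ := hq θ hθ
    refine exists_skewAdjoint_mulVec_eq (fun hPv => mulVec_eq_zero_of_isNondegenerateAt hh hnd hX
      (hP θ) hPP hP_left (fun u hu => ?_) hPv) ?_
    · rw [aeval_mulVec_of_mulVec_eq hu, hq_eval, Complex.ofReal_one, one_smul]
    · rw [star_mulVec, (hP θ).eq, ← dotProduct_mulVec, mulVec_mulVec, hPP]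
      exact re_dotProduct_aeval_mulVec_eq_zero hh hX (q θ)
  choose! K hK_skew hK using hblock
  refine ⟨∑ θ ∈ s, P θ * K θ * P θ, ?_, ?_, ?_⟩
  · change (∑ θ ∈ s, P θ * K θ * P θ)ᴴ = _
    rw [conjTranspose_sum, ← Finset.sum_neg_distrib]
    refine Finset.sum_congr rfl fun θ hθ => ?_
    rw [conjTranspose_mul, conjTranspose_mul, (hP θ).eq, hK_skew θ hθ]
    noncomm_ring
  · rw [Ring.lie_def, Finset.sum_mul, Finset.mul_sum, sub_eq_zero]
    refine Finset.sum_congr rfl fun θ hθ => ?_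
    rw [mul_assoc _ (P θ), hP_right θ hθ, ← mul_assoc, ← mul_assoc, (hq θ hθ).2.2,
      Matrix.mul_smul, smul_mul_assoc, smul_mul_assoc]
  · calc (∑ θ ∈ s, P θ * K θ * P θ) *ᵥ lastCol h
        = ∑ θ ∈ s, P θ *ᵥ w := by
          rw [sum_mulVec]
          refine Finset.sum_congr rfl fun θ hθ => ?_
          rw [← mulVec_mulVec, ← mulVec_mulVec, hK θ hθ, mulVec_mulVec, (hq θ hθ).2.1]
      _ = w := by rw [← sum_mulVec, hsum, one_mulVec]

theorem extendZero_lie_of_isHermitian {A : Matrix (Fin n) (Fin n) ℂ}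
    {h : Matrix (Fin (n + 1)) (Fin (n + 1)) ℂ} (hA : A ∈ skewHermitian n) (hh : h.IsHermitian) :
    ⁅extendZero A, h⁆ =
      bordered ⁅A, initBlock h⁆ (A *ᵥ lastCol h) (star (A *ᵥ lastCol h)) 0 := by
  conv_lhs => rw [eq_bordered_of_isHermitian hh]
  rw [extendZero_lie, star_mulVec, show Aᴴ = -A from hA, vecMul_neg]

theorem exists_lie_eq_lie_extendZero {X h : Matrix (Fin (n + 1)) (Fin (n + 1)) ℂ}
    (hh : h.IsHermitian) (hnd : IsNondegenerateAt h) (hX : X ∈ skewHermitian (n + 1))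
    (hX_block : initBlock ⁅X, h⁆ ∈ orbitTangent (initBlock h)) :
    ∃ A ∈ skewHermitian n, ⁅X, h⁆ = ⁅extendZero A, h⁆ := by
  obtain ⟨Z, hZ, hXZ⟩ := hX_block
  have hsub : ⁅X - extendZero Z, h⁆ = ⁅X, h⁆ - ⁅extendZero Z, h⁆ := by
    simp only [Ring.lie_def]; noncomm_ring
  have hδ : ⁅X - extendZero Z, h⁆.IsHermitian :=
    isHermitian_lie (sub_mem_skewHermitian hX (extendZero_mem_skewHermitian hZ)) hh
  set δ := ⁅X - extendZero Z, h⁆ with hδ_def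
  have hδ_block : initBlock δ = 0 := by
    rw [hsub]
    change initBlock ⁅X, h⁆ - initBlock ⁅extendZero Z, h⁆ = 0
    rw [initBlock_extendZero_lie, hXZ, sub_self]
  have hδ_corner : δ (Fin.last n) (Fin.last n) = 0 := by
    have htrace : δ.trace = 0 := by
      rw [hδ_def, Ring.lie_def, trace_sub, trace_mul_comm, sub_self]
    simpa [trace_eq_trace_initBlock_add, hδ_block] using htrace
  have hδ_eq : δ = bordered 0 (lastCol δ) (star (lastCol δ)) 0 := by
    have := eq_bordered_of_isHermitian hδ
    rwa [hδ_block, hδ_corner] at this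
  obtain ⟨A, hA, hA_lie, hA_col⟩ :=
    exists_skewHermitian_commute_mulVec_lastCol_eq hh hnd (hδ_def ▸ hδ_eq)
  have hA_eq : ⁅extendZero A, h⁆ = δ := by
    rw [extendZero_lie_of_isHermitian hA hh, hA_lie, hA_col, ← hδ_eq]
  refine ⟨A + Z, add_mem_skewHermitian hA hZ, ?_⟩
  have hadd : extendZero (A + Z) = extendZero A + extendZero Z := by simp [bordered_add]
  rw [hadd, ← sub_add_cancel ⁅X, h⁆ ⁅extendZero Z, h⁆, ← hsub, ← hA_eq]
  simp only [Ring.lie_def]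
  noncomm_ring

theorem kks_eq_zero_of_mem_infinitesimalFiber {h X Y : Matrix (Fin n) (Fin n) ℂ}
    (hh : h.IsHermitian) (hnd : IsNondegenerate h) (hX : X ∈ skewHermitian n)
    (hY : Y ∈ skewHermitian n) (hXh : ⁅X, h⁆ ∈ infinitesimalFiber h)
    (hYh : ⁅Y, h⁆ ∈ infinitesimalFiber h) : kks h X Y = 0 := by
  induction n with
  | zero => simp [kks, trace]
  | succ n ih =>
    rw [isNondegenerate_succ] at hnd
    have reduce : ∀ W ∈ skewHermitian (n + 1), ⁅W, h⁆ ∈ infinitesimalFiber h →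
        ∃ A ∈ skewHermitian n, ⁅A, initBlock h⁆ ∈ infinitesimalFiber (initBlock h) ∧
          ⁅W, h⁆ = ⁅extendZero A, h⁆ := fun W hW hWh => by
      rw [mem_infinitesimalFiber_succ] at hWh
      obtain ⟨A, hA, hWA⟩ := exists_lie_eq_lie_extendZero hh hnd.1 hW (hWh.2 n le_rfl)
      refine ⟨A, hA, ?_, hWA⟩
      rw [← initBlock_extendZero_lie, ← hWA]
      exact hWh.2
    obtain ⟨A, hA, hAh, hXA⟩ := reduce X hX hXh
    obtain ⟨B, hB, hBh, hYB⟩ := reduce Y hY hYh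
    rw [kks_congr hXA hYB, kks_extendZero]
    exact ih (initBlock_isHermitian hh) hnd.2 hA hB hAh hBh

end Nondegenerate

/-! ### Tangent vectors of fibers -/

section ExpCurve

attribute [local instance] Matrix.linftyOpNormedRing Matrix.linftyOpNormedAlgebra

variable {n : ℕ}

theorem contDiff_exp_smul_apply (B : Matrix (Fin n) (Fin n) ℂ) (i j : Fin n) :
    ContDiff ℝ ∞ fun s : ℝ => NormedSpace.exp (s • B) i j := by
  have hexp : ContDiff ℝ ∞ fun s : ℝ => NormedSpace.exp (s • B) :=
    (contDiff_iff_contDiffAt.2 fun x =>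
      (NormedSpace.exp_analytic (𝕂 := ℝ) x).contDiffAt).comp (contDiff_id.smul contDiff_const)
  exact (LinearMap.toContinuousLinearMap (entryLinearMap ℝ ℂ i j)).contDiff.comp hexp

theorem hasDerivAt_exp_smul_apply (B : Matrix (Fin n) (Fin n) ℂ) (i j : Fin n) :
    HasDerivAt (fun s : ℝ => NormedSpace.exp (s • B) i j) (B i j) 0 := by
  have hexp := hasDerivAt_exp_smul_const (𝕂 := ℝ) B 0
  rw [zero_smul, NormedSpace.exp_zero, one_mul] at hexp
  exact (LinearMap.toContinuousLinearMap
    (entryLinearMap ℝ ℂ i j)).hasFDerivAt.comp_hasDerivAt 0 hexp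

end ExpCurve

section MatrixCalculus

attribute [local instance] Matrix.normedAddCommGroup Matrix.normedSpace

variable {n : ℕ} {E : Type*} [NormedAddCommGroup E] [NormedSpace ℝ E]
  {f g : E → Matrix (Fin n) (Fin n) ℂ} {γ η : ℝ → Matrix (Fin n) (Fin n) ℂ}
  {δ ε : Matrix (Fin n) (Fin n) ℂ} {t : ℝ}

theorem contDiff_matrix_iff {k l : ℕ} {f : E → Matrix (Fin k) (Fin l) ℂ} :
    ContDiff ℝ ∞ f ↔ ∀ i j, ContDiff ℝ ∞ fun s => f s i j :=
  Iff.trans (contDiff_pi (F' := fun _ : Fin k => Fin l → ℂ))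
    (forall_congr' fun _ => contDiff_pi (F' := fun _ : Fin l => ℂ))

theorem hasDerivAt_matrix_iff :
    HasDerivAt γ δ t ↔ ∀ i j, HasDerivAt (fun s => γ s i j) (δ i j) t :=
  Iff.trans (hasDerivAt_pi (E' := fun _ : Fin n => Fin n → ℂ))
    (forall_congr' fun _ => hasDerivAt_pi (E' := fun _ : Fin n => ℂ))

theorem contDiff_matrix_mul (hf : ContDiff ℝ ∞ f) (hg : ContDiff ℝ ∞ g) :
    ContDiff ℝ ∞ fun s => f s * g s := by
  rw [contDiff_matrix_iff] at hf hg ⊢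
  intro i j
  simp only [mul_apply]
  exact ContDiff.sum fun k _ => (hf i k).mul (hg k j)

theorem contDiff_conjTranspose (hf : ContDiff ℝ ∞ f) : ContDiff ℝ ∞ fun s => (f s)ᴴ := by
  rw [contDiff_matrix_iff] at hf ⊢
  exact fun i j => Complex.conjCLE.contDiff.comp (hf j i)

theorem contDiff_extendOne (hf : ContDiff ℝ ∞ f) : ContDiff ℝ ∞ fun s => extendOne (f s) := by
  rw [contDiff_matrix_iff] at hf ⊢
  intro i j
  induction i using Fin.lastCases with
  | last => induction j using Fin.lastCases <;> simpa using contDiff_const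
  | cast i => induction j using Fin.lastCases with
    | last => simpa using contDiff_const
    | cast j => simpa using hf i j

theorem hasDerivAt_matrix_mul (hγ : HasDerivAt γ δ t) (hη : HasDerivAt η ε t) :
    HasDerivAt (fun s => γ s * η s) (δ * η t + γ t * ε) t := by
  rw [hasDerivAt_matrix_iff] at hγ hη ⊢
  intro i j
  simp only [mul_apply, Matrix.add_apply, ← Finset.sum_add_distrib]
  exact HasDerivAt.fun_sum fun k _ => (hγ i k).mul (hη k j)

theorem hasDerivAt_conjTranspose (hγ : HasDerivAt γ δ t) :
    HasDerivAt (fun s => (γ s)ᴴ) δᴴ t := by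
  rw [hasDerivAt_matrix_iff] at hγ ⊢
  exact fun i j => (hγ j i).star

theorem hasDerivAt_extendOne (hγ : HasDerivAt γ δ t) :
    HasDerivAt (fun s => extendOne (γ s)) (extendZero δ) t := by
  rw [hasDerivAt_matrix_iff] at hγ ⊢
  intro i j
  induction i using Fin.lastCases with
  | last => induction j using Fin.lastCases <;> simpa using hasDerivAt_const _ _
  | cast i => induction j using Fin.lastCases with
    | last => simpa using hasDerivAt_const _ _
    | cast j => simpa using hγ i j

theorem contDiff_exp_smul (B : Matrix (Fin n) (Fin n) ℂ) :
    ContDiff ℝ ∞ fun s : ℝ => NormedSpace.exp (s • B) :=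
  contDiff_matrix_iff.2 (contDiff_exp_smul_apply B)

theorem hasDerivAt_exp_smul (B : Matrix (Fin n) (Fin n) ℂ) :
    HasDerivAt (fun s : ℝ => NormedSpace.exp (s • B)) B 0 :=
  hasDerivAt_matrix_iff.2 (hasDerivAt_exp_smul_apply B)

theorem exp_smul_mem_unitaryGroup {B : Matrix (Fin n) (Fin n) ℂ} (hB : B ∈ skewHermitian n)
    (s : ℝ) : NormedSpace.exp (s • B) ∈ unitaryGroup (Fin n) ℂ := by
  have hsB : (s • B)ᴴ = -(s • B) := by
    rw [conjTranspose_smul, show Bᴴ = -B from hB, star_trivial, smul_neg]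
  rw [mem_unitaryGroup_iff', star_eq_conjTranspose, ← exp_conjTranspose, hsB,
    ← Matrix.exp_add_of_commute _ _ (Commute.refl (s • B)).neg_left, neg_add_cancel,
    NormedSpace.exp_zero]

end MatrixCalculus

section Isospectral

open Polynomial

variable {n : ℕ} {h δ : Matrix (Fin n) (Fin n) ℂ} {γ : ℝ → Matrix (Fin n) (Fin n) ℂ}

theorem aeval_eq_zero_of_unitarilySimilar {x y : Matrix (Fin n) (Fin n) ℂ}
    (hxy : UnitarilySimilar x y) {p : ℝ[X]} (hp : aeval y p = 0) : aeval x p = 0 := by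
  obtain ⟨U, hU, rfl⟩ := hxy
  let conj : Matrix (Fin n) (Fin n) ℂ ≃⋆ₐ[ℝ] Matrix (Fin n) (Fin n) ℂ :=
    Unitary.conjStarAlgAut ℝ _ ⟨U, hU⟩
  have hconj : aeval (conj y) p = conj (aeval y p) := aeval_algHom_apply conj y p
  rw [hp, map_zero] at hconj
  exact hconj

/-- If `q` vanishes on the spectrum of `h` except at `θ`, then `q (γ s) (γ s - θ) = 0` along an
isospectral curve `γ`; differentiate this identity and multiply by `q h` from the right. -/
theorem aeval_mul_velocity_mul_aeval_eq_zero (h0 : γ 0 = h)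
    (hcont : Filter.Tendsto γ (𝓝[≠] 0) (𝓝 h))
    (hslope : Filter.Tendsto (fun s => s⁻¹ • (γ s - γ 0)) (𝓝[≠] 0) (𝓝 δ))
    (hiso : ∀ᶠ s in 𝓝 0, UnitarilySimilar (γ s) h) {q : ℝ[X]} {θ : ℝ}
    (hq : h * aeval h q = (θ : ℂ) • aeval h q) : aeval h q * δ * aeval h q = 0 := by
  have hann : ∀ᶠ s in 𝓝 0, aeval (γ s) q * (γ s - (θ : ℂ) • 1) = 0 := by
    filter_upwards [hiso] with s hs
    have hp : aeval h (q * (X - C θ)) = 0 := by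
      rw [mul_comm, map_mul, map_sub, aeval_X, aeval_C, sub_mul, hq,
        Algebra.algebraMap_eq_smul_one, smul_mul_assoc, one_mul, Complex.coe_smul, sub_self]
    simpa [Algebra.algebraMap_eq_smul_one] using aeval_eq_zero_of_unitarilySimilar hs hp
  have hslope_zero : ∀ᶠ s in 𝓝[≠] (0 : ℝ),
      aeval (γ s) q * (s⁻¹ • (γ s - γ 0)) * aeval h q = 0 := by
    filter_upwards [hann.filter_mono nhdsWithin_le_nhds] with s hs
    have hright : (γ 0 - (θ : ℂ) • 1) * aeval h q = 0 := by
      rw [h0, sub_mul, hq, smul_mul_assoc, one_mul, sub_self]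
    rw [mul_smul_comm, smul_mul_assoc, ← sub_sub_sub_cancel_right (γ s) (γ 0) ((θ : ℂ) • 1),
      mul_sub, hs, zero_sub, neg_mul, mul_assoc, hright, mul_zero, neg_zero, smul_zero]
  have haeval : Filter.Tendsto (fun s => aeval (γ s) q) (𝓝[≠] 0) (𝓝 (aeval h q)) :=
    ((Polynomial.continuous_aeval q).tendsto h).comp hcont
  exact tendsto_nhds_unique ((haeval.mul hslope).mul_const _)
    (tendsto_const_nhds.congr' (hslope_zero.mono fun _ => Eq.symm))

end Isospectral

section Tangent

open Polynomial

attribute [local instance] Matrix.normedAddCommGroup Matrix.normedSpace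

variable {n : ℕ} {h δ : Matrix (Fin n) (Fin n) ℂ} {γ : ℝ → Matrix (Fin n) (Fin n) ℂ}

theorem isHermitian_velocity (hγ : HasDerivAt γ δ 0) (hherm : ∀ᶠ s in 𝓝 0, (γ s).IsHermitian) :
    δ.IsHermitian :=
  ((hasDerivAt_conjTranspose hγ).congr_of_eventuallyEq
    (hherm.mono fun _ hs => hs.eq.symm)).unique hγ

theorem velocity_mem_orbitTangent (hh : h.IsHermitian) (hγ : HasDerivAt γ δ 0) (h0 : γ 0 = h)
    (hiso : ∀ᶠ s in 𝓝 0, UnitarilySimilar (γ s) h) : δ ∈ orbitTangent h := by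
  have hδ := isHermitian_velocity hγ (hiso.mono fun _ hs => hs.isHermitian hh)
  refine mem_orbitTangent_of_trace_mul_eq_zero hh hδ fun Z _ hZh => ?_
  have hcont := hγ.continuousAt.tendsto.mono_left (nhdsWithin_le_nhds (s := {0}ᶜ))
  rw [h0] at hcont
  have hslope := hγ.tendsto_slope_zero
  simp only [zero_add] at hslope
  obtain ⟨s, q, hsum, hq⟩ := exists_spectral_projections hh
  have hZ_comm : ∀ θ, Commute Z (aeval h (q θ)) := fun θ => by
    have hcomm : Commute Z h := by rwa [Ring.lie_def, sub_eq_zero] at hZh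
    exact (Algebra.commute_of_mem_adjoin_singleton_of_commute (aeval_mem_adjoin_singleton ℝ h)
      hcomm)
  rw [← mul_one Z, ← hsum, Finset.mul_sum, Finset.mul_sum, trace_sum]
  refine Finset.sum_eq_zero fun θ hθ => ?_
  obtain ⟨-, hPP, hP⟩ := hq θ hθ
  have hzero := aeval_mul_velocity_mul_aeval_eq_zero h0 hcont hslope hiso hP
  calc (δ * (Z * aeval h (q θ))).trace
      = (δ * aeval h (q θ) * Z * aeval h (q θ)).trace := by
        rw [mul_assoc _ Z, (hZ_comm θ).eq, mul_assoc δ, ← mul_assoc (aeval h (q θ)), hPP]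
    _ = (aeval h (q θ) * δ * aeval h (q θ) * Z).trace := by
        rw [trace_mul_comm]; simp only [mul_assoc]
    _ = 0 := by rw [hzero, zero_mul, trace_zero]

theorem velocity_mem_infinitesimalFiber (hh : h.IsHermitian) (hγ : HasDerivAt γ δ 0)
    (h0 : γ 0 = h) (hfiber : ∀ᶠ s in 𝓝 0, γ s ∈ spectralFiber h) : δ ∈ infinitesimalFiber h :=
  fun k hk => velocity_mem_orbitTangent (γ := fun s => leadingBlock (γ s) k hk)
    (leadingBlock_isHermitian hh k hk)
    (hasDerivAt_matrix_iff.2 fun _ _ => hasDerivAt_matrix_iff.1 hγ _ _) (by rw [h0])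
    (hfiber.mono fun _ hs => hs k hk)

/-- `g` is a smooth curve of unitary matrices through `1` with velocity `Z` that moves `h` inside
its fiber. -/
structure IsFiberFlow (h Z : Matrix (Fin n) (Fin n) ℂ) (g : ℝ → Matrix (Fin n) (Fin n) ℂ) :
    Prop where
  contDiff : ContDiff ℝ ∞ g
  hasDerivAt : HasDerivAt g Z 0
  map_zero : g 0 = 1
  mem_unitaryGroup : ∀ s, g s ∈ unitaryGroup (Fin n) ℂ
  conj_mem_spectralFiber : ∀ s, g s * h * (g s)ᴴ ∈ spectralFiber h

theorem IsFiberFlow.extend {h : Matrix (Fin (n + 1)) (Fin (n + 1)) ℂ}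
    {Z B : Matrix (Fin n) (Fin n) ℂ} {g : ℝ → Matrix (Fin n) (Fin n) ℂ}
    (hg : IsFiberFlow (initBlock h) Z g) (hB : B ∈ skewHermitian n)
    (hcomm : Commute B (initBlock h)) :
    IsFiberFlow h (extendZero (Z + B))
      fun s => extendOne (g s * NormedSpace.exp (s • B)) where
  contDiff := contDiff_extendOne (contDiff_matrix_mul hg.contDiff (contDiff_exp_smul B))
  hasDerivAt := by
    have hderiv := hasDerivAt_matrix_mul hg.hasDerivAt (hasDerivAt_exp_smul B)
    rw [hg.map_zero, zero_smul, NormedSpace.exp_zero, mul_one, one_mul] at hderiv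
    exact hasDerivAt_extendOne hderiv
  map_zero := by
    rw [hg.map_zero, zero_smul, NormedSpace.exp_zero, mul_one]
    exact bordered_one
  mem_unitaryGroup s :=
    extendOne_mem_unitaryGroup (mul_mem (hg.mem_unitaryGroup s) (exp_smul_mem_unitaryGroup hB s))
  conj_mem_spectralFiber s := by
    have hexp := exp_smul_mem_unitaryGroup hB s
    have hfix : NormedSpace.exp (s • B) * initBlock h * (NormedSpace.exp (s • B))ᴴ =
        initBlock h := by
      rw [((hcomm.smul_left s).exp_left).eq, mul_assoc,
        mul_conjTranspose_self_of_mem_unitaryGroup hexp, mul_one]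
    refine mem_spectralFiber_succ.2
      ⟨⟨_, extendOne_mem_unitaryGroup (mul_mem (hg.mem_unitaryGroup s) hexp), rfl⟩, ?_⟩
    have hblock : g s * NormedSpace.exp (s • B) * initBlock h *
        (g s * NormedSpace.exp (s • B))ᴴ = g s * initBlock h * (g s)ᴴ := by
      conv_rhs => rw [← hfix]
      simp only [conjTranspose_mul, mul_assoc]
    rw [initBlock_extendOne_conj, hblock]
    exact hg.conj_mem_spectralFiber s

theorem exists_isFiberFlow (hh : h.IsHermitian) (hnd : IsNondegenerate h)
    (hδ : δ ∈ infinitesimalFiber h) :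
    ∃ Z ∈ skewHermitian n, δ = ⁅Z, h⁆ ∧ ∃ g, IsFiberFlow h Z g := by
  induction n with
  | zero =>
    refine ⟨0, zero_mem_skewHermitian, Subsingleton.elim _ _, fun _ => 1, contDiff_const,
      hasDerivAt_const _ _, rfl, fun _ => one_mem _, fun s => ?_⟩
    rw [Subsingleton.elim (_ * _) h]
    exact self_mem_spectralFiber h
  | succ n ih =>
    rw [isNondegenerate_succ] at hnd
    obtain ⟨⟨X, hX, rfl⟩, hδ_block⟩ := mem_infinitesimalFiber_succ.1 hδ
    obtain ⟨Z, hZ, hXZ, g, hg⟩ := ih (initBlock_isHermitian hh) hnd.2 hδ_block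
    obtain ⟨A, hA, hXA⟩ := exists_lie_eq_lie_extendZero hh hnd.1 hX ⟨Z, hZ, hXZ⟩
    have hcomm : Commute (A - Z) (initBlock h) := by
      have hAZ : ⁅A, initBlock h⁆ = ⁅Z, initBlock h⁆ := by
        rw [← hXZ, hXA, initBlock_extendZero_lie]
      rw [Ring.lie_def, Ring.lie_def] at hAZ
      rw [Commute, SemiconjBy, sub_mul, mul_sub, sub_eq_sub_iff_sub_eq_sub, hAZ]
    have hflow := hg.extend (sub_mem_skewHermitian hA hZ) hcomm
    rw [add_sub_cancel] at hflow
    exact ⟨extendZero A, extendZero_mem_skewHermitian hA, hXA, _, hflow⟩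

theorem tangentVectors_spectralFiber (hh : h.IsHermitian) (hnd : IsNondegenerate h) :
    tangentVectors (spectralFiber h) h = infinitesimalFiber h := by
  ext δ
  constructor
  · rintro ⟨γ, -, hfiber, h0, hγ⟩
    exact velocity_mem_infinitesimalFiber hh hγ h0 hfiber
  · intro hδ
    obtain ⟨Z, hZ, rfl, g, hg⟩ := exists_isFiberFlow hh hnd hδ
    have hsmooth : ContDiff ℝ ∞ fun s => g s * h * (g s)ᴴ := contDiff_matrix_mul
      (contDiff_matrix_mul hg.contDiff contDiff_const) (contDiff_conjTranspose hg.contDiff)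
    have hderiv := hasDerivAt_matrix_mul
      (hasDerivAt_matrix_mul hg.hasDerivAt (hasDerivAt_const _ h))
      (hasDerivAt_conjTranspose hg.hasDerivAt)
    rw [hg.map_zero, show Zᴴ = -Z from hZ, mul_zero, add_zero, conjTranspose_one, mul_one, one_mul,
      mul_neg, ← sub_eq_add_neg, ← Ring.lie_def] at hderiv
    exact ⟨_, hsmooth.contDiffAt, .of_forall hg.conj_mem_spectralFiber, by simp [hg.map_zero],
      hderiv⟩

theorem lie_mem_tangentVectors_spectralFiber_iff (hh : h.IsHermitian) (hnd : IsNondegenerate h)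
    {X : Matrix (Fin n) (Fin n) ℂ} (hX : X ∈ skewHermitian n) :
    ⁅X, h⁆ ∈ tangentVectors (spectralFiber h) h ↔
      ∀ Y ∈ skewHermitian n, ⁅Y, h⁆ ∈ tangentVectors (spectralFiber h) h → kks h X Y = 0 := by
  rw [tangentVectors_spectralFiber hh hnd]
  refine ⟨fun hXh Y hY hYh => kks_eq_zero_of_mem_infinitesimalFiber hh hnd hX hY hXh hYh,
    fun horth => ?_⟩
  have hherm := isHermitian_lie hX hh
  refine mem_infinitesimalFiber_of_trace_mul_eq_zero hh hherm fun Y hY hYh => ?_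
  refine Complex.ext (re_trace_mul_eq_zero hherm hY) ?_
  rw [← kks_eq_im_trace, horth Y hY hYh, Complex.zero_im]

end Tangent

/-! ### Eigenspaces of bordered matrices -/

section Eigenspace

section General

variable {m : Type*} [Fintype m] [DecidableEq m] {x y : Matrix m m ℂ} {θ : ℝ}

/-- The eigenspace of a complex matrix for a real number; it is `⊥` if this number is not an
eigenvalue. -/
def eigenspace (x : Matrix m m ℂ) (θ : ℝ) : Submodule ℂ (m → ℂ) :=
  Module.End.eigenspace (toLin' x) (θ : ℂ)

theorem mem_eigenspace {u : m → ℂ} : u ∈ eigenspace x θ ↔ x *ᵥ u = (θ : ℂ) • u := by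
  rw [eigenspace, Module.End.mem_eigenspace_iff, toLin'_apply]

theorem eigenspace_eq_bot_iff :
    eigenspace x θ = ⊥ ↔ ∀ u, x *ᵥ u = (θ : ℂ) • u → u = 0 := by
  simp only [Submodule.eq_bot_iff, mem_eigenspace]

theorem UnitarilySimilar.finrank_eigenspace_le (hxy : UnitarilySimilar x y) (θ : ℝ) :
    Module.finrank ℂ (eigenspace x θ) ≤ Module.finrank ℂ (eigenspace y θ) := by
  obtain ⟨U, hU, rfl⟩ := hxy
  have hmaps : ∀ u ∈ eigenspace (U * y * Uᴴ) θ, Uᴴ.mulVecLin u ∈ eigenspace y θ := by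
    intro u hu
    rw [mem_eigenspace] at hu ⊢
    rw [mulVecLin_apply, ← mulVec_smul, ← hu, mulVec_mulVec, mulVec_mulVec, ← mul_assoc,
      ← mul_assoc, conjTranspose_mul_self_of_mem_unitaryGroup hU, one_mul]
  refine LinearMap.finrank_le_finrank_of_injective (f := Uᴴ.mulVecLin.restrict hmaps)
    fun a b hab => Subtype.ext ?_
  have hUab : Uᴴ *ᵥ a.1 = Uᴴ *ᵥ b.1 := congrArg Subtype.val hab
  simpa [mulVec_mulVec, mul_conjTranspose_self_of_mem_unitaryGroup hU] using
    congrArg (U *ᵥ ·) hUab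

theorem UnitarilySimilar.finrank_eigenspace_eq (hxy : UnitarilySimilar x y) (θ : ℝ) :
    Module.finrank ℂ (eigenspace x θ) = Module.finrank ℂ (eigenspace y θ) :=
  (hxy.finrank_eigenspace_le θ).antisymm (hxy.symm.finrank_eigenspace_le θ)

theorem finrank_eigenspace_diagonal (d : m → ℝ) (θ : ℝ) :
    Module.finrank ℂ (eigenspace (diagonal fun i => (d i : ℂ)) θ) =
      Fintype.card {i // d i = θ} := by
  have hker : eigenspace (diagonal fun i => (d i : ℂ)) θ =
      LinearMap.ker (diagonal fun i => (d i : ℂ) - θ).mulVecLin := by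
    ext u
    simp [mem_eigenspace, funext_iff, mulVec_diagonal, sub_mul, sub_eq_zero]
  have hrank : (diagonal fun i => (d i : ℂ) - θ).rank = Fintype.card {i // ¬ d i = θ} := by
    rw [rank_diagonal]
    refine Fintype.card_congr (Equiv.subtypeEquivRight fun i => ?_)
    rw [not_iff_not, sub_eq_zero]
    norm_cast
  have hrank_nullity :=
    LinearMap.finrank_range_add_finrank_ker (diagonal fun i => (d i : ℂ) - θ).mulVecLin
  rw [← hker, ← Matrix.rank, hrank, Module.finrank_fintype_fun_eq_card,
    Fintype.card_subtype_compl] at hrank_nullity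
  have hle := Fintype.card_subtype_le (fun i => d i = θ)
  omega

end General

theorem star_dotProduct_mulVec_of_mulVec_eq {m : Type*} [Fintype m] {x : Matrix m m ℂ}
    (hx : x.IsHermitian) {θ : ℝ} {u : m → ℂ}
    (hu : x *ᵥ u = (θ : ℂ) • u) (p : m → ℂ) : star u ⬝ᵥ (x *ᵥ p) = θ * (star u ⬝ᵥ p) := by
  have hstar := congrArg star hu
  rw [star_mulVec, hx.eq, star_smul, Complex.star_def, Complex.conj_ofReal] at hstar
  rw [dotProduct_mulVec, hstar, smul_dotProduct, smul_eq_mul]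

variable {n : ℕ} {h x : Matrix (Fin (n + 1)) (Fin (n + 1)) ℂ} {θ : ℝ}

theorem star_lastCol_dotProduct_eq_zero (hh : h.IsHermitian) {p u : Fin n → ℂ}
    (hp : h *ᵥ (Fin.snoc p 1 : Fin (n + 1) → ℂ) = (θ : ℂ) • (Fin.snoc p 1 : Fin (n + 1) → ℂ))
    (hu : initBlock h *ᵥ u = (θ : ℂ) • u) : star (lastCol h) ⬝ᵥ u = 0 := by
  rw [mulVec_snoc_of_isHermitian hh, smul_snoc] at hp
  have hcol : initBlock h *ᵥ p + lastCol h = (θ : ℂ) • p := by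
    ext i
    simpa using congrFun hp i.castSucc
  have hpair := congrArg (star u ⬝ᵥ ·) hcol
  simp only [dotProduct_add, star_dotProduct_mulVec_of_mulVec_eq (initBlock_isHermitian hh) hu,
    dotProduct_smul, smul_eq_mul, add_eq_left] at hpair
  rw [star_dotProduct, hpair, star_zero]

theorem exists_mulVec_snoc_one_eq {u : Fin (n + 1) → ℂ} (hu : h *ᵥ u = (θ : ℂ) • u)
    (hlast : u (Fin.last n) ≠ 0) :
    ∃ p : Fin n → ℂ, h *ᵥ (Fin.snoc p 1 : Fin (n + 1) → ℂ) =
      (θ : ℂ) • (Fin.snoc p 1 : Fin (n + 1) → ℂ) := by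
  refine ⟨fun i => (u (Fin.last n))⁻¹ * u i.castSucc, ?_⟩
  have hscale : (Fin.snoc (fun i => (u (Fin.last n))⁻¹ * u i.castSucc) 1 : Fin (n + 1) → ℂ) =
      (u (Fin.last n))⁻¹ • u := by
    ext j; induction j using Fin.lastCases <;> simp [hlast]
  rw [hscale, mulVec_smul, hu, smul_comm]

theorem eq_zero_of_eigenspace_eq_bot (hh : h.IsHermitian) (hbot : eigenspace h θ = ⊥)
    {u : Fin n → ℂ} (hu : initBlock h *ᵥ u = (θ : ℂ) • u)
    (hu_col : star (lastCol h) ⬝ᵥ u = 0) : u = 0 := by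
  have hsnoc := eigenspace_eq_bot_iff.1 hbot _ (mulVec_snoc_zero_eq_smul hh hu hu_col)
  ext i
  simpa using congrFun hsnoc i.castSucc

theorem finrank_eigenspace_initBlock_le_one (hh : h.IsHermitian) (hbot : eigenspace h θ = ⊥) :
    Module.finrank ℂ (eigenspace (initBlock h) θ) ≤ 1 := by
  have hinj : Function.Injective ((dotProductBilin ℂ ℂ (star (lastCol h))).comp
      (eigenspace (initBlock h) θ).subtype) := by
    rw [injective_iff_map_eq_zero]
    rintro ⟨u, hu⟩ hu_col
    exact Subtype.ext (eq_zero_of_eigenspace_eq_bot hh hbot (mem_eigenspace.1 hu) hu_col)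
  simpa using LinearMap.finrank_le_finrank_of_injective hinj

theorem finrank_eigenspace_initBlock_lt (hh : h.IsHermitian) {p : Fin n → ℂ}
    (hp : h *ᵥ (Fin.snoc p 1 : Fin (n + 1) → ℂ) = (θ : ℂ) • (Fin.snoc p 1 : Fin (n + 1) → ℂ)) :
    Module.finrank ℂ (eigenspace (initBlock h) θ) < Module.finrank ℂ (eigenspace h θ) := by
  let snocZero : (Fin n → ℂ) →ₗ[ℂ] (Fin (n + 1) → ℂ) :=
    { toFun := fun u => Fin.snoc u 0
      map_add' := fun a b => by ext j; induction j using Fin.lastCases <;> simp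
      map_smul' := fun c a => by ext j; induction j using Fin.lastCases <;> simp }
  have hinj : Function.Injective snocZero := fun a b hab => by
    ext i; simpa [snocZero] using congrFun hab i.castSucc
  rw [(Submodule.equivMapOfInjective snocZero hinj _).finrank_eq]
  refine Submodule.finrank_lt_finrank_of_lt (SetLike.lt_iff_le_and_exists.2 ⟨?_, ?_⟩)
  · rintro _ ⟨u, hu, rfl⟩
    have hu' := mem_eigenspace.1 hu
    exact mem_eigenspace.2
      (mulVec_snoc_zero_eq_smul hh hu' (star_lastCol_dotProduct_eq_zero hh hp hu'))
  · refine ⟨Fin.snoc p 1, mem_eigenspace.2 hp, ?_⟩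
    rintro ⟨u, -, hu⟩
    simpa [snocZero] using congrFun hu (Fin.last n)

theorem finrank_eigenspace_le_initBlock (hlast : ∀ u ∈ eigenspace h θ, u (Fin.last n) = 0) :
    Module.finrank ℂ (eigenspace h θ) ≤ Module.finrank ℂ (eigenspace (initBlock h) θ) := by
  have hmaps : ∀ u ∈ eigenspace h θ,
      LinearMap.funLeft ℂ ℂ Fin.castSucc u ∈ eigenspace (initBlock h) θ := by
    intro u hu
    have hu_last := hlast u hu
    rw [mem_eigenspace] at hu ⊢
    ext i
    have hi := congrFun hu i.castSucc
    simp only [mulVec, dotProduct, Fin.sum_univ_castSucc, hu_last, mul_zero, add_zero] at hi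
    simpa [mulVec, dotProduct, LinearMap.funLeft] using hi
  refine LinearMap.finrank_le_finrank_of_injective
    (f := (LinearMap.funLeft ℂ ℂ Fin.castSucc).restrict hmaps) fun a b hab => ?_
  ext j
  induction j using Fin.lastCases with
  | last => rw [hlast _ a.2, hlast _ b.2]
  | cast i => exact congrFun (congrArg Subtype.val hab) i

/-- Regularity of the last step of the sequence of leading principal submatrices: every eigenvalue
of the whole matrix has an eigenvector whose last coordinate does not vanish. -/
def IsRegularAt (h : Matrix (Fin (n + 1)) (Fin (n + 1)) ℂ) : Prop :=
  ∀ θ : ℝ, eigenspace h θ ≠ ⊥ → ∃ p : Fin n → ℂ, h *ᵥ (Fin.snoc p 1 : Fin (n + 1) → ℂ) =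
      (θ : ℂ) • (Fin.snoc p 1 : Fin (n + 1) → ℂ)

theorem isRegularAt_iff_finrank_lt (hh : h.IsHermitian) :
    IsRegularAt h ↔ ∀ θ : ℝ, eigenspace h θ ≠ ⊥ →
      Module.finrank ℂ (eigenspace (initBlock h) θ) < Module.finrank ℂ (eigenspace h θ) := by
  refine forall_congr' fun θ => imp_congr_right fun _ =>
    ⟨fun ⟨p, hp⟩ => finrank_eigenspace_initBlock_lt hh hp, fun hlt => ?_⟩
  contrapose! hlt
  refine finrank_eigenspace_le_initBlock fun u hu => ?_
  by_contra hlast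
  obtain ⟨p, hp⟩ := exists_mulVec_snoc_one_eq (mem_eigenspace.1 hu) hlast
  exact hlt p hp

theorem IsRegularAt.of_unitarilySimilar (hr : IsRegularAt h) (hh : h.IsHermitian)
    (hxh : UnitarilySimilar x h) (hblock : UnitarilySimilar (initBlock x) (initBlock h)) :
    IsRegularAt x := by
  rw [isRegularAt_iff_finrank_lt hh] at hr
  rw [isRegularAt_iff_finrank_lt (hxh.isHermitian hh)]
  intro θ hθ
  rw [hxh.finrank_eigenspace_eq, hblock.finrank_eigenspace_eq]
  refine hr θ fun hbot => hθ ?_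
  rw [← Submodule.finrank_eq_zero] at hbot ⊢
  rw [hxh.finrank_eigenspace_eq, hbot]

theorem IsRegularAt.isNondegenerateAt (hr : IsRegularAt h) (hh : h.IsHermitian) :
    IsNondegenerateAt h := by
  intro θ u hu0 hu
  by_cases hu_col : star (lastCol h) ⬝ᵥ u = 0
  · exact Or.inr (hr θ fun hbot => hu0 (eq_zero_of_eigenspace_eq_bot hh hbot hu hu_col))
  · exact Or.inl ⟨u, hu, hu_col⟩

end Eigenspace

/-! ### Base points -/

section BasePoint

variable {n : ℕ}

/-- The matrices whose Gelfand–Cetlin fiber is a non-torus Lagrangian: the upper left `2 × 2` block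
is scalar, the upper left `3 × 3` block is not, and all further blocks are regular. -/
def IsBasePoint : (k : ℕ) → Matrix (Fin (k + 3)) (Fin (k + 3)) ℂ → Prop
  | 0, h => (∃ c : ℝ, initBlock h = (c : ℂ) • 1) ∧ lastCol h ≠ 0
  | k + 1, h => IsBasePoint k (initBlock h) ∧ IsRegularAt h

theorem smul_one_mulVec_eq_iff {c θ : ℝ} {u : Fin n → ℂ} (hu0 : u ≠ 0) :
    ((c : ℂ) • (1 : Matrix (Fin n) (Fin n) ℂ)) *ᵥ u = (θ : ℂ) • u ↔ c = θ := by
  rw [smul_mulVec, one_mulVec, smul_left_inj hu0, Complex.ofReal_inj]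

theorem isNondegenerateAt_smul_one (c : ℝ) :
    IsNondegenerateAt ((c : ℂ) • (1 : Matrix (Fin (n + 1)) (Fin (n + 1)) ℂ)) := by
  intro θ u hu0 hu
  have hblock : initBlock ((c : ℂ) • (1 : Matrix (Fin (n + 1)) (Fin (n + 1)) ℂ)) =
      (c : ℂ) • 1 := by
    ext i j; simp [one_apply]
  rw [hblock, smul_one_mulVec_eq_iff hu0] at hu
  exact Or.inr ⟨0, by rw [smul_mulVec, one_mulVec, hu]⟩

theorem isNondegenerate_smul_one (c : ℝ) :
    IsNondegenerate ((c : ℂ) • (1 : Matrix (Fin n) (Fin n) ℂ)) := by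
  intro k hk
  have hblock : leadingBlock ((c : ℂ) • (1 : Matrix (Fin n) (Fin n) ℂ)) (k + 1) hk =
      (c : ℂ) • 1 := by
    ext i j; simp [leadingBlock, one_apply]
  rw [hblock]
  exact isNondegenerateAt_smul_one c

open scoped ComplexOrder in
theorem isNondegenerateAt_of_initBlock_eq_smul_one {h : Matrix (Fin (n + 1)) (Fin (n + 1)) ℂ}
    {c : ℝ} (hblock : initBlock h = (c : ℂ) • 1) (hcol : lastCol h ≠ 0) :
    IsNondegenerateAt h := by
  intro θ u hu0 hu
  rw [hblock, smul_one_mulVec_eq_iff hu0] at hu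
  refine Or.inl ⟨lastCol h, ?_, by rwa [Ne, dotProduct_star_self_eq_zero]⟩
  rw [hblock, smul_mulVec, one_mulVec, hu]

theorem IsBasePoint.isNondegenerate : ∀ {k : ℕ} {h : Matrix (Fin (k + 3)) (Fin (k + 3)) ℂ},
    IsBasePoint k h → h.IsHermitian → IsNondegenerate h
  | 0, _, ⟨⟨_, hblock⟩, hcol⟩, _ => isNondegenerate_succ.2
    ⟨isNondegenerateAt_of_initBlock_eq_smul_one hblock hcol,
      hblock ▸ isNondegenerate_smul_one _⟩
  | _ + 1, _, ⟨hbase, hreg⟩, hh => isNondegenerate_succ.2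
    ⟨hreg.isNondegenerateAt hh, hbase.isNondegenerate (initBlock_isHermitian hh)⟩

theorem UnitarilySimilar.mul_self {m : Type*} [Fintype m] [DecidableEq m] {x y : Matrix m m ℂ}
    (hxy : UnitarilySimilar x y) : UnitarilySimilar (x * x) (y * y) := by
  obtain ⟨U, hU, rfl⟩ := hxy
  refine ⟨U, hU, ?_⟩
  calc U * y * Uᴴ * (U * y * Uᴴ) = U * y * (Uᴴ * U) * y * Uᴴ := by simp only [mul_assoc]
    _ = U * (y * y) * Uᴴ := by
      rw [conjTranspose_mul_self_of_mem_unitaryGroup hU, mul_one]; simp only [mul_assoc]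

theorem trace_mul_self_of_isHermitian {z : Matrix (Fin (n + 1)) (Fin (n + 1)) ℂ}
    (hz : z.IsHermitian) : (z * z).trace = (initBlock z * initBlock z).trace +
      2 * ((∑ i, ‖lastCol z i‖ ^ 2 : ℝ) : ℂ) + z (Fin.last n) (Fin.last n) ^ 2 := by
  have hnorm : star (lastCol z) ⬝ᵥ lastCol z = ((∑ i, ‖lastCol z i‖ ^ 2 : ℝ) : ℂ) := by
    push_cast
    exact Finset.sum_congr rfl fun i _ => Complex.conj_mul' _
  conv_lhs => rw [eq_bordered_of_isHermitian hz, bordered_mul, trace_bordered]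
  rw [trace_add, trace_vecMulVec, dotProduct_comm, hnorm]
  ring

theorem apply_last_last_eq {x h : Matrix (Fin (n + 1)) (Fin (n + 1)) ℂ}
    (hxh : UnitarilySimilar x h) (hblock : UnitarilySimilar (initBlock x) (initBlock h)) :
    x (Fin.last n) (Fin.last n) = h (Fin.last n) (Fin.last n) := by
  have htrace := hxh.trace_eq
  rw [trace_eq_trace_initBlock_add, trace_eq_trace_initBlock_add h, hblock.trace_eq] at htrace
  exact add_left_cancel htrace

theorem sum_norm_lastCol_sq_eq {x h : Matrix (Fin (n + 1)) (Fin (n + 1)) ℂ}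
    (hh : h.IsHermitian) (hxh : UnitarilySimilar x h)
    (hblock : UnitarilySimilar (initBlock x) (initBlock h)) :
    ∑ i, ‖lastCol x i‖ ^ 2 = ∑ i, ‖lastCol h i‖ ^ 2 := by
  have htrace := hxh.mul_self.trace_eq
  rw [trace_mul_self_of_isHermitian (hxh.isHermitian hh), trace_mul_self_of_isHermitian hh,
    hblock.mul_self.trace_eq, apply_last_last_eq hxh hblock] at htrace
  exact_mod_cast mul_left_cancel₀ two_ne_zero (add_left_cancel (add_right_cancel htrace))

theorem sum_norm_sq_eq_zero_iff {v : Fin n → ℂ} : ∑ i, ‖v i‖ ^ 2 = 0 ↔ v = 0 := by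
  rw [Finset.sum_eq_zero_iff_of_nonneg fun i _ => by positivity]
  simp [funext_iff]

theorem IsBasePoint.of_mem_spectralFiber : ∀ {k : ℕ} {h x : Matrix (Fin (k + 3)) (Fin (k + 3)) ℂ},
    IsBasePoint k h → h.IsHermitian → x ∈ spectralFiber h → IsBasePoint k x
  | 0, h, x, ⟨⟨c, hc⟩, hcol⟩, hh, hx => by
    obtain ⟨hxh, hx'⟩ := mem_spectralFiber_succ.1 hx
    have hblock := unitarilySimilar_of_mem_spectralFiber hx'
    refine ⟨⟨c, (hc ▸ hblock).eq_smul_one⟩, ?_⟩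
    rwa [Ne, ← sum_norm_sq_eq_zero_iff, sum_norm_lastCol_sq_eq hh hxh hblock,
      sum_norm_sq_eq_zero_iff]
  | _ + 1, _, _, ⟨hbase, hreg⟩, hh, hx => by
    obtain ⟨hxh, hx'⟩ := mem_spectralFiber_succ.1 hx
    exact ⟨hbase.of_mem_spectralFiber (initBlock_isHermitian hh) hx',
      hreg.of_unitarilySimilar hh hxh (unitarilySimilar_of_mem_spectralFiber hx')⟩

end BasePoint

/-! ### Existence of base points -/

section Existence

variable {n : ℕ}

theorem reflection_mem_unitaryGroup {m : Type*} [Fintype m] [DecidableEq m] {w : m → ℂ} {r : ℝ}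
    (hr : r * (star w ⬝ᵥ w) = 2) :
    1 - (r : ℂ) • vecMulVec w (star w) ∈ unitaryGroup m ℂ := by
  have hsq : vecMulVec w (star w) * vecMulVec w (star w) =
      (star w ⬝ᵥ w) • vecMulVec w (star w) := by
    rw [vecMulVec_mul_vecMulVec, vecMulVec_smul]
  have hself : (1 - (r : ℂ) • vecMulVec w (star w))ᴴ = 1 - (r : ℂ) • vecMulVec w (star w) := by
    simp [conjTranspose_vecMulVec]
  have hcoeff : (r : ℂ) * r * (star w ⬝ᵥ w) = r + r := by linear_combination (r : ℂ) * hr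
  rw [mem_unitaryGroup_iff', star_eq_conjTranspose, hself, sub_mul, mul_sub, mul_sub,
    smul_mul_smul_comm, hsq, smul_smul, hcoeff, add_smul]
  simp

theorem exists_unitary_last_row_ne_zero (n : ℕ) :
    ∃ U ∈ unitaryGroup (Fin (n + 1)) ℂ, ∀ i, U (Fin.last n) i ≠ 0 := by
  set w : Fin (n + 1) → ℂ := Fin.snoc (fun _ : Fin n => (1 : ℂ)) (n + 1 : ℂ) with hw
  set r : ℝ := 2 / (n + (n + 1) ^ 2) with hr
  have hden : (n + (n + 1) ^ 2 : ℝ) ≠ 0 := by positivity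
  have hr0 : (r : ℂ) ≠ 0 := Complex.ofReal_ne_zero.2 (div_ne_zero two_ne_zero hden)
  have hn0 : (n + 1 : ℂ) ≠ 0 := by norm_cast
  have hww : star w ⬝ᵥ w = ((n + (n + 1) ^ 2 : ℝ) : ℂ) := by
    simp [hw, dotProduct, Fin.sum_univ_castSucc]; ring
  refine ⟨_, reflection_mem_unitaryGroup (w := w) (r := r) ?_, fun i => ?_⟩
  · rw [hww, ← Complex.ofReal_mul, hr, div_mul_cancel₀ _ hden, Complex.ofReal_ofNat]
  rw [Matrix.sub_apply, Matrix.smul_apply, vecMulVec_apply, Pi.star_apply, smul_eq_mul, hw,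
    Fin.snoc_last]
  induction i using Fin.lastCases with
  | last =>
    have hentry : (1 : ℝ) - r * ((n + 1) * (n + 1)) ≠ 0 := by
      rw [hr, div_mul_eq_mul_div, sub_ne_zero, Ne, eq_div_iff hden]
      nlinarith
    rw [one_apply_eq, Fin.snoc_last, star_add, star_natCast, star_one]
    exact_mod_cast hentry
  | cast i =>
    rw [one_apply_ne (Fin.castSucc_ne_last i).symm, Fin.snoc_castSucc, star_one, mul_one, zero_sub,
      neg_ne_zero]
    exact mul_ne_zero hr0 hn0

theorem isRegularAt_conj_diagonal {U : Matrix (Fin (n + 1)) (Fin (n + 1)) ℂ}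
    (hU : U ∈ unitaryGroup (Fin (n + 1)) ℂ) (hlast : ∀ i, U (Fin.last n) i ≠ 0)
    (d : Fin (n + 1) → ℝ) : IsRegularAt (U * (diagonal fun i => (d i : ℂ)) * Uᴴ) := by
  intro θ hθ
  obtain ⟨i, rfl⟩ : ∃ i, d i = θ := by
    by_contra! hne
    refine hθ (Submodule.finrank_eq_zero.1 ?_)
    rw [UnitarilySimilar.finrank_eigenspace_eq ⟨U, hU, rfl⟩, finrank_eigenspace_diagonal,
      Fintype.card_eq_zero_iff]
    exact ⟨fun i => hne i.1 i.2⟩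
  have heigen : (U * (diagonal fun i => (d i : ℂ)) * Uᴴ) *ᵥ U.col i = (d i : ℂ) • U.col i := by
    rw [← mulVec_single_one, mulVec_mulVec, mul_assoc,
      conjTranspose_mul_self_of_mem_unitaryGroup hU, mul_one, ← mulVec_mulVec,
      diagonal_mulVec_single, mul_one, ← mulVec_smul, ← Pi.single_smul, smul_eq_mul, mul_one]
  exact exists_mulVec_snoc_one_eq heigen (hlast i)

theorem exists_isBasePoint_three {a b c : ℝ} (hbc : b < c) (hca : c < a) :
    ∃ h : Matrix (Fin 3) (Fin 3) ℂ, h.IsHermitian ∧ IsBasePoint 0 h ∧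
      h.charpoly = (Polynomial.X - Polynomial.C (b : ℂ)) * (Polynomial.X - Polynomial.C (c : ℂ)) *
        (Polynomial.X - Polynomial.C (a : ℂ)) := by
  have hpos : 0 < (a - c) * (c - b) := mul_pos (by linarith) (by linarith)
  obtain ⟨s, hs_pos, hs_sq⟩ : ∃ s : ℝ, 0 < s ∧ s * s = (a - c) * (c - b) :=
    ⟨_, Real.sqrt_pos.2 hpos, Real.mul_self_sqrt hpos.le⟩
  refine ⟨!![(c : ℂ), 0, s; 0, c, 0; s, 0, (a + b - c : ℝ)], ?_, ⟨⟨c, ?_⟩, fun hcol => ?_⟩, ?_⟩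
  · ext i j
    fin_cases i <;> fin_cases j <;> simp
  · ext i j
    fin_cases i <;> fin_cases j <;> simp
  · simpa [Fin.last, hs_pos.ne'] using congrFun hcol 0
  · have hC : (Polynomial.C (s : ℂ)) * Polynomial.C (s : ℂ) =
        (Polynomial.C (a : ℂ) - Polynomial.C (c : ℂ)) *
          (Polynomial.C (c : ℂ) - Polynomial.C (b : ℂ)) := by
      rw [← map_mul, ← Complex.ofReal_mul, hs_sq]; simp
    rw [Matrix.charpoly, det_fin_three]
    simp only [charmatrix_apply, diagonal_apply, of_apply, cons_val', cons_val_zero, cons_val_one,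
      cons_val, cons_val_fin_one, Fin.isValue, Fin.reduceEq, if_true, if_false, map_zero,
      Complex.ofReal_sub, Complex.ofReal_add, map_sub, map_add]
    linear_combination (-(Polynomial.X - Polynomial.C (c : ℂ))) * hC

theorem exists_isBasePoint_three_of_injective {l : Fin 3 → ℝ} (hl : Function.Injective l) :
    ∃ h : Matrix (Fin 3) (Fin 3) ℂ,
      UnitarilySimilar h (diagonal fun i => (l i : ℂ)) ∧ IsBasePoint 0 h := by
  set σ := Tuple.sort l
  have hmono : StrictMono (l ∘ σ) :=
    (Tuple.monotone_sort l).strictMono_of_injective (hl.comp σ.injective)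
  obtain ⟨h, hh, hbase, hcharpoly⟩ := exists_isBasePoint_three (a := l (σ 2)) (b := l (σ 0))
    (c := l (σ 1)) (hmono (by decide)) (hmono (by decide))
  refine ⟨h, (unitarilySimilar_iff_charpoly_eq hh (isHermitian_diagonal_ofReal l)).2 ?_, hbase⟩
  rw [hcharpoly, charpoly_diagonal, ← Equiv.prod_comp σ, Fin.prod_univ_three]

theorem finrank_eigenspace_initBlock_add_two_le {x : Matrix (Fin (n + 1)) (Fin (n + 1)) ℂ}
    (hx : x.IsHermitian) (hreg : IsRegularAt x) (hn : 3 ≤ n) {θ : ℝ}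
    (hθ : Module.finrank ℂ (eigenspace x θ) + 2 ≤ n + 1) :
    Module.finrank ℂ (eigenspace (initBlock x) θ) + 2 ≤ n := by
  by_cases hbot : eigenspace x θ = ⊥
  · have hle := finrank_eigenspace_initBlock_le_one hx hbot
    omega
  · have hlt := (isRegularAt_iff_finrank_lt hx).1 hreg θ hbot
    omega

theorem exists_isBasePoint : ∀ (k : ℕ) (l : Fin (k + 3) → ℝ),
    (∀ θ, Fintype.card {i // l i = θ} + 2 ≤ k + 3) →
    ∃ h : Matrix (Fin (k + 3)) (Fin (k + 3)) ℂ,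
      UnitarilySimilar h (diagonal fun i => (l i : ℂ)) ∧ IsBasePoint k h
  | 0, l, hl => by
    refine exists_isBasePoint_three_of_injective fun i j hij => ?_
    have hcard : Fintype.card {i // l i = l j} ≤ 1 := by have := hl (l j); omega
    rw [Fintype.card_le_one_iff_subsingleton] at hcard
    exact congrArg Subtype.val (Subsingleton.elim (⟨i, hij⟩ : {i // l i = l j}) ⟨j, rfl⟩)
  | k + 1, l, hl => by
    obtain ⟨U, hU, hrow⟩ := exists_unitary_last_row_ne_zero (k + 3)
    set x := U * (diagonal fun i => (l i : ℂ)) * Uᴴ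
    have hxl : UnitarilySimilar x (diagonal fun i => (l i : ℂ)) := ⟨U, hU, rfl⟩
    have hxh : x.IsHermitian := hxl.isHermitian (isHermitian_diagonal_ofReal l)
    have hreg : IsRegularAt x := isRegularAt_conj_diagonal hU hrow l
    have hblock := unitarilySimilar_diagonal_eigenvalues (initBlock_isHermitian hxh)
    obtain ⟨h', hh', hbase⟩ := exists_isBasePoint k (initBlock_isHermitian hxh).eigenvalues
      fun θ => by
        rw [← finrank_eigenspace_diagonal, ← hblock.finrank_eigenspace_eq]
        refine finrank_eigenspace_initBlock_add_two_le hxh hreg (Nat.le_add_left 3 k) ?_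
        rw [hxl.finrank_eigenspace_eq, finrank_eigenspace_diagonal]
        exact hl θ
    have hh'x : UnitarilySimilar h' (initBlock x) := hh'.trans hblock.symm
    obtain ⟨W, hW, hh'W⟩ := hh'x
    have hconj : UnitarilySimilar (extendOne W * x * (extendOne W)ᴴ) x :=
      ⟨_, extendOne_mem_unitaryGroup hW, rfl⟩
    have hconj_block : initBlock (extendOne W * x * (extendOne W)ᴴ) = h' := by
      rw [initBlock_extendOne_conj, hh'W]
    exact ⟨_, hconj.trans hxl, hconj_block ▸ hbase,
      hreg.of_unitarilySimilar hxh hconj (hconj_block ▸ ⟨W, hW, hh'W⟩)⟩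

end Existence

/-! ### Orbits that are projective spaces -/

theorem smoothMapOn_of_contDiff {E F : Type*} [NormedAddCommGroup E] [NormedSpace ℝ E]
    [NormedAddCommGroup F] [NormedSpace ℝ F] {f : E → F} (hf : ContDiff ℝ ∞ f) (X : Set E) :
    SmoothMapOn f X :=
  fun _ _ => ⟨Set.univ, isOpen_univ, trivial, f, hf.contDiffOn, fun _ _ => rfl⟩

section ProjectiveSpace

variable {m : ℕ}

theorem star_dotProduct_self_real {ι : Type*} [Fintype ι] (v : ι → ℂ) :
    star (star v ⬝ᵥ v) = star v ⬝ᵥ v := by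
  rw [← star_dotProduct_star, star_star, dotProduct_comm]

open scoped ComplexOrder in
theorem unitarilySimilar_lineProjector_single (ℓ : Projectivization ℂ (Fin (m + 1) → ℂ))
    (j : Fin (m + 1)) : UnitarilySimilar (lineProjector ℓ) (single j j 1) := by
  have hne : star ℓ.rep ⬝ᵥ ℓ.rep ≠ 0 := by
    rw [Ne, dotProduct_star_self_eq_zero]; exact ℓ.rep_nonzero
  refine (unitarilySimilar_iff_charpoly_eq ?_ ?_).2 ?_
  · rw [Matrix.IsHermitian, lineProjector, conjTranspose_smul, conjTranspose_vecMulVec, star_star,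
      star_inv₀, star_dotProduct_self_real]
  · rw [Matrix.IsHermitian, conjTranspose_single, star_one]
  · rw [single_eq_single_vecMulVec_single, lineProjector, ← smul_vecMulVec, charpoly_vecMulVec,
      charpoly_vecMulVec, smul_dotProduct, dotProduct_comm ℓ.rep, smul_eq_mul, inv_mul_cancel₀ hne,
      single_one_dotProduct, Pi.single_eq_same]

theorem lineProjector_mk {v : Fin (m + 1) → ℂ} (hv : v ≠ 0) :
    lineProjector (Projectivization.mk ℂ v hv) =
      (star v ⬝ᵥ v)⁻¹ • vecMulVec v (star v) := by
  obtain ⟨a, ha⟩ := Projectivization.exists_smul_eq_mk_rep ℂ v hv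
  have ha0 : (a : ℂ) ≠ 0 := a.ne_zero
  have ha0' : star (a : ℂ) ≠ 0 := star_ne_zero.2 ha0
  rw [lineProjector, ← ha, Units.smul_def, star_smul, smul_dotProduct, dotProduct_smul,
    smul_vecMulVec, vecMulVec_smul, smul_smul, smul_smul, smul_eq_mul, smul_eq_mul]
  congr 1
  field_simp

theorem complexProjectiveSpace_eq (j : Fin (m + 1)) :
    complexProjectiveSpace m = {P | UnitarilySimilar P (single j j 1)} := by
  refine Set.Subset.antisymm ?_ ?_
  · rintro _ ⟨ℓ, rfl⟩
    exact unitarilySimilar_lineProjector_single ℓ j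
  · rintro _ ⟨U, hU, rfl⟩
    have hcol : star (U.col j) ⬝ᵥ U.col j = 1 := by
      have hentry := congrFun₂ (conjTranspose_mul_self_of_mem_unitaryGroup hU) j j
      rwa [one_apply_eq] at hentry
    have hcol0 : U.col j ≠ 0 := fun h0 => by simp [h0] at hcol
    refine ⟨Projectivization.mk ℂ (U.col j) hcol0, ?_⟩
    rw [lineProjector_mk, hcol, inv_one, one_smul, single_eq_single_vecMulVec_single,
      mul_vecMulVec, vecMulVec_mul, mulVec_single_one, single_one_vecMul]
    rfl

theorem UnitarilySimilar.smul_add_smul_one {ι : Type*} [Fintype ι] [DecidableEq ι]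
    {x y : Matrix ι ι ℂ} (hxy : UnitarilySimilar x y) (a b : ℂ) :
    UnitarilySimilar (a • x + b • 1) (a • y + b • 1) := by
  obtain ⟨U, hU, rfl⟩ := hxy
  refine ⟨U, hU, ?_⟩
  rw [mul_add, add_mul, mul_smul_comm, smul_mul_assoc, mul_smul_comm, smul_mul_assoc, mul_one,
    mul_conjTranspose_self_of_mem_unitaryGroup hU]

theorem coadjointOrbit_const {n : ℕ} {l : Fin n → ℝ} {θ : ℝ} (hl : ∀ i, l i = θ) :
    coadjointOrbit l = {(θ : ℂ) • 1} := by
  have hdiag : (diagonal fun i => (l i : ℂ)) = (θ : ℂ) • 1 := by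
    simp_rw [hl, smul_one_eq_diagonal]
  refine Set.Subset.antisymm (fun x hx => ?_) ?_
  · have hx' : UnitarilySimilar x (diagonal fun i => (l i : ℂ)) := hx
    exact (hdiag ▸ hx').eq_smul_one
  · rintro _ rfl
    exact hdiag ▸ UnitarilySimilar.refl (diagonal fun i => (l i : ℂ))

theorem complexProjectiveSpace_zero : complexProjectiveSpace 0 = {1} := by
  have hsingle : single (0 : Fin (0 + 1)) (0 : Fin (0 + 1)) (1 : ℂ) = (1 : ℂ) • 1 := by
    ext i j
    rw [Fin.fin_one_eq_zero i, Fin.fin_one_eq_zero j]; simp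
  rw [complexProjectiveSpace_eq 0, hsingle]
  refine Set.Subset.antisymm (fun P hP => ?_) ?_
  · simpa using UnitarilySimilar.eq_smul_one hP
  · rintro _ rfl
    simpa using UnitarilySimilar.refl (1 : Matrix (Fin (0 + 1)) (Fin (0 + 1)) ℂ)

attribute [local instance] Matrix.normedAddCommGroup Matrix.normedSpace

theorem orbitIsProjectiveSpace_of_eq_singleton {n : ℕ} {l : Fin n → ℝ}
    {x : Matrix (Fin n) (Fin n) ℂ} (hx : coadjointOrbit l = {x}) : OrbitIsProjectiveSpace l := by
  refine ⟨0, ?_⟩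
  rw [hx, complexProjectiveSpace_zero]
  exact ⟨fun _ => 1, fun _ => x, smoothMapOn_of_contDiff contDiff_const _,
    smoothMapOn_of_contDiff contDiff_const _, fun _ _ => rfl, fun _ _ => rfl,
    fun _ hy => hy.symm, fun _ hy => hy.symm⟩

theorem orbitIsProjectiveSpace_of_eq_off {l : Fin (m + 1) → ℝ} {θ : ℝ} {j : Fin (m + 1)}
    (hl : ∀ i, i ≠ j → l i = θ) (hj : l j ≠ θ) : OrbitIsProjectiveSpace l := by
  set c : ℂ := l j - θ with hc
  have hc0 : c ≠ 0 := sub_ne_zero.2 (Complex.ofReal_injective.ne hj)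
  have hdiag : (diagonal fun i => (l i : ℂ)) = c • single j j 1 + (θ : ℂ) • 1 := by
    rw [← diagonal_single, smul_one_eq_diagonal, ← diagonal_smul, diagonal_add]
    congr 1; ext i
    obtain rfl | hij := eq_or_ne i j
    · simp [hc]
    · simp [hl i hij, hij]
  have hleft (x : Matrix (Fin (m + 1)) (Fin (m + 1)) ℂ) :
      c • (c⁻¹ • x + (-(c⁻¹ * θ)) • 1) + (θ : ℂ) • 1 = x := by
    rw [smul_add, smul_smul, smul_smul, mul_neg, ← mul_assoc, mul_inv_cancel₀ hc0]
    module
  have hright (y : Matrix (Fin (m + 1)) (Fin (m + 1)) ℂ) :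
      c⁻¹ • (c • y + (θ : ℂ) • 1) + (-(c⁻¹ * θ)) • 1 = y := by
    rw [smul_add, smul_smul, smul_smul, inv_mul_cancel₀ hc0]
    module
  have hsmooth (a b : ℂ) (X : Set (Matrix (Fin (m + 1)) (Fin (m + 1)) ℂ)) :
      SmoothMapOn (fun x => a • x + b • 1) X :=
    smoothMapOn_of_contDiff ((contDiff_id.const_smul a).add contDiff_const) X
  refine ⟨m, _, _, hsmooth c⁻¹ (-(c⁻¹ * θ)) _, hsmooth c θ _, fun x hx => ?_, fun y hy => ?_,
    fun x _ => hleft x, fun y _ => hright y⟩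
  · have hx' : UnitarilySimilar x (diagonal fun i => (l i : ℂ)) := hx
    rw [complexProjectiveSpace_eq j]
    simpa only [Set.mem_ofPred_eq, hdiag, hright] using hx'.smul_add_smul_one c⁻¹ (-(c⁻¹ * θ))
  · rw [complexProjectiveSpace_eq j] at hy
    change UnitarilySimilar _ (diagonal fun i => (l i : ℂ))
    exact hdiag ▸ UnitarilySimilar.smul_add_smul_one hy c θ

theorem card_add_two_le_of_not_projective {n : ℕ} {l : Fin n → ℝ}
    (hproj : ¬ OrbitIsProjectiveSpace l) (θ : ℝ) : Fintype.card {i // l i = θ} + 2 ≤ n := by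
  contrapose! hproj
  by_cases hconst : ∀ i, l i = θ
  · exact orbitIsProjectiveSpace_of_eq_singleton (coadjointOrbit_const hconst)
  push Not at hconst
  obtain ⟨j, hj⟩ := hconst
  have hcard : Fintype.card {i // ¬ l i = θ} ≤ 1 := by
    rw [Fintype.card_subtype_compl, Fintype.card_fin]
    omega
  rw [Fintype.card_le_one_iff_subsingleton] at hcard
  cases n with
  | zero => exact j.elim0
  | succ m =>
    refine orbitIsProjectiveSpace_of_eq_off (θ := θ) (j := j) (fun i hij => ?_) hj
    by_contra hi
    exact hij (congrArg Subtype.val (Subsingleton.elim (⟨i, hi⟩ : {i // ¬ l i = θ}) ⟨j, hj⟩))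

end ProjectiveSpace

/-! ### The last column of a matrix with prescribed spectra -/

section LastColumn

variable {n : ℕ}

theorem eq_of_initBlock_lastCol_trace {x z : Matrix (Fin (n + 1)) (Fin (n + 1)) ℂ}
    (hx : x.IsHermitian) (hz : z.IsHermitian) (hblock : initBlock x = initBlock z)
    (hcol : lastCol x = lastCol z) (htrace : x.trace = z.trace) : x = z := by
  rw [trace_eq_trace_initBlock_add, trace_eq_trace_initBlock_add z, hblock] at htrace
  rw [eq_bordered_of_isHermitian hx, eq_bordered_of_isHermitian hz, hblock, hcol,
    add_left_cancel htrace]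

theorem det_bordered_diagonal {K : Type*} [Field K] {d : Fin n → K} (hd : ∀ i, d i ≠ 0)
    (v w : Fin n → K) (t : K) :
    (bordered (diagonal d) v w t).det = (∏ i, d i) * (t - ∑ i, w i * v i / d i) := by
  have hinv : diagonal d * diagonal d⁻¹ = 1 := by
    rw [diagonal_mul_diagonal, ← diagonal_one]
    exact congrArg diagonal (funext fun i => mul_inv_cancel₀ (hd i))
  have hfactor : bordered (diagonal d) v w t = bordered (diagonal d) 0 w 1 *
      bordered 1 (diagonal d⁻¹ *ᵥ v) 0 (t - w ⬝ᵥ (diagonal d⁻¹ *ᵥ v)) := by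
    rw [bordered_mul, mulVec_mulVec, hinv]
    simp
  have hlower : (bordered (diagonal d) 0 w 1).IsLowerTriangular := fun i j hij => by
    induction i using Fin.lastCases with
    | last => exact absurd hij (Fin.le_last j).not_gt
    | cast i => induction j using Fin.lastCases with
      | last => simp
      | cast j => simpa using diagonal_apply_ne d (Fin.castSucc_lt_castSucc_iff.1 hij).ne
  have hupper : ∀ (u : Fin n → K) (s : K), (bordered 1 u 0 s).IsUpperTriangular :=
    fun u s i j hij => by
      induction j using Fin.lastCases with
      | last => exact absurd hij (Fin.le_last i).not_gt
      | cast j => induction i using Fin.lastCases with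
        | last => simp
        | cast i => simpa using one_apply_ne (Fin.castSucc_lt_castSucc_iff.1 hij).ne'
  rw [hfactor, det_mul, det_of_isLowerTriangular _ hlower, det_of_isUpperTriangular (hupper _ _)]
  simp [Fin.prod_univ_castSucc, dotProduct, mulVec_diagonal, div_eq_inv_mul, mul_left_comm]

theorem sum_fiber_eq_zero_of_sum_div {ι : Type*} [Fintype ι] {μ c : ι → ℝ}
    (hsum : ∀ z : ℝ, (∀ i, z ≠ μ i) → ∑ i, c i / (z - μ i) = 0) (θ : ℝ) :
    ∑ i with μ i = θ, c i = 0 := by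
  have hlim : Filter.Tendsto (fun z : ℝ => ∑ i, c i * ((z - θ) / (z - μ i))) (𝓝[≠] θ)
      (𝓝 (∑ i, if μ i = θ then c i else 0)) := by
    refine tendsto_finsetSum _ fun i _ => ?_
    split_ifs with hi
    · refine tendsto_const_nhds.congr' ?_
      filter_upwards [self_mem_nhdsWithin] with z hz
      rw [hi, div_self (sub_ne_zero.2 hz), mul_one]
    · have hcont : ContinuousAt (fun z : ℝ => c i * ((z - θ) / (z - μ i))) θ := by
        have := sub_ne_zero.2 (Ne.symm hi)
        fun_prop (disch := assumption)
      simpa only [sub_self, zero_div, mul_zero] using hcont.tendsto.mono_left nhdsWithin_le_nhds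
  have hzero : ∀ᶠ z in 𝓝[≠] θ, ∑ i, c i * ((z - θ) / (z - μ i)) = 0 := by
    have hpoles : ∀ᶠ z in 𝓝[≠] θ, ∀ i, z ≠ μ i := by
      rw [Filter.eventually_all]
      intro i
      by_cases hi : μ i = θ
      · exact hi ▸ self_mem_nhdsWithin
      · exact (isOpen_ne.eventually_mem (Ne.symm hi : θ ≠ μ i)).filter_mono nhdsWithin_le_nhds
    filter_upwards [hpoles] with z hz
    calc ∑ i, c i * ((z - θ) / (z - μ i)) = (z - θ) * ∑ i, c i / (z - μ i) := by
          rw [Finset.mul_sum]; exact Finset.sum_congr rfl fun i _ => by ring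
      _ = 0 := by rw [hsum z hz, mul_zero]
  rw [Finset.sum_filter]
  exact tendsto_nhds_unique (hlim.congr' hzero) tendsto_const_nhds

variable {x h : Matrix (Fin (n + 1)) (Fin (n + 1)) ℂ} {μ : Fin n → ℝ}

theorem eval_charpoly_of_initBlock_eq_diagonal (hx : x.IsHermitian)
    (hdiag : initBlock x = diagonal fun i => (μ i : ℂ)) {z : ℝ} (hz : ∀ i, z ≠ μ i) :
    x.charpoly.eval (z : ℂ) = (∏ i, ((z : ℂ) - μ i)) * (z - x (Fin.last n) (Fin.last n) -
      ((∑ i, ‖lastCol x i‖ ^ 2 / (z - μ i) : ℝ) : ℂ)) := by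
  have hsub : scalar (Fin (n + 1)) (z : ℂ) - x = bordered (diagonal fun i => (z : ℂ) - μ i)
      (-lastCol x) (-star (lastCol x)) (z - x (Fin.last n) (Fin.last n)) := by
    have hscalar : scalar (Fin (n + 1)) (z : ℂ) =
        bordered (diagonal fun _ : Fin n => (z : ℂ)) 0 0 (z : ℂ) :=
      bordered_ext (by simp [diagonal_apply]) (by simp [Fin.castSucc_ne_last])
        (by simp [fun i : Fin n => (Fin.castSucc_ne_last i).symm]) (by simp)
    conv_lhs => rw [eq_bordered_of_isHermitian hx, hdiag, hscalar, bordered_sub, diagonal_sub]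
    rw [zero_sub, zero_sub]
  rw [eval_charpoly, hsub, det_bordered_diagonal fun i => sub_ne_zero.2 (by exact_mod_cast hz i)]
  congr 2
  push_cast
  refine Finset.sum_congr rfl fun i _ => ?_
  rw [← Complex.conj_mul']
  simp

theorem sum_fiber_norm_lastCol_sq_eq (hh : h.IsHermitian) (hxh : UnitarilySimilar x h)
    (hx_diag : initBlock x = diagonal fun i => (μ i : ℂ))
    (hh_diag : initBlock h = diagonal fun i => (μ i : ℂ)) (θ : ℝ) :
    ∑ i with μ i = θ, ‖lastCol x i‖ ^ 2 = ∑ i with μ i = θ, ‖lastCol h i‖ ^ 2 := by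
  rw [← sub_eq_zero, ← Finset.sum_sub_distrib]
  refine sum_fiber_eq_zero_of_sum_div (fun z hz => ?_) θ
  have hcorner : x (Fin.last n) (Fin.last n) = h (Fin.last n) (Fin.last n) :=
    apply_last_last_eq hxh (hx_diag.trans hh_diag.symm ▸ .refl _)
  have heval := congrArg (Polynomial.eval (z : ℂ)) hxh.charpoly_eq
  rw [eval_charpoly_of_initBlock_eq_diagonal (hxh.isHermitian hh) hx_diag hz,
    eval_charpoly_of_initBlock_eq_diagonal hh hh_diag hz, hcorner] at heval
  have hprod : (∏ i, ((z : ℂ) - μ i)) ≠ 0 :=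
    Finset.prod_ne_zero_iff.2 fun i _ => sub_ne_zero.2 (by exact_mod_cast hz i)
  have hsums := Complex.ofReal_injective (sub_right_injective (mul_left_cancel₀ hprod heval))
  simp only [sub_div, Finset.sum_sub_distrib]
  rw [hsums, sub_self]

theorem IsRegularAt.eq_of_lastCol_ne_zero (hr : IsRegularAt h) (hh : h.IsHermitian)
    (hdiag : initBlock h = diagonal fun i => (μ i : ℂ)) {i j : Fin n} (hi : lastCol h i ≠ 0)
    (hij : μ j = μ i) : j = i := by
  by_contra hne
  have heig : ∀ a b : ℂ, initBlock h *ᵥ (Pi.single i a - Pi.single j b) =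
      (μ i : ℂ) • (Pi.single i a - Pi.single j b) := by
    intro a b
    rw [hdiag, mulVec_sub, diagonal_mulVec_single, diagonal_mulVec_single, hij, smul_sub,
      ← Pi.single_smul, ← Pi.single_smul, smul_eq_mul, smul_eq_mul]
  by_cases hbot : eigenspace h (μ i) = ⊥
  · have hzero := eq_zero_of_eigenspace_eq_bot hh hbot
      (heig (star (lastCol h j)) (star (lastCol h i))) (by simp [dotProduct_sub, mul_comm])
    exact hi (by simpa [hne] using congrFun hzero j)
  · obtain ⟨p, hp⟩ := hr _ hbot
    exact hi (by simpa using star_lastCol_dotProduct_eq_zero hh hp (heig 1 0))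

theorem IsRegularAt.norm_lastCol_eq_of_diagonal (hr : IsRegularAt h) (hh : h.IsHermitian)
    (hxh : UnitarilySimilar x h) (hx_diag : initBlock x = diagonal fun i => (μ i : ℂ))
    (hh_diag : initBlock h = diagonal fun i => (μ i : ℂ)) (i : Fin n) :
    ‖lastCol x i‖ = ‖lastCol h i‖ := by
  have hx := hxh.isHermitian hh
  have hrx : IsRegularAt x :=
    hr.of_unitarilySimilar hh hxh (hx_diag.trans hh_diag.symm ▸ .refl _)
  have hfilter : ∀ {z : Matrix (Fin (n + 1)) (Fin (n + 1)) ℂ}, IsRegularAt z → z.IsHermitian →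
      initBlock z = (diagonal fun i => (μ i : ℂ)) → lastCol z i ≠ 0 →
      Finset.univ.filter (fun j => μ j = μ i) = {i} := fun hrz hz hz_diag hi => by
    ext j
    simp only [Finset.mem_filter, Finset.mem_univ, true_and, Finset.mem_singleton]
    exact ⟨hrz.eq_of_lastCol_ne_zero hz hz_diag hi, fun hj => by rw [hj]⟩
  have hsum := sum_fiber_norm_lastCol_sq_eq hh hxh hx_diag hh_diag (μ i)
  by_cases hi : lastCol h i = 0 ∧ lastCol x i = 0
  · rw [hi.1, hi.2]
  · have hsingle : Finset.univ.filter (fun j => μ j = μ i) = {i} := by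
      obtain hi | hi := not_and_or.1 hi
      · exact hfilter hr hh hh_diag hi
      · exact hfilter hrx hx hx_diag hi
    rw [hsingle, Finset.sum_singleton, Finset.sum_singleton] at hsum
    exact (sq_eq_sq₀ (norm_nonneg _) (norm_nonneg _)).1 hsum

theorem unitarilySimilar_extendOne_conj {g : Matrix (Fin n) (Fin n) ℂ}
    (hg : g ∈ unitaryGroup (Fin n) ℂ) (x : Matrix (Fin (n + 1)) (Fin (n + 1)) ℂ) :
    UnitarilySimilar (extendOne g * x * (extendOne g)ᴴ) x :=
  ⟨_, extendOne_mem_unitaryGroup hg, rfl⟩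

theorem IsRegularAt.norm_lastCol_eq (hr : IsRegularAt h) (hh : h.IsHermitian)
    (hxh : UnitarilySimilar x h) (hblock : initBlock x = initBlock h)
    {U : Matrix (Fin n) (Fin n) ℂ} (hU : U ∈ unitaryGroup (Fin n) ℂ)
    (hdiag : initBlock h = U * (diagonal fun i => (μ i : ℂ)) * Uᴴ) (i : Fin n) :
    ‖(Uᴴ *ᵥ lastCol x) i‖ = ‖(Uᴴ *ᵥ lastCol h) i‖ := by
  have hU' := conjTranspose_mem_unitaryGroup hU
  have hsim_x := unitarilySimilar_extendOne_conj hU' x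
  have hsim_h := unitarilySimilar_extendOne_conj hU' h
  have hconj_diag : Uᴴ * initBlock h * Uᴴᴴ = diagonal fun i => (μ i : ℂ) := by
    rw [hdiag, conjTranspose_conjTranspose, conjTranspose_mul_conj_mul hU]
  have hh_diag := (initBlock_extendOne_conj Uᴴ h).trans hconj_diag
  have hx_diag := (initBlock_extendOne_conj Uᴴ x).trans (hblock ▸ hconj_diag)
  have hblock_sim : UnitarilySimilar (initBlock (extendOne Uᴴ * h * (extendOne Uᴴ)ᴴ))
      (initBlock h) := ⟨Uᴴ, hU', initBlock_extendOne_conj Uᴴ h⟩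
  rw [← lastCol_extendOne_conj, ← lastCol_extendOne_conj]
  exact (hr.of_unitarilySimilar hh hsim_h hblock_sim).norm_lastCol_eq_of_diagonal
    (hsim_h.isHermitian hh) (hsim_x.trans (hxh.trans hsim_h.symm)) hx_diag hh_diag i

end LastColumn

/-! ### Parametrization of the fiber by the product of a three-sphere and a torus -/

section SphereTorus

/-- The vector space in which `sphereTorus ι` lies. -/
abbrev SphereTorusAmbient (ι : Type) : Type := (ℂ × ℂ) × (ι → ℂ)

/-- The product of the unit sphere `S³ ⊆ ℂ²` and of the unit circles `S¹ ⊆ ℂ` indexed by `ι`. -/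
def sphereTorus (ι : Type) : Set (SphereTorusAmbient ι) :=
  {m | ‖m.1.1‖ ^ 2 + ‖m.1.2‖ ^ 2 = 1 ∧ ∀ i, ‖m.2 i‖ = 1}

theorem restrict_mem_sphereTorus {ι κ : Type} {m : SphereTorusAmbient (ι ⊕ κ)}
    (hm : m ∈ sphereTorus (ι ⊕ κ)) : (m.1, m.2 ∘ Sum.inl) ∈ sphereTorus ι :=
  ⟨hm.1, fun i => hm.2 (Sum.inl i)⟩

end SphereTorus

section QuaternionMatrix

/-- The pair `q : ℂ × ℂ` as the quaternion `q.1 + j q.2`, acting on `ℂ²`; for `q` of norm one this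
identifies `S³` with `SU(2)`. -/
def quatMatrix (q : ℂ × ℂ) : Matrix (Fin 2) (Fin 2) ℂ := !![q.1, -star q.2; q.2, star q.1]

/-- The vector `v / s` of `ℂ²`, as a pair. -/
noncomputable def scaledPair (s : ℝ) (v : Fin 2 → ℂ) : ℂ × ℂ := (v 0 / s, v 1 / s)

variable {q : ℂ × ℂ} {s : ℝ} {v : Fin 2 → ℂ}

theorem star_mul_self_eq_norm_sq (z : ℂ) : star z * z = ((‖z‖ ^ 2 : ℝ) : ℂ) := by
  push_cast
  exact Complex.conj_mul' z

theorem star_mul_add_star_mul_eq_one (hq : ‖q.1‖ ^ 2 + ‖q.2‖ ^ 2 = 1) :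
    star q.1 * q.1 + star q.2 * q.2 = 1 := by
  rw [star_mul_self_eq_norm_sq, star_mul_self_eq_norm_sq]
  exact_mod_cast hq

theorem quatMatrix_mem_unitaryGroup (hq : ‖q.1‖ ^ 2 + ‖q.2‖ ^ 2 = 1) :
    quatMatrix q ∈ unitaryGroup (Fin 2) ℂ := by
  have hsum := star_mul_add_star_mul_eq_one hq
  rw [mem_unitaryGroup_iff', star_eq_conjTranspose]
  ext i j
  fin_cases i <;> fin_cases j
  · simpa [quatMatrix, mul_apply, Fin.sum_univ_two] using hsum
  · simp [quatMatrix, mul_apply, Fin.sum_univ_two, mul_comm]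
  · simp [quatMatrix, mul_apply, Fin.sum_univ_two, mul_comm]
  · simpa [quatMatrix, mul_apply, Fin.sum_univ_two, mul_comm, add_comm] using hsum

theorem quatMatrix_mulVec (q : ℂ × ℂ) (s : ℂ) : quatMatrix q *ᵥ ![s, 0] = ![q.1 * s, q.2 * s] := by
  ext i
  fin_cases i <;> simp [quatMatrix, mulVec, dotProduct, Fin.sum_univ_two]

theorem norm_scaledPair (hs : s ≠ 0) (hv : ∑ i, ‖v i‖ ^ 2 = s ^ 2) :
    ‖(scaledPair s v).1‖ ^ 2 + ‖(scaledPair s v).2‖ ^ 2 = 1 := by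
  rw [Fin.sum_univ_two] at hv
  simp only [scaledPair, norm_div, div_pow, Complex.norm_real, Real.norm_eq_abs, sq_abs]
  rw [← add_div, hv, div_self (pow_ne_zero 2 hs)]

theorem quatMatrix_scaledPair_mulVec (hs : s ≠ 0) :
    quatMatrix (scaledPair s v) *ᵥ ![(s : ℂ), 0] = v := by
  have hs' : (s : ℂ) ≠ 0 := by exact_mod_cast hs
  rw [quatMatrix_mulVec]
  ext i
  fin_cases i <;> simp [scaledPair, hs']

theorem scaledPair_quatMatrix_mulVec (hs : s ≠ 0) :
    scaledPair s (quatMatrix q *ᵥ ![(s : ℂ), 0]) = q := by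
  have hs' : (s : ℂ) ≠ 0 := by exact_mod_cast hs
  rw [quatMatrix_mulVec]
  exact Prod.ext (by simp [scaledPair, hs']) (by simp [scaledPair, hs'])

end QuaternionMatrix

section Parametrization

attribute [local instance] Matrix.normedAddCommGroup Matrix.normedSpace

/-- Mutually inverse smooth maps `m ↦ g m * h * (g m)ᴴ` and `coord` between `sphereTorus ι` and
`spectralFiber h`, where `g` is unitary on `sphereTorus ι`. Keeping the conjugating matrix `g`, and
not just the conjugated one, lets the parametrization of `initBlock h` act on `h`. -/
structure FiberParametrization {n : ℕ} (h : Matrix (Fin n) (Fin n) ℂ) (ι : Type) [Fintype ι] where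
  conjugator : SphereTorusAmbient ι → Matrix (Fin n) (Fin n) ℂ
  coord : Matrix (Fin n) (Fin n) ℂ → SphereTorusAmbient ι
  contDiff_conjugator : ContDiff ℝ ∞ conjugator
  contDiff_coord : ContDiff ℝ ∞ coord
  conjugator_mem : ∀ m ∈ sphereTorus ι, conjugator m ∈ unitaryGroup (Fin n) ℂ
  conj_mem : ∀ m ∈ sphereTorus ι, conjugator m * h * (conjugator m)ᴴ ∈ spectralFiber h
  coord_mem : ∀ x ∈ spectralFiber h, coord x ∈ sphereTorus ι
  coord_conj : ∀ m ∈ sphereTorus ι, coord (conjugator m * h * (conjugator m)ᴴ) = m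
  conj_coord : ∀ x ∈ spectralFiber h, conjugator (coord x) * h * (conjugator (coord x))ᴴ = x

variable {n : ℕ} {ι : Type} [Fintype ι]

theorem contDiff_initBlock_lastCol :
    ContDiff ℝ ∞ fun x : Matrix (Fin (n + 1)) (Fin (n + 1)) ℂ => (initBlock x, lastCol x) := by
  have hentry : ∀ i j, ContDiff ℝ ∞ fun x : Matrix (Fin (n + 1)) (Fin (n + 1)) ℂ => x i j :=
    contDiff_matrix_iff.1 contDiff_id
  exact (contDiff_matrix_iff.2 fun i j => hentry i.castSucc j.castSucc).prodMk
    (contDiff_pi.2 fun i => hentry i.castSucc (Fin.last n))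

/-- A parametrization all of whose conjugating matrices have the form `extendOne (g m)`. -/
def FiberParametrization.ofInitBlock {h : Matrix (Fin (n + 1)) (Fin (n + 1)) ℂ}
    (hh : h.IsHermitian) (g : SphereTorusAmbient ι → Matrix (Fin n) (Fin n) ℂ)
    (coord : Matrix (Fin n) (Fin n) ℂ × (Fin n → ℂ) → SphereTorusAmbient ι)
    (contDiff_g : ContDiff ℝ ∞ g) (contDiff_coord : ContDiff ℝ ∞ coord)
    (g_mem : ∀ m ∈ sphereTorus ι, g m ∈ unitaryGroup (Fin n) ℂ)
    (conj_mem : ∀ m ∈ sphereTorus ι, g m * initBlock h * (g m)ᴴ ∈ spectralFiber (initBlock h))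
    (coord_mem : ∀ x ∈ spectralFiber h, coord (initBlock x, lastCol x) ∈ sphereTorus ι)
    (coord_conj : ∀ m ∈ sphereTorus ι,
      coord (g m * initBlock h * (g m)ᴴ, g m *ᵥ lastCol h) = m)
    (conj_coord : ∀ x ∈ spectralFiber h, g (coord (initBlock x, lastCol x)) * initBlock h *
      (g (coord (initBlock x, lastCol x)))ᴴ = initBlock x)
    (mulVec_coord : ∀ x ∈ spectralFiber h,
      g (coord (initBlock x, lastCol x)) *ᵥ lastCol h = lastCol x) :
    FiberParametrization h ι where
  conjugator m := extendOne (g m)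
  coord x := coord (initBlock x, lastCol x)
  contDiff_conjugator := contDiff_extendOne contDiff_g
  contDiff_coord := contDiff_coord.comp contDiff_initBlock_lastCol
  conjugator_mem m hm := extendOne_mem_unitaryGroup (g_mem m hm)
  conj_mem m hm := mem_spectralFiber_succ.2 ⟨unitarilySimilar_extendOne_conj (g_mem m hm) h,
    initBlock_extendOne_conj (g m) h ▸ conj_mem m hm⟩
  coord_mem := coord_mem
  coord_conj m hm := by rw [initBlock_extendOne_conj, lastCol_extendOne_conj, coord_conj m hm]
  conj_coord x hx := by
    have hxh := unitarilySimilar_of_mem_spectralFiber hx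
    have hsim := unitarilySimilar_extendOne_conj (g_mem _ (coord_mem x hx)) h
    refine eq_of_initBlock_lastCol_trace (hsim.isHermitian hh) (hxh.isHermitian hh) ?_ ?_
      (hsim.trans hxh.symm).trace_eq
    · rw [initBlock_extendOne_conj, conj_coord x hx]
    · rw [lastCol_extendOne_conj, mulVec_coord x hx]

end Parametrization

section BaseCase

attribute [local instance] Matrix.normedAddCommGroup Matrix.normedSpace

theorem contDiff_quatMatrix : ContDiff ℝ ∞ quatMatrix := by
  refine contDiff_matrix_iff.2 fun i j => ?_
  fin_cases i <;> fin_cases j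
  · exact contDiff_fst
  · exact (Complex.conjCLE.contDiff.comp contDiff_snd).neg
  · exact contDiff_snd
  · exact Complex.conjCLE.contDiff.comp contDiff_fst

theorem contDiff_scaledPair (s : ℝ) : ContDiff ℝ ∞ (scaledPair s) :=
  ((contDiff_apply ℝ ℂ 0).div_const _).prodMk ((contDiff_apply ℝ ℂ 1).div_const _)

theorem conj_smul_one {n : ℕ} {g : Matrix (Fin n) (Fin n) ℂ} (hg : g ∈ unitaryGroup (Fin n) ℂ)
    (c : ℂ) : g * (c • (1 : Matrix (Fin n) (Fin n) ℂ)) * gᴴ = c • 1 := by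
  rw [mul_smul_comm, mul_one, smul_mul_assoc, mul_conjTranspose_self_of_mem_unitaryGroup hg]

theorem initBlock_eq_smul_one_of_mem_spectralFiber {n : ℕ}
    {h x : Matrix (Fin (n + 1)) (Fin (n + 1)) ℂ} {c : ℂ} (hc : initBlock h = c • 1)
    (hx : x ∈ spectralFiber h) : initBlock x = c • 1 := by
  have hsim := unitarilySimilar_of_mem_spectralFiber (mem_spectralFiber_succ.1 hx).2
  exact UnitarilySimilar.eq_smul_one (hc ▸ hsim)

theorem exists_sum_norm_sq_eq_sq {n : ℕ} {v : Fin n → ℂ} (hv : v ≠ 0) :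
    ∃ s : ℝ, s ≠ 0 ∧ ∑ i, ‖v i‖ ^ 2 = s ^ 2 := by
  have hnonneg : 0 ≤ ∑ i, ‖v i‖ ^ 2 := Finset.sum_nonneg fun _ _ => by positivity
  refine ⟨√(∑ i, ‖v i‖ ^ 2), ?_, (Real.sq_sqrt hnonneg).symm⟩
  rwa [Ne, Real.sqrt_eq_zero hnonneg, sum_norm_sq_eq_zero_iff]

theorem nonempty_fiberParametrization_three {h : Matrix (Fin 3) (Fin 3) ℂ} (hh : h.IsHermitian)
    (hbase : IsBasePoint 0 h) : Nonempty (FiberParametrization h Empty) := by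
  obtain ⟨⟨c, hc⟩, hcol⟩ := hbase
  obtain ⟨s, hs, hs_sq⟩ := exists_sum_norm_sq_eq_sq hcol
  set Q := quatMatrix (scaledPair s (lastCol h))
  have hQ : Q ∈ unitaryGroup (Fin 2) ℂ := quatMatrix_mem_unitaryGroup (norm_scaledPair hs hs_sq)
  have hmul : ∀ q, (quatMatrix q * Qᴴ) *ᵥ lastCol h = quatMatrix q *ᵥ ![(s : ℂ), 0] := fun q => by
    have hcol_eq : lastCol h = Q *ᵥ ![(s : ℂ), 0] := (quatMatrix_scaledPair_mulVec hs).symm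
    rw [hcol_eq, mulVec_mulVec, mul_assoc, conjTranspose_mul_self_of_mem_unitaryGroup hQ, mul_one]
  have hg_mem : ∀ m ∈ sphereTorus Empty, quatMatrix m.1 * Qᴴ ∈ unitaryGroup (Fin 2) ℂ := fun m hm =>
    mul_mem (quatMatrix_mem_unitaryGroup hm.1) (conjTranspose_mem_unitaryGroup hQ)
  have hconj : ∀ m ∈ sphereTorus Empty,
      quatMatrix m.1 * Qᴴ * initBlock h * (quatMatrix m.1 * Qᴴ)ᴴ = initBlock h := fun m hm => by
    rw [hc, conj_smul_one (hg_mem m hm)]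
  let coord : Matrix (Fin 2) (Fin 2) ℂ × (Fin 2 → ℂ) → SphereTorusAmbient Empty :=
    fun p => (scaledPair s p.2, Empty.elim)
  have hblock : ∀ x ∈ spectralFiber h, initBlock x = initBlock h := fun x hx =>
    (initBlock_eq_smul_one_of_mem_spectralFiber hc hx).trans hc.symm
  have hcoord_mem : ∀ x ∈ spectralFiber h, coord (initBlock x, lastCol x) ∈ sphereTorus Empty :=
    fun x hx => ⟨norm_scaledPair hs ((sum_norm_lastCol_sq_eq hh
      (unitarilySimilar_of_mem_spectralFiber hx) (hblock x hx ▸ .refl _)).trans hs_sq),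
      fun i => i.elim⟩
  refine ⟨.ofInitBlock hh (fun m => quatMatrix m.1 * Qᴴ) coord ?_ ?_ hg_mem ?_ hcoord_mem ?_ ?_ ?_⟩
  · exact contDiff_matrix_mul (contDiff_quatMatrix.comp contDiff_fst) contDiff_const
  · exact ((contDiff_scaledPair s).comp contDiff_snd).prodMk contDiff_const
  · exact fun m hm => (hconj m hm).symm ▸ self_mem_spectralFiber _
  · exact fun m _ => Prod.ext (by simp only [coord, hmul, scaledPair_quatMatrix_mulVec hs])
      (Subsingleton.elim _ _)
  · exact fun x hx => (hconj _ (hcoord_mem x hx)).trans (hblock x hx).symm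
  · exact fun x _ => by rw [hmul, quatMatrix_scaledPair_mulVec hs]

end BaseCase

section Phases

attribute [local instance] Matrix.normedAddCommGroup Matrix.normedSpace

variable {n : ℕ} {v : Fin n → ℂ}

/-- The vector with entries `θ i` where `v i ≠ 0`, and `1` where `v i = 0`: the phases that can be
read off from the entries of `v` after they have been rotated. -/
noncomputable def phaseVector (v : Fin n → ℂ) (θ : {i // v i ≠ 0} → ℂ) : Fin n → ℂ := fun i =>
  if hi : v i ≠ 0 then θ ⟨i, hi⟩ else 1

theorem norm_phaseVector {θ : {i // v i ≠ 0} → ℂ} (hθ : ∀ i, ‖θ i‖ = 1) (i : Fin n) :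
    ‖phaseVector v θ i‖ = 1 := by
  unfold phaseVector
  split_ifs with hi
  · exact hθ ⟨i, hi⟩
  · exact norm_one

theorem norm_phaseVector_of_mem {ι : Type} {m : SphereTorusAmbient (ι ⊕ {i // v i ≠ 0})}
    (hm : m ∈ sphereTorus (ι ⊕ {i // v i ≠ 0})) (i : Fin n) :
    ‖phaseVector v (m.2 ∘ Sum.inr) i‖ = 1 :=
  norm_phaseVector (fun j => hm.2 (Sum.inr j)) i

theorem contDiff_phaseVector (v : Fin n → ℂ) : ContDiff ℝ ∞ (phaseVector v) := by
  refine contDiff_pi.2 fun i => ?_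
  unfold phaseVector
  split_ifs with hi
  · exact contDiff_apply ℝ ℂ (⟨i, hi⟩ : {i // v i ≠ 0})
  · exact contDiff_const

theorem diagonal_phaseVector_mulVec_div (θ : {i // v i ≠ 0} → ℂ) (i : {i // v i ≠ 0}) :
    (diagonal (phaseVector v θ) *ᵥ v) i / v i = θ i := by
  rw [mulVec_diagonal, mul_div_cancel_right₀ _ i.2, phaseVector, dif_pos i.2]

theorem diagonal_phaseVector_div_mulVec {w : Fin n → ℂ} (hw : ∀ i, ‖w i‖ = ‖v i‖) :
    diagonal (phaseVector v fun i => w i / v i) *ᵥ v = w := by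
  ext i
  rw [mulVec_diagonal, phaseVector]
  split_ifs with hi
  · exact div_mul_cancel₀ _ hi
  · have hwi := hw i
    rw [not_not.1 hi, norm_zero, norm_eq_zero] at hwi
    rw [not_not.1 hi, hwi, mul_zero]

theorem diagonal_mem_unitaryGroup {d : Fin n → ℂ} (hd : ∀ i, ‖d i‖ = 1) :
    diagonal d ∈ unitaryGroup (Fin n) ℂ := by
  rw [mem_unitaryGroup_iff', star_eq_conjTranspose, diagonal_conjTranspose, diagonal_mul_diagonal,
    ← diagonal_one]
  congr 1
  ext i
  rw [Pi.star_apply, star_mul_self_eq_norm_sq, hd i, one_pow, Complex.ofReal_one]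

theorem conj_diagonal_conj_eq {U : Matrix (Fin n) (Fin n) ℂ} (hU : U ∈ unitaryGroup (Fin n) ℂ)
    {d : Fin n → ℂ} (hd : ∀ i, ‖d i‖ = 1) (e : Fin n → ℂ) :
    U * diagonal d * Uᴴ * (U * diagonal e * Uᴴ) * (U * diagonal d * Uᴴ)ᴴ = U * diagonal e * Uᴴ := by
  have hUU := conjTranspose_mul_self_of_mem_unitaryGroup hU
  have hdd := mul_conjTranspose_self_of_mem_unitaryGroup (diagonal_mem_unitaryGroup hd)
  calc U * diagonal d * Uᴴ * (U * diagonal e * Uᴴ) * (U * diagonal d * Uᴴ)ᴴ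
      = U * (diagonal d * ((Uᴴ * U) * diagonal e * (Uᴴ * U)) * (diagonal d)ᴴ) * Uᴴ := by
        simp only [conjTranspose_mul, conjTranspose_conjTranspose, mul_assoc]
    _ = U * (diagonal e * (diagonal d * (diagonal d)ᴴ)) * Uᴴ := by
        rw [hUU, one_mul, mul_one, (commute_diagonal d e).eq, mul_assoc (diagonal e)]
    _ = U * diagonal e * Uᴴ := by rw [hdd, mul_one]

end Phases

section InductiveStep

attribute [local instance] Matrix.normedAddCommGroup Matrix.normedSpace

variable {n : ℕ} {ι : Type} [Fintype ι] {y U : Matrix (Fin n) (Fin n) ℂ} {v : Fin n → ℂ}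

namespace FiberParametrization

/-- The conjugating matrices of `P`, preceded by rotations of the eigenvectors of `y`, which are the
columns of `U`. The rotations fix `y`, but act on a last column with coordinates `v` in that
eigenbasis. -/
noncomputable def twistedConjugator (P : FiberParametrization y ι) (U : Matrix (Fin n) (Fin n) ℂ)
    (v : Fin n → ℂ) (m : SphereTorusAmbient (ι ⊕ {i // v i ≠ 0})) : Matrix (Fin n) (Fin n) ℂ :=
  P.conjugator (m.1, m.2 ∘ Sum.inl) * (U * diagonal (phaseVector v (m.2 ∘ Sum.inr)) * Uᴴ)

/-- The coordinates of the last column `p.2` in the eigenbasis `U`, after undoing the conjugation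
that takes `y` to `p.1`. -/
def untwistedCol (P : FiberParametrization y ι) (U : Matrix (Fin n) (Fin n) ℂ)
    (p : Matrix (Fin n) (Fin n) ℂ × (Fin n → ℂ)) : Fin n → ℂ :=
  (Uᴴ * (P.conjugator (P.coord p.1))ᴴ) *ᵥ p.2

/-- The coordinates of `P`, together with the phases that rotate `v` to `untwistedCol P U`. -/
noncomputable def twistedCoord (P : FiberParametrization y ι) (U : Matrix (Fin n) (Fin n) ℂ)
    (v : Fin n → ℂ) (p : Matrix (Fin n) (Fin n) ℂ × (Fin n → ℂ)) :
    SphereTorusAmbient (ι ⊕ {i // v i ≠ 0}) :=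
  ((P.coord p.1).1, Sum.elim (P.coord p.1).2 fun i => P.untwistedCol U p i / v i)

variable (P : FiberParametrization y ι) (U v)

theorem contDiff_twistedConjugator : ContDiff ℝ ∞ (P.twistedConjugator U v) := by
  have hproj : ∀ {κ : Type} [Fintype κ] (f : κ → ι ⊕ {i // v i ≠ 0}),
      ContDiff ℝ ∞ fun m : SphereTorusAmbient (ι ⊕ {i // v i ≠ 0}) => m.2 ∘ f := fun f =>
    contDiff_pi.2 fun i => (contDiff_apply ℝ ℂ (f i)).comp contDiff_snd
  have hphase : ContDiff ℝ ∞ fun m : SphereTorusAmbient (ι ⊕ {i // v i ≠ 0}) =>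
      diagonal (phaseVector v (m.2 ∘ Sum.inr)) := by
    have hentry := contDiff_pi.1 ((contDiff_phaseVector v).comp (hproj Sum.inr))
    refine contDiff_matrix_iff.2 fun i j => ?_
    obtain rfl | hij := eq_or_ne i j
    · simp only [diagonal_apply_eq]
      exact hentry i
    · simpa only [diagonal_apply_ne _ hij] using contDiff_const
  exact contDiff_matrix_mul (P.contDiff_conjugator.comp (contDiff_fst.prodMk (hproj Sum.inl)))
    (contDiff_matrix_mul (contDiff_matrix_mul contDiff_const hphase) contDiff_const)

theorem contDiff_untwistedCol : ContDiff ℝ ∞ (P.untwistedCol U) := by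
  have hmatrix : ContDiff ℝ ∞ fun p : Matrix (Fin n) (Fin n) ℂ × (Fin n → ℂ) =>
      Uᴴ * (P.conjugator (P.coord p.1))ᴴ := contDiff_matrix_mul contDiff_const
    (contDiff_conjTranspose (P.contDiff_conjugator.comp (P.contDiff_coord.comp contDiff_fst)))
  refine contDiff_pi.2 fun i => ?_
  simp only [untwistedCol, mulVec, dotProduct]
  exact ContDiff.sum fun k _ =>
    (contDiff_matrix_iff.1 hmatrix i k).mul ((contDiff_apply ℝ ℂ k).comp contDiff_snd)

theorem contDiff_twistedCoord : ContDiff ℝ ∞ (P.twistedCoord U v) := by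
  have hcoord := P.contDiff_coord.comp
    (contDiff_fst (E := Matrix (Fin n) (Fin n) ℂ) (F := Fin n → ℂ))
  refine (contDiff_fst.comp hcoord).prodMk (contDiff_pi.2 fun i => ?_)
  rcases i with i | i
  · exact (contDiff_apply ℝ ℂ i).comp (contDiff_snd.comp hcoord)
  · exact (contDiff_pi.1 (P.contDiff_untwistedCol U) i.1).div_const _

variable {U v} {m : SphereTorusAmbient (ι ⊕ {i // v i ≠ 0})}

theorem twistedConjugator_mem (hU : U ∈ unitaryGroup (Fin n) ℂ)
    (hm : m ∈ sphereTorus (ι ⊕ {i // v i ≠ 0})) :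
    P.twistedConjugator U v m ∈ unitaryGroup (Fin n) ℂ :=
  mul_mem (P.conjugator_mem _ (restrict_mem_sphereTorus hm)) (mul_mem (mul_mem hU
    (diagonal_mem_unitaryGroup (norm_phaseVector_of_mem hm))) (conjTranspose_mem_unitaryGroup hU))

theorem twistedConjugator_conj (hU : U ∈ unitaryGroup (Fin n) ℂ) {e : Fin n → ℂ}
    (hy : y = U * diagonal e * Uᴴ) (hm : m ∈ sphereTorus (ι ⊕ {i // v i ≠ 0})) :
    P.twistedConjugator U v m * y * (P.twistedConjugator U v m)ᴴ =
      P.conjugator (m.1, m.2 ∘ Sum.inl) * y * (P.conjugator (m.1, m.2 ∘ Sum.inl))ᴴ := by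
  set D := U * diagonal (phaseVector v (m.2 ∘ Sum.inr)) * Uᴴ with hD
  have hDy : D * y * Dᴴ = y := by
    rw [hy, hD, conj_diagonal_conj_eq hU (norm_phaseVector_of_mem hm)]
  calc P.twistedConjugator U v m * y * (P.twistedConjugator U v m)ᴴ
      = P.conjugator (m.1, m.2 ∘ Sum.inl) * (D * y * Dᴴ) *
          (P.conjugator (m.1, m.2 ∘ Sum.inl))ᴴ := by
        simp only [twistedConjugator, ← hD, conjTranspose_mul, mul_assoc]
    _ = _ := by rw [hDy]

theorem twistedConjugator_mulVec (hU : U ∈ unitaryGroup (Fin n) ℂ)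
    (m : SphereTorusAmbient (ι ⊕ {i // v i ≠ 0})) :
    P.twistedConjugator U v m *ᵥ (U *ᵥ v) = P.conjugator (m.1, m.2 ∘ Sum.inl) *ᵥ
      (U *ᵥ (diagonal (phaseVector v (m.2 ∘ Sum.inr)) *ᵥ v)) := by
  rw [twistedConjugator, ← mulVec_mulVec, mulVec_mulVec _ (_ * Uᴴ) U, mul_assoc _ Uᴴ,
    conjTranspose_mul_self_of_mem_unitaryGroup hU, mul_one, mulVec_mulVec _ U]

theorem coord_twistedConjugator_conj (hU : U ∈ unitaryGroup (Fin n) ℂ) {e : Fin n → ℂ}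
    (hy : y = U * diagonal e * Uᴴ) (hm : m ∈ sphereTorus (ι ⊕ {i // v i ≠ 0})) :
    P.coord (P.twistedConjugator U v m * y * (P.twistedConjugator U v m)ᴴ) =
      (m.1, m.2 ∘ Sum.inl) := by
  rw [P.twistedConjugator_conj hU hy hm, P.coord_conj _ (restrict_mem_sphereTorus hm)]

theorem twistedCoord_conj (hU : U ∈ unitaryGroup (Fin n) ℂ) {e : Fin n → ℂ}
    (hy : y = U * diagonal e * Uᴴ) (hm : m ∈ sphereTorus (ι ⊕ {i // v i ≠ 0})) :
    P.twistedCoord U v (P.twistedConjugator U v m * y * (P.twistedConjugator U v m)ᴴ,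
      P.twistedConjugator U v m *ᵥ (U *ᵥ v)) = m := by
  have hcoord := P.coord_twistedConjugator_conj hU hy hm
  have hg := P.conjugator_mem _ (restrict_mem_sphereTorus hm)
  have hcol : P.untwistedCol U (P.twistedConjugator U v m * y * (P.twistedConjugator U v m)ᴴ,
      P.twistedConjugator U v m *ᵥ (U *ᵥ v)) = diagonal (phaseVector v (m.2 ∘ Sum.inr)) *ᵥ v := by
    simp only [untwistedCol]
    rw [hcoord, P.twistedConjugator_mulVec hU, mulVec_mulVec, mulVec_mulVec, mul_assoc Uᴴ,
      conjTranspose_mul_self_of_mem_unitaryGroup hg, mul_one,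
      conjTranspose_mul_self_of_mem_unitaryGroup hU, one_mulVec]
  refine Prod.ext ?_ (funext fun i => ?_)
  · simp only [twistedCoord, hcoord]
  · rcases i with i | i
    · simp only [twistedCoord, hcoord, Sum.elim_inl, Function.comp_apply]
    · simp only [twistedCoord, hcol, Sum.elim_inr]
      exact diagonal_phaseVector_mulVec_div _ i

variable {p : Matrix (Fin n) (Fin n) ℂ × (Fin n → ℂ)}

theorem twistedCoord_mem (hp : p.1 ∈ spectralFiber y)
    (hnorm : ∀ i, ‖P.untwistedCol U p i‖ = ‖v i‖) :
    P.twistedCoord U v p ∈ sphereTorus (ι ⊕ {i // v i ≠ 0}) := by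
  have hcoord := P.coord_mem _ hp
  refine ⟨hcoord.1, fun i => ?_⟩
  rcases i with i | i
  · exact hcoord.2 i
  · simp only [twistedCoord, Sum.elim_inr]
    rw [norm_div, hnorm, div_self (norm_ne_zero_iff.2 i.2)]

theorem conj_twistedCoord (hU : U ∈ unitaryGroup (Fin n) ℂ) {e : Fin n → ℂ}
    (hy : y = U * diagonal e * Uᴴ) (hp : p.1 ∈ spectralFiber y)
    (hnorm : ∀ i, ‖P.untwistedCol U p i‖ = ‖v i‖) :
    P.twistedConjugator U v (P.twistedCoord U v p) * y *
      (P.twistedConjugator U v (P.twistedCoord U v p))ᴴ = p.1 :=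
  (P.twistedConjugator_conj hU hy (P.twistedCoord_mem hp hnorm)).trans (P.conj_coord _ hp)

theorem twistedConjugator_twistedCoord_mulVec (hU : U ∈ unitaryGroup (Fin n) ℂ)
    (hp : p.1 ∈ spectralFiber y) (hnorm : ∀ i, ‖P.untwistedCol U p i‖ = ‖v i‖) :
    P.twistedConjugator U v (P.twistedCoord U v p) *ᵥ (U *ᵥ v) = p.2 := by
  have hg := P.conjugator_mem _ (P.coord_mem _ hp)
  calc P.twistedConjugator U v (P.twistedCoord U v p) *ᵥ (U *ᵥ v)
      = P.conjugator (P.coord p.1) *ᵥ (U *ᵥ P.untwistedCol U p) := by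
        rw [P.twistedConjugator_mulVec hU]
        exact congrArg (fun w => P.conjugator (P.coord p.1) *ᵥ (U *ᵥ w))
          (diagonal_phaseVector_div_mulVec hnorm)
    _ = p.2 := by
        rw [untwistedCol, mulVec_mulVec _ U, ← mul_assoc U,
          mul_conjTranspose_self_of_mem_unitaryGroup hU, one_mul, mulVec_mulVec,
          mul_conjTranspose_self_of_mem_unitaryGroup hg, one_mulVec]

end FiberParametrization

theorem IsRegularAt.norm_untwistedCol_eq
    {h x : Matrix (Fin (n + 1)) (Fin (n + 1)) ℂ} (hr : IsRegularAt h) (hh : h.IsHermitian)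
    (P : FiberParametrization (initBlock h) ι) (hU : U ∈ unitaryGroup (Fin n) ℂ) {μ : Fin n → ℝ}
    (hdiag : initBlock h = U * (diagonal fun i => (μ i : ℂ)) * Uᴴ) (hx : x ∈ spectralFiber h)
    (i : Fin n) :
    ‖P.untwistedCol U (initBlock x, lastCol x) i‖ = ‖(Uᴴ *ᵥ lastCol h) i‖ := by
  obtain ⟨hxh, hx_block⟩ := mem_spectralFiber_succ.1 hx
  have hg := P.conjugator_mem _ (P.coord_mem _ hx_block)
  set g := P.conjugator (P.coord (initBlock x)) with hg_def
  have hg' := conjTranspose_mem_unitaryGroup hg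
  have hblock : initBlock (extendOne gᴴ * x * (extendOne gᴴ)ᴴ) = initBlock h := by
    rw [initBlock_extendOne_conj, conjTranspose_conjTranspose, ← P.conj_coord _ hx_block, ← hg_def,
      conjTranspose_mul_conj_mul hg]
  have hnorm := hr.norm_lastCol_eq hh ((unitarilySimilar_extendOne_conj hg' x).trans hxh) hblock hU
    hdiag i
  rwa [lastCol_extendOne_conj, mulVec_mulVec] at hnorm

theorem IsRegularAt.exists_fiberParametrization {h : Matrix (Fin (n + 1)) (Fin (n + 1)) ℂ}
    (hr : IsRegularAt h) (hh : h.IsHermitian) (P : FiberParametrization (initBlock h) ι) :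
    ∃ (κ : Type) (_ : Fintype κ), Nonempty (FiberParametrization h κ) := by
  obtain ⟨U, hU, hdiag⟩ := unitarilySimilar_diagonal_eigenvalues (initBlock_isHermitian hh)
  set v := Uᴴ *ᵥ lastCol h with hv
  have hcol : lastCol h = U *ᵥ v := by
    rw [hv, mulVec_mulVec, mul_conjTranspose_self_of_mem_unitaryGroup hU, one_mulVec]
  have hblock : ∀ x ∈ spectralFiber h, initBlock x ∈ spectralFiber (initBlock h) := fun x hx =>
    (mem_spectralFiber_succ.1 hx).2
  have hnorm : ∀ x ∈ spectralFiber h, ∀ i,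
      ‖P.untwistedCol U (initBlock x, lastCol x) i‖ = ‖v i‖ := fun x hx =>
    hr.norm_untwistedCol_eq hh P hU hdiag hx
  refine ⟨ι ⊕ {i // v i ≠ 0}, inferInstance, ⟨.ofInitBlock hh (P.twistedConjugator U v)
    (P.twistedCoord U v) (P.contDiff_twistedConjugator U v) (P.contDiff_twistedCoord U v)
    (fun m hm => P.twistedConjugator_mem hU hm) (fun m hm => ?_)
    (fun x hx => P.twistedCoord_mem (hblock x hx) (hnorm x hx)) (fun m hm => ?_)
    (fun x hx => P.conj_twistedCoord hU hdiag (hblock x hx) (hnorm x hx)) (fun x hx => ?_)⟩⟩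
  · rw [P.twistedConjugator_conj hU hdiag hm]
    exact P.conj_mem _ (restrict_mem_sphereTorus hm)
  · rw [hcol]
    exact P.twistedCoord_conj hU hdiag hm
  · rw [hcol]
    exact P.twistedConjugator_twistedCoord_mulVec hU (hblock x hx) (hnorm x hx)

theorem IsBasePoint.exists_fiberParametrization :
    ∀ {k : ℕ} {h : Matrix (Fin (k + 3)) (Fin (k + 3)) ℂ}, IsBasePoint k h → h.IsHermitian →
      ∃ (ι : Type) (_ : Fintype ι), Nonempty (FiberParametrization h ι)
  | 0, _, hbase, hh => ⟨Empty, inferInstance, nonempty_fiberParametrization_three hh hbase⟩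
  | _ + 1, _, ⟨hbase, hr⟩, hh => by
    obtain ⟨ι, _, ⟨P⟩⟩ := hbase.exists_fiberParametrization (initBlock_isHermitian hh)
    exact hr.exists_fiberParametrization hh P

end InductiveStep

/-! ### The fiber as a submanifold -/

section Submanifold

variable {E F G : Type*} [NormedAddCommGroup E] [NormedSpace ℝ E] [NormedAddCommGroup F]
  [NormedSpace ℝ F] [NormedAddCommGroup G] [NormedSpace ℝ G]
  {X : Set E} {Y : Set F} {Z : Set G} {f : E → F} {g : F → G}

theorem smoothMapOn_of_contDiffOn (hX : IsOpen X) (hf : ContDiffOn ℝ ∞ f X) : SmoothMapOn f X :=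
  fun _ hx => ⟨X, hX, hx, f, hf, fun _ _ => rfl⟩

theorem smoothMapOn_comp (hg : SmoothMapOn g Y) (hf : SmoothMapOn f X) (hfXY : Set.MapsTo f X Y) :
    SmoothMapOn (g ∘ f) X := by
  intro x hx
  obtain ⟨U, hU, hxU, f', hf', hff'⟩ := hf x hx
  obtain ⟨V, hV, hxV, g', hg', hgg'⟩ := hg (f x) (hfXY hx)
  refine ⟨U ∩ f' ⁻¹' V, hf'.continuousOn.isOpen_inter_preimage hU hV, ⟨hxU, ?_⟩, g' ∘ f',
    hg'.comp (hf'.mono Set.inter_subset_left) fun _ hy => hy.2, fun y hy => ?_⟩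
  · rwa [Set.mem_preimage, ← hff' ⟨hx, hxU⟩]
  · have hfy : f y = f' y := hff' ⟨hy.1, hy.2.1⟩
    have hfyV : f y ∈ V := hfy ▸ hy.2.2
    rw [Function.comp_apply, Function.comp_apply, ← hfy]
    exact hgg' ⟨hfXY hy.1, hfyV⟩

theorem diffeomorphic_trans (hXY : Diffeomorphic X Y) (hYZ : Diffeomorphic Y Z) :
    Diffeomorphic X Z := by
  obtain ⟨f, f', hf, hf', hfX, hfY, hleft, hright⟩ := hXY
  obtain ⟨g, g', hg, hg', hgY, hgZ, hleft', hright'⟩ := hYZ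
  exact ⟨g ∘ f, f' ∘ g', smoothMapOn_comp hg hf hfX, smoothMapOn_comp hf' hg' hgZ, hgY.comp hfX,
    hfY.comp hgZ, hleft.comp hleft' hfX, hright.comp hright' hgZ⟩

theorem diffeomorphic_inter_preimage {g : F → E} (hf : ContDiff ℝ ∞ f) (hg : ContDiff ℝ ∞ g)
    (hfXY : Set.MapsTo f X Y) (hgYX : Set.MapsTo g Y X) (hleft : Set.LeftInvOn g f X)
    (hright : Set.RightInvOn g f Y) (V : Set F) : Diffeomorphic (X ∩ f ⁻¹' V) (Y ∩ V) := by
  refine ⟨f, g, smoothMapOn_of_contDiff hf _, smoothMapOn_of_contDiff hg _,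
    fun x hx => ⟨hfXY hx.1, hx.2⟩, fun y hy => ⟨hgYX hy.1, ?_⟩, fun x hx => hleft hx.1,
    fun y hy => hright hy.1⟩
  rw [Set.mem_preimage, hright hy.1]
  exact hy.2

theorem isSubmanifold_of_leftInvOn {g : F → E} {d : ℕ} (hY : IsSubmanifold Y d)
    (hf : ContDiff ℝ ∞ f) (hg : ContDiff ℝ ∞ g) (hfXY : Set.MapsTo f X Y)
    (hgYX : Set.MapsTo g Y X) (hleft : Set.LeftInvOn g f X) (hright : Set.RightInvOn g f Y) :
    IsSubmanifold X d := by
  intro x hx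
  obtain ⟨V, hV, hxV, W, hW, hVW⟩ := hY (f x) (hfXY hx)
  exact ⟨f ⁻¹' V, hV.preimage hf.continuous, hxV, W, hW, diffeomorphic_trans
    (diffeomorphic_inter_preimage hf hg hfXY hgYX hleft hright V) hVW⟩

theorem isSubmanifold_of_finrank_eq [FiniteDimensional ℝ F] {d : ℕ}
    (hd : Module.finrank ℝ F = d) (hX : ∀ x ∈ X, ∃ V : Set E, IsOpen V ∧ x ∈ V ∧
      ∃ W : Set F, IsOpen W ∧ Diffeomorphic (X ∩ V) W) : IsSubmanifold X d := by
  intro x hx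
  obtain ⟨V, hV, hxV, W, hW, hVW⟩ := hX x hx
  let e : EuclideanSpace ℝ (Fin d) ≃L[ℝ] F := .ofFinrankEq (by rw [finrank_euclideanSpace_fin, hd])
  refine ⟨V, hV, hxV, e ⁻¹' W, hW.preimage e.continuous, diffeomorphic_trans hVW
    ⟨e.symm, e, smoothMapOn_of_contDiff e.symm.contDiff _, smoothMapOn_of_contDiff e.contDiff _,
      fun w hw => ?_, fun _ hw => hw, fun w _ => e.apply_symm_apply w,
      fun w _ => e.symm_apply_apply w⟩⟩
  rwa [Set.mem_preimage, e.apply_symm_apply]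

end Submanifold

section Charts

/-- The product of the quaternions `q.1 + j q.2` and `p.1 + j p.2`, as a pair. -/
def quatMul (q p : ℂ × ℂ) : ℂ × ℂ := (q.1 * p.1 - star q.2 * p.2, q.2 * p.1 + star q.1 * p.2)

/-- The conjugate of the quaternion `q.1 + j q.2`, as a pair. -/
def quatConj (q : ℂ × ℂ) : ℂ × ℂ := (star q.1, -q.2)

variable {q : ℂ × ℂ}

theorem quatConj_quatConj (q : ℂ × ℂ) : quatConj (quatConj q) = q := by
  simp [quatConj]

theorem norm_quatConj (q : ℂ × ℂ) :
    ‖(quatConj q).1‖ ^ 2 + ‖(quatConj q).2‖ ^ 2 = ‖q.1‖ ^ 2 + ‖q.2‖ ^ 2 := by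
  simp [quatConj]

theorem complex_norm_sq (z : ℂ) : ‖z‖ ^ 2 = z.re ^ 2 + z.im ^ 2 := by
  rw [Complex.sq_norm, Complex.normSq_apply, sq, sq]

theorem norm_quatMul (hq : ‖q.1‖ ^ 2 + ‖q.2‖ ^ 2 = 1) (p : ℂ × ℂ) :
    ‖(quatMul q p).1‖ ^ 2 + ‖(quatMul q p).2‖ ^ 2 = ‖p.1‖ ^ 2 + ‖p.2‖ ^ 2 := by
  simp only [complex_norm_sq] at hq ⊢
  simp only [quatMul, Complex.star_def, Complex.add_re, Complex.add_im, Complex.sub_re,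
    Complex.sub_im, Complex.mul_re, Complex.mul_im, Complex.conj_re, Complex.conj_im]
  linear_combination (p.1.re ^ 2 + p.1.im ^ 2 + (p.2.re ^ 2 + p.2.im ^ 2)) * hq

theorem quatMul_quatConj_quatMul (hq : ‖q.1‖ ^ 2 + ‖q.2‖ ^ 2 = 1) (p : ℂ × ℂ) :
    quatMul (quatConj q) (quatMul q p) = p := by
  have hsum := star_mul_add_star_mul_eq_one hq
  refine Prod.ext ?_ ?_ <;> simp only [quatMul, quatConj, star_neg, star_star]
  · linear_combination p.1 * hsum
  · linear_combination p.2 * hsum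

theorem quatMul_quatConj_self (hq : ‖q.1‖ ^ 2 + ‖q.2‖ ^ 2 = 1) :
    quatMul (quatConj q) q = (1, 0) := by
  have hsum := star_mul_add_star_mul_eq_one hq
  refine Prod.ext ?_ ?_ <;> simp only [quatMul, quatConj, star_neg, star_star]
  · linear_combination hsum
  · ring

theorem contDiff_quatMul (q : ℂ × ℂ) : ContDiff ℝ ∞ (quatMul q) :=
  ((contDiff_const.mul contDiff_fst).sub (contDiff_const.mul contDiff_snd)).prodMk
    ((contDiff_const.mul contDiff_fst).add (contDiff_const.mul contDiff_snd))

variable {ι : Type} {m x : SphereTorusAmbient ι}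

/-- Left translation by `m` in the group `sphereTorus ι`, with `S³` the unit quaternions. -/
def sphereTorusMul (m x : SphereTorusAmbient ι) : SphereTorusAmbient ι :=
  (quatMul m.1 x.1, m.2 * x.2)

/-- The inverse of `m` in the group `sphereTorus ι`. -/
def sphereTorusInv (m : SphereTorusAmbient ι) : SphereTorusAmbient ι := (quatConj m.1, star m.2)

theorem sphereTorusMul_mem (hm : m ∈ sphereTorus ι) (hx : x ∈ sphereTorus ι) :
    sphereTorusMul m x ∈ sphereTorus ι :=
  ⟨(norm_quatMul hm.1 x.1).trans hx.1, fun i => by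
    simp only [sphereTorusMul, Pi.mul_apply, norm_mul, hm.2, hx.2, one_mul]⟩

theorem sphereTorusInv_mem (hm : m ∈ sphereTorus ι) : sphereTorusInv m ∈ sphereTorus ι :=
  ⟨(norm_quatConj m.1).trans hm.1, fun i => (norm_star (m.2 i)).trans (hm.2 i)⟩

theorem sphereTorusInv_inv (m : SphereTorusAmbient ι) : sphereTorusInv (sphereTorusInv m) = m :=
  Prod.ext (quatConj_quatConj m.1) (star_star m.2)

theorem star_mul_self_eq_one (hm : m ∈ sphereTorus ι) : star m.2 * m.2 = 1 :=
  funext fun i => by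
    rw [Pi.mul_apply, Pi.star_apply, star_mul_self_eq_norm_sq, hm.2 i]
    simp

theorem sphereTorusMul_inv_mul (hm : m ∈ sphereTorus ι) (x : SphereTorusAmbient ι) :
    sphereTorusMul (sphereTorusInv m) (sphereTorusMul m x) = x :=
  Prod.ext (quatMul_quatConj_quatMul hm.1 x.1) (by
    rw [sphereTorusMul, sphereTorusMul, sphereTorusInv, ← mul_assoc, star_mul_self_eq_one hm,
      one_mul])

theorem sphereTorusMul_inv_self (hm : m ∈ sphereTorus ι) :
    sphereTorusMul (sphereTorusInv m) m = ((1, 0), 1) :=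
  Prod.ext (quatMul_quatConj_self hm.1) (star_mul_self_eq_one hm)

theorem contDiff_sphereTorusMul [Fintype ι] (m : SphereTorusAmbient ι) :
    ContDiff ℝ ∞ (sphereTorusMul m) :=
  ((contDiff_quatMul m.1).comp contDiff_fst).prodMk (contDiff_const.mul contDiff_snd)

/-- Coordinates on the half of `sphereTorus ι` around its unit `((1, 0), 1)` where the real parts
of `x.1.1` and of all `x.2 i` are positive. -/
def sphereTorusChart (x : SphereTorusAmbient ι) : (ℝ × ℂ) × (ι → ℝ) :=
  ((x.1.1.im, x.1.2), fun i => (x.2 i).im)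

/-- The inverse of `sphereTorusChart`: the positive real parts are recovered from the norms. -/
noncomputable def sphereTorusChartInv (w : (ℝ × ℂ) × (ι → ℝ)) : SphereTorusAmbient ι :=
  ((⟨√(1 - (w.1.1 ^ 2 + ‖w.1.2‖ ^ 2)), w.1.1⟩, w.1.2), fun i => ⟨√(1 - w.2 i ^ 2), w.2 i⟩)

/-- The domain of `sphereTorusChart`. -/
def sphereTorusChartDomain (ι : Type) : Set (SphereTorusAmbient ι) :=
  {x | 0 < x.1.1.re ∧ ∀ i, 0 < (x.2 i).re}

/-- The range of `sphereTorusChart`. -/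
def sphereTorusChartRange (ι : Type) : Set ((ℝ × ℂ) × (ι → ℝ)) :=
  {w | w.1.1 ^ 2 + ‖w.1.2‖ ^ 2 < 1 ∧ ∀ i, w.2 i ^ 2 < 1}

theorem isOpen_sphereTorusChartDomain [Finite ι] : IsOpen (sphereTorusChartDomain ι) := by
  simp only [sphereTorusChartDomain, Set.ofPred_and, Set.ofPred_forall]
  exact (isOpen_lt (by fun_prop) (by fun_prop)).inter
    (isOpen_iInter_of_finite fun i => isOpen_lt (by fun_prop) (by fun_prop))

theorem isOpen_sphereTorusChartRange [Finite ι] : IsOpen (sphereTorusChartRange ι) := by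
  simp only [sphereTorusChartRange, Set.ofPred_and, Set.ofPred_forall]
  exact (isOpen_lt (by fun_prop) (by fun_prop)).inter
    (isOpen_iInter_of_finite fun i => isOpen_lt (by fun_prop) (by fun_prop))

theorem contDiff_sphereTorusChart [Fintype ι] :
    ContDiff ℝ ∞ (sphereTorusChart : SphereTorusAmbient ι → (ℝ × ℂ) × (ι → ℝ)) := by
  have him : ContDiff ℝ ∞ Complex.im := Complex.imCLM.contDiff
  exact ((him.comp (contDiff_fst.comp contDiff_fst)).prodMk (contDiff_snd.comp contDiff_fst)).prodMk
    (contDiff_pi.2 fun i => him.comp ((contDiff_apply ℝ ℂ i).comp contDiff_snd))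

theorem contDiffOn_complex_mk {E : Type*} [NormedAddCommGroup E] [NormedSpace ℝ E] {X : Set E}
    {a b : E → ℝ} (ha : ContDiffOn ℝ ∞ a X) (hb : ContDiffOn ℝ ∞ b X) :
    ContDiffOn ℝ ∞ (fun x => (⟨a x, b x⟩ : ℂ)) X :=
  Complex.equivRealProdCLM.symm.contDiff.comp_contDiffOn (ha.prodMk hb)

theorem contDiffOn_sphereTorusChartInv [Fintype ι] :
    ContDiffOn ℝ ∞ (sphereTorusChartInv : _ → SphereTorusAmbient ι) (sphereTorusChartRange ι) := by
  have hfst : ContDiff ℝ ∞ fun w : (ℝ × ℂ) × (ι → ℝ) => w.1.1 := contDiff_fst.comp contDiff_fst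
  have hsnd : ContDiff ℝ ∞ fun w : (ℝ × ℂ) × (ι → ℝ) => w.1.2 := contDiff_snd.comp contDiff_fst
  have hcoord : ∀ i, ContDiff ℝ ∞ fun w : (ℝ × ℂ) × (ι → ℝ) => w.2 i := fun i =>
    (contDiff_apply ℝ ℝ i).comp contDiff_snd
  refine ((contDiffOn_complex_mk (ContDiffOn.sqrt ?_ fun w hw => ?_) hfst.contDiffOn).prodMk
    hsnd.contDiffOn).prodMk (contDiffOn_pi.2 fun i =>
      contDiffOn_complex_mk (ContDiffOn.sqrt ?_ fun w hw => ?_) (hcoord i).contDiffOn)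
  · exact (contDiff_const.sub ((hfst.pow 2).add (hsnd.norm_sq ℝ))).contDiffOn
  · exact (sub_pos.2 hw.1).ne'
  · exact (contDiff_const.sub ((hcoord i).pow 2)).contDiffOn
  · exact (sub_pos.2 (hw.2 i)).ne'

theorem sphereTorusChart_mem (hx : x ∈ sphereTorus ι) (hxd : x ∈ sphereTorusChartDomain ι) :
    sphereTorusChart x ∈ sphereTorusChartRange ι := by
  refine ⟨?_, fun i => ?_⟩ <;> simp only [sphereTorusChart]
  · have hnorm := hx.1
    rw [complex_norm_sq x.1.1] at hnorm
    linarith [pow_pos hxd.1 2]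
  · have hnorm := complex_norm_sq (x.2 i)
    rw [hx.2 i] at hnorm
    linarith [pow_pos (hxd.2 i) 2]

theorem sphereTorusChartInv_mem {w : (ℝ × ℂ) × (ι → ℝ)} (hw : w ∈ sphereTorusChartRange ι) :
    sphereTorusChartInv w ∈ sphereTorus ι ∩ sphereTorusChartDomain ι := by
  refine ⟨⟨?_, fun i => ?_⟩, Real.sqrt_pos.2 (sub_pos.2 hw.1),
    fun i => Real.sqrt_pos.2 (sub_pos.2 (hw.2 i))⟩ <;> simp only [sphereTorusChartInv]
  · rw [complex_norm_sq ⟨_, _⟩, Real.sq_sqrt (sub_pos.2 hw.1).le]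
    ring
  · rw [← sq_eq_sq₀ (norm_nonneg _) zero_le_one, complex_norm_sq,
      Real.sq_sqrt (sub_pos.2 (hw.2 i)).le]
    ring

theorem sphereTorusChartInv_chart (hx : x ∈ sphereTorus ι) (hxd : x ∈ sphereTorusChartDomain ι) :
    sphereTorusChartInv (sphereTorusChart x) = x := by
  refine Prod.ext (Prod.ext (Complex.ext ?_ rfl) rfl) (funext fun i => Complex.ext ?_ rfl) <;>
    simp only [sphereTorusChartInv, sphereTorusChart]
  · have hnorm := hx.1
    rw [complex_norm_sq x.1.1] at hnorm
    rw [← Real.sqrt_sq hxd.1.le]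
    congr 1
    linarith
  · have hnorm := complex_norm_sq (x.2 i)
    rw [hx.2 i] at hnorm
    rw [← Real.sqrt_sq (hxd.2 i).le]
    congr 1
    linarith

theorem diffeomorphic_sphereTorusChartRange [Fintype ι] :
    Diffeomorphic (sphereTorus ι ∩ sphereTorusChartDomain ι) (sphereTorusChartRange ι) :=
  ⟨sphereTorusChart, sphereTorusChartInv, smoothMapOn_of_contDiff contDiff_sphereTorusChart _,
    smoothMapOn_of_contDiffOn isOpen_sphereTorusChartRange contDiffOn_sphereTorusChartInv,
    fun _ hx => sphereTorusChart_mem hx.1 hx.2, fun _ hw => sphereTorusChartInv_mem hw,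
    fun _ hx => sphereTorusChartInv_chart hx.1 hx.2, fun _ _ => rfl⟩

theorem isSubmanifold_sphereTorus [Fintype ι] :
    IsSubmanifold (sphereTorus ι) (3 + Fintype.card ι) := by
  refine isSubmanifold_of_finrank_eq (F := (ℝ × ℂ) × (ι → ℝ)) ?_ fun m hm => ?_
  · rw [Module.finrank_prod, Module.finrank_prod, Module.finrank_self,
      Complex.finrank_real_complex, Module.finrank_fintype_fun_eq_card]
  have hinv := sphereTorusInv_mem hm
  have hright := sphereTorusMul_inv_mul hinv
  rw [sphereTorusInv_inv] at hright
  refine ⟨sphereTorusMul (sphereTorusInv m) ⁻¹' sphereTorusChartDomain ι,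
    isOpen_sphereTorusChartDomain.preimage (contDiff_sphereTorusMul _).continuous, ?_,
    sphereTorusChartRange ι, isOpen_sphereTorusChartRange, diffeomorphic_trans
      (diffeomorphic_inter_preimage (contDiff_sphereTorusMul _) (contDiff_sphereTorusMul m)
        (fun x hx => sphereTorusMul_mem hinv hx) (fun x hx => sphereTorusMul_mem hm hx)
        (fun x _ => hright x) (fun x _ => sphereTorusMul_inv_mul hm x) _)
      diffeomorphic_sphereTorusChartRange⟩
  rw [Set.mem_preimage, sphereTorusMul_inv_self hm]
  exact ⟨zero_lt_one, fun _ => zero_lt_one⟩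

end Charts

namespace FiberParametrization

attribute [local instance] Matrix.normedAddCommGroup Matrix.normedSpace

variable {n : ℕ} {h : Matrix (Fin n) (Fin n) ℂ} {ι : Type} [Fintype ι]

theorem contDiff_conj (P : FiberParametrization h ι) :
    ContDiff ℝ ∞ fun m => P.conjugator m * h * (P.conjugator m)ᴴ :=
  contDiff_matrix_mul (contDiff_matrix_mul P.contDiff_conjugator contDiff_const)
    (contDiff_conjTranspose P.contDiff_conjugator)

theorem isSubmanifold (P : FiberParametrization h ι) :
    IsSubmanifold (spectralFiber h) (3 + Fintype.card ι) :=
  isSubmanifold_of_leftInvOn isSubmanifold_sphereTorus P.contDiff_coord P.contDiff_conj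
    P.coord_mem P.conj_mem P.conj_coord P.coord_conj

/-- The parametrization as a homeomorphism onto the fiber. -/
def homeomorph (P : FiberParametrization h ι) : sphereTorus ι ≃ₜ spectralFiber h where
  toFun m := ⟨P.conjugator m * h * (P.conjugator m)ᴴ, P.conj_mem m m.2⟩
  invFun x := ⟨P.coord x, P.coord_mem x x.2⟩
  left_inv m := Subtype.ext (P.coord_conj m m.2)
  right_inv x := Subtype.ext (P.conj_coord x x.2)
  continuous_toFun := (P.contDiff_conj.continuous.comp continuous_subtype_val).subtype_mk _
  continuous_invFun := (P.contDiff_coord.continuous.comp continuous_subtype_val).subtype_mk _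

end FiberParametrization

/-! ### Homeomorphisms with tori -/

section CircleLogarithms

open unitInterval

variable {A : Type*} [TopologicalSpace A]

theorem exists_circle_log_of_homotopy (H : I × A → Circle) (hH : Continuous H) (c : Circle)
    (hzero : ∀ a, H (0, a) = c) :
    ∃ φ : A → ℝ, Continuous φ ∧ ∀ a, Circle.exp (φ a) = H (1, a) := by
  obtain ⟨t, rfl⟩ := Circle.exp_surjective c
  refine ⟨fun a => Circle.isCoveringMap_exp.liftHomotopy ⟨H, hH⟩ (.const A t) hzero (1, a),
    by fun_prop, fun a => ?_⟩
  exact congr_fun (Circle.isCoveringMap_exp.liftHomotopy_lifts ⟨H, hH⟩ (.const A t) hzero) (1, a)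

theorem exists_circle_log_of_continuous {E : Type*} [NormedAddCommGroup E] [NormedSpace ℝ E]
    {f : E → Circle} (hf : Continuous f) :
    ∃ φ : E → ℝ, Continuous φ ∧ ∀ x, Circle.exp (φ x) = f x := by
  obtain ⟨φ, hφ, hφf⟩ := exists_circle_log_of_homotopy (fun p : I × E => f ((p.1 : ℝ) • p.2))
    (by fun_prop) (f 0) (by simp)
  exact ⟨φ, hφ, by simpa using hφf⟩

theorem circle_log_unique [PreconnectedSpace A] {φ ψ : A → ℝ} (hφ : Continuous φ)
    (hψ : Continuous ψ) (hexp : ∀ a, Circle.exp (φ a) = Circle.exp (ψ a)) :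
    ∃ m : ℤ, ∀ a, φ a = ψ a + m * (2 * Real.pi) := by
  rcases isEmpty_or_nonempty A with hA | ⟨⟨a⟩⟩
  · exact ⟨0, fun a => hA.elim a⟩
  obtain ⟨m, hm⟩ := Circle.exp_eq_exp.1 (hexp a)
  refine ⟨m, congr_fun (Circle.isCoveringMap_exp.eq_of_comp_eq hφ
    (g₂ := fun b => ψ b + m * (2 * Real.pi)) (by fun_prop) (funext fun b => ?_) a hm)⟩
  simp only [Function.comp_apply, hexp b]
  exact Circle.exp_eq_exp.2 ⟨-m, by push_cast; ring⟩

theorem exists_circle_log_of_isOpen_union {U V : Set A} (hU : IsOpen U) (hV : IsOpen V)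
    (hcover : U ∪ V = Set.univ) (hconn : IsPreconnected (U ∩ V)) {f : A → Circle} {φ ψ : A → ℝ}
    (hφ : ContinuousOn φ U) (hφf : ∀ a ∈ U, Circle.exp (φ a) = f a) (hψ : ContinuousOn ψ V)
    (hψf : ∀ a ∈ V, Circle.exp (ψ a) = f a) :
    ∃ χ : A → ℝ, Continuous χ ∧ ∀ a, Circle.exp (χ a) = f a := by
  classical
  have : PreconnectedSpace ↥(U ∩ V) := isPreconnected_iff_preconnectedSpace.1 hconn
  obtain ⟨m, hm⟩ := circle_log_unique (A := ↥(U ∩ V))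
    (hφ.mono Set.inter_subset_left).domRestrict (hψ.mono Set.inter_subset_right).domRestrict
    fun a => (hφf a a.2.1).trans (hψf a a.2.2).symm
  have hφχ : Set.EqOn (U.piecewise φ fun a => ψ a + m * (2 * Real.pi)) φ U :=
    U.piecewise_eqOn _ _
  have hψχ : Set.EqOn (U.piecewise φ fun a => ψ a + m * (2 * Real.pi))
      (fun a => ψ a + m * (2 * Real.pi)) V := fun a haV => by
    by_cases haU : a ∈ U
    · exact (hφχ haU).trans (hm ⟨a, haU, haV⟩)
    · exact Set.piecewise_eq_of_notMem U _ _ haU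
  refine ⟨U.piecewise φ fun a => ψ a + m * (2 * Real.pi), ?_, fun a => ?_⟩
  · rw [← continuousOn_univ, ← hcover]
    exact (hφ.congr hφχ).union_of_isOpen ((hψ.add continuousOn_const).congr hψχ) hU hV
  · rcases hcover.ge (Set.mem_univ a) with haU | haV
    · rw [hφχ haU, hφf a haU]
    · rw [hψχ haV, Circle.exp_add, Circle.exp_int_mul_two_pi, mul_one, hψf a haV]

theorem not_exists_continuous_circle_sqrt :
    ¬ ∃ k : Circle → Circle, Continuous k ∧ ∀ w, k w ^ 2 = w := by
  rintro ⟨k, hk, hsq⟩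
  obtain ⟨ψ, hψ, hψk⟩ := exists_circle_log_of_continuous (f := fun t : ℝ => k (Circle.exp t))
    (by fun_prop)
  obtain ⟨m, hm⟩ := circle_log_unique (φ := fun t => ψ t + ψ t) (ψ := fun t : ℝ => t)
    (by fun_prop) (by fun_prop) fun t => by rw [Circle.exp_add, hψk, ← sq, hsq]
  have hshift : ψ (2 * Real.pi) = Real.pi + ψ 0 := by
    linarith [hm 0, hm (2 * Real.pi)]
  have hperiod : Circle.exp (ψ (2 * Real.pi)) = Circle.exp (ψ 0) := by
    rw [hψk, hψk, Circle.exp_two_pi, Circle.exp_zero]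
  rw [hshift, Circle.exp_add] at hperiod
  exact Circle.exp_pi_ne_one (mul_eq_right.1 hperiod)

end CircleLogarithms

section SphereLogarithms

open Metric Module

variable {E : Type*} [NormedAddCommGroup E] [InnerProductSpace ℝ E]

theorem isPreconnected_sphere_compl_inter_compl_neg (hE : 2 < finrank ℝ E)
    (v : sphere (0 : E) 1) : IsPreconnected ({v}ᶜ ∩ {-v}ᶜ : Set (sphere (0 : E) 1)) := by
  have : FiniteDimensional ℝ E := .of_finrank_pos (by omega)
  have hv : ‖(v : E)‖ = 1 := mem_sphere_zero_iff_norm.1 v.2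
  have hdim : 1 < finrank ℝ (ℝ ∙ (v : E))ᗮ := by
    have hadd := (ℝ ∙ (v : E)).finrank_add_finrank_orthogonal
    rw [finrank_span_singleton (norm_ne_zero_iff.1 (hv.trans_ne one_ne_zero))] at hadd
    omega
  have hzero : ∀ x ≠ v, stereographic hv x = 0 ↔ x = -v := fun x hx => by
    rw [← stereographic_apply_neg v]
    exact (stereographic hv).injOn.eq_iff hx (ne_neg_of_mem_unit_sphere ℝ v).symm
  have himage : (stereographic hv).symm '' {0}ᶜ = {v}ᶜ ∩ {-v}ᶜ := by
    rw [(stereographic hv).symm_image_eq_source_inter_preimage]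
    · exact Set.ext fun x => and_congr_right fun hx => not_congr (hzero x hx)
    · rw [stereographic_target]
      exact Set.subset_univ _
  rw [← himage]
  refine (isConnected_compl_singleton_of_one_lt_rank (by exact_mod_cast lt_rank_of_lt_finrank hdim)
    0).isPreconnected.image _ ((stereographic hv).continuousOn_symm.mono ?_)
  rw [stereographic_target]
  exact Set.subset_univ _

variable {B : Type*} [NormedAddCommGroup B] [NormedSpace ℝ B]

theorem exists_circle_log_on_sphere_compl {f : sphere (0 : E) 1 × B → Circle} (hf : Continuous f)
    (v : sphere (0 : E) 1) : ∃ φ : sphere (0 : E) 1 × B → ℝ,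
      ContinuousOn φ ({v}ᶜ ×ˢ Set.univ) ∧
        ∀ x ∈ ({v}ᶜ ×ˢ Set.univ : Set (sphere (0 : E) 1 × B)), Circle.exp (φ x) = f x := by
  have hv : ‖(v : E)‖ = 1 := mem_sphere_zero_iff_norm.1 v.2
  have hsymm : Continuous (stereographic hv).symm := by
    rw [← continuousOn_univ, ← stereographic_target hv]
    exact (stereographic hv).continuousOn_symm
  obtain ⟨φ, hφ, hφf⟩ := exists_circle_log_of_continuous
    (f := fun y : (ℝ ∙ (v : E))ᗮ × B => f ((stereographic hv).symm y.1, y.2)) (by fun_prop)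
  refine ⟨fun x => φ (stereographic hv x.1, x.2), hφ.comp_continuousOn
    (((stereographic hv).continuousOn.comp continuousOn_fst fun x hx => hx.1).prodMk
      continuousOn_snd), fun x hx => ?_⟩
  rw [hφf, (stereographic hv).left_inv hx.1]

theorem exists_circle_log_sphere_prod (hE : 2 < finrank ℝ E) {f : sphere (0 : E) 1 × B → Circle}
    (hf : Continuous f) :
    ∃ φ : sphere (0 : E) 1 × B → ℝ, Continuous φ ∧ ∀ x, Circle.exp (φ x) = f x := by
  have : Nontrivial E := nontrivial_of_finrank_pos (by omega : 0 < finrank ℝ E)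
  obtain ⟨v⟩ : Nonempty (sphere (0 : E) 1) := (NormedSpace.sphere_nonempty.2 zero_le_one).to_subtype
  obtain ⟨φ, hφ, hφf⟩ := exists_circle_log_on_sphere_compl hf v
  obtain ⟨ψ, hψ, hψf⟩ := exists_circle_log_on_sphere_compl hf (-v)
  refine exists_circle_log_of_isOpen_union (isOpen_compl_singleton.prod isOpen_univ)
    (isOpen_compl_singleton.prod isOpen_univ) ?_ ?_ hφ hφf hψ hψf
  · rw [← Set.union_prod, ← Set.compl_inter, Set.singleton_inter_eq_empty.2, Set.compl_empty,
      Set.univ_prod_univ]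
    exact fun hvv => ne_neg_of_mem_unit_sphere ℝ v hvv
  · rw [Set.prod_inter_prod, Set.univ_inter]
    exact (isPreconnected_sphere_compl_inter_compl_neg hE v).prod isPreconnected_univ

end SphereLogarithms

section TorusCover

variable {X ι : Type*}

/-- The product of the identity of `X` with the universal covering of the torus `ι → Circle`. -/
noncomputable def torusCover (x : X × (ι → ℝ)) : X × (ι → Circle) :=
  (x.1, fun i => Circle.exp (x.2 i))

theorem torusCover_add_single [DecidableEq ι] (x : X × (ι → ℝ)) (i : ι) :
    torusCover (x.1, x.2 + Pi.single i (2 * Real.pi)) = torusCover x := by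
  refine Prod.ext rfl (funext fun k => ?_)
  rcases eq_or_ne k i with rfl | hk
  · simp [torusCover]
  · simp [torusCover, hk]

theorem eq_of_torusCover_eq [Finite ι] [DecidableEq ι] {C : Type*} {G : X × (ι → ℝ) → C}
    (hG : ∀ i x, G (x.1, x.2 + Pi.single i (2 * Real.pi)) = G x) {x y : X × (ι → ℝ)}
    (hxy : torusCover x = torusCover y) : G x = G y := by
  have := Fintype.ofFinite ι
  let periods : AddSubgroup (ι → ℝ) :=
    { carrier := {w | ∀ x, G (x.1, x.2 + w) = G x}
      zero_mem' := fun x => by rw [add_zero]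
      add_mem' := fun {v w} hv hw x => by
        rw [← add_assoc, ← hv x]
        exact hw (x.1, x.2 + v)
      neg_mem' := fun {w} hw x => by
        rw [← hw (x.1, x.2 + -w), neg_add_cancel_right] }
  obtain ⟨hfst, hsnd⟩ := Prod.ext_iff.1 hxy
  choose m hm using fun i => Circle.exp_eq_exp.1 (congr_fun hsnd i)
  have hsingle : ∀ i, Pi.single i (2 * Real.pi) ∈ periods := hG
  have hperiod : ∑ i, m i • Pi.single i (2 * Real.pi) ∈ periods :=
    sum_mem fun i _ => zsmul_mem (hsingle i) _
  have hadd : x.2 = y.2 + ∑ i, m i • (Pi.single i (2 * Real.pi) : ι → ℝ) := by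
    funext j
    simp [Finset.sum_apply, Pi.single_apply, hm j]
  rw [← hperiod y, ← hadd]
  exact congrArg G (Prod.ext hfst rfl)

variable [TopologicalSpace X]

theorem isOpenQuotientMap_torusCover :
    IsOpenQuotientMap (torusCover : X × (ι → ℝ) → X × (ι → Circle)) :=
  IsOpenQuotientMap.id.prodMap (IsOpenQuotientMap.piMap fun _ =>
    ⟨Circle.exp_surjective, Circle.exp.continuous, isLocalHomeomorph_circleExp.isOpenMap⟩)

theorem exists_continuous_sqrt_of_even_periods [Finite ι] [DecidableEq ι]
    {f : X × (ι → Circle) → Circle} {φ : X × (ι → ℝ) → ℝ} (hφ : Continuous φ)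
    (hφf : ∀ x, Circle.exp (φ x) = f (torusCover x))
    (heven : ∀ i, ∃ m : ℤ, Even m ∧
      ∀ x, φ (x.1, x.2 + Pi.single i (2 * Real.pi)) = φ x + m * (2 * Real.pi)) :
    ∃ g : X × (ι → Circle) → Circle, Continuous g ∧ ∀ y, g y ^ 2 = f y := by
  have hperiod : ∀ i (x : X × (ι → ℝ)), Circle.exp (φ (x.1, x.2 + Pi.single i (2 * Real.pi)) / 2) =
      Circle.exp (φ x / 2) := fun i x => by
    obtain ⟨_, ⟨m, rfl⟩, hm⟩ := heven i
    rw [hm]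
    exact Circle.exp_eq_exp.2 ⟨m, by push_cast; ring⟩
  have hcover := isOpenQuotientMap_torusCover (X := X) (ι := ι)
  refine ⟨fun y => Circle.exp (φ (Function.surjInv hcover.surjective y) / 2), ?_, fun y => ?_⟩
  · rw [hcover.isQuotientMap.continuous_iff]
    have hhalf : Continuous fun x => Circle.exp (φ x / 2) := by fun_prop
    exact hhalf.congr fun x => eq_of_torusCover_eq (G := fun x => Circle.exp (φ x / 2)) hperiod
      (Function.surjInv_eq hcover.surjective _).symm
  · rw [sq, ← Circle.exp_add, add_halves, hφf, Function.surjInv_eq hcover.surjective]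

theorem exists_nonempty_even_sum [Fintype ι] {κ : Type*} [Fintype κ]
    (hcard : Fintype.card ι < Fintype.card κ) (n : κ → ι → ℤ) :
    ∃ B : Finset κ, B.Nonempty ∧ ∀ i, Even (∑ j ∈ B, n j i) := by
  classical
  have hdep : ¬ LinearIndependent (ZMod 2) fun j i => (n j i : ZMod 2) := fun hind => by
    have hle := hind.fintype_card_le_finrank
    rw [Module.finrank_fintype_fun_eq_card] at hle
    omega
  obtain ⟨c, hc, j₀, hj₀⟩ := Fintype.not_linearIndependent_iff.1 hdep
  have hone : ∀ a : ZMod 2, a ≠ 0 → a = 1 := by decide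
  refine ⟨Finset.univ.filter fun j => c j ≠ 0, ⟨j₀, by simpa using hj₀⟩, fun i => ?_⟩
  rw [← ZMod.intCast_eq_zero_iff_even, Int.cast_sum, Finset.sum_filter]
  calc ∑ j, (if c j ≠ 0 then (n j i : ZMod 2) else 0)
      = ∑ j, c j * (n j i : ZMod 2) := Finset.sum_congr rfl fun j _ => by
        split_ifs with hcj
        · rw [hone _ hcj, one_mul]
        · rw [not_not.1 hcj, zero_mul]
    _ = 0 := by simpa [Finset.sum_apply] using congr_fun hc i

theorem isEmpty_homeomorph_torus_of_exists_circle_log [Fintype ι] {κ : Type*} [Fintype κ]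
    [PreconnectedSpace X]
    (hlog : ∀ f : X × (ι → ℝ) → Circle, Continuous f →
      ∃ φ : X × (ι → ℝ) → ℝ, Continuous φ ∧ ∀ x, Circle.exp (φ x) = f x)
    (hcard : Fintype.card ι < Fintype.card κ) :
    IsEmpty (X × (ι → Circle) ≃ₜ (κ → Circle)) := by
  classical
  refine ⟨fun Θ => ?_⟩
  have hcover := (isOpenQuotientMap_torusCover (X := X) (ι := ι)).continuous
  choose φ hφ hφΘ using fun j => hlog (fun x => Θ (torusCover x) j)
    ((continuous_apply j).comp (Θ.continuous.comp hcover))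
  have hperiod : ∀ j i, ∃ m : ℤ, ∀ x : X × (ι → ℝ),
      φ j (x.1, x.2 + Pi.single i (2 * Real.pi)) = φ j x + m * (2 * Real.pi) := fun j i =>
    circle_log_unique (by fun_prop) (hφ j) fun x => by
      rw [hφΘ, hφΘ, torusCover_add_single]
  choose n hn using hperiod
  obtain ⟨B, ⟨j₀, hj₀⟩, heven⟩ := exists_nonempty_even_sum hcard n
  obtain ⟨g, hg, hsq⟩ := exists_continuous_sqrt_of_even_periods (f := fun y => ∏ j ∈ B, Θ y j)
    (φ := fun x => ∑ j ∈ B, φ j x) (by fun_prop)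
    (fun x => (map_sum Circle.expHom _ _).trans (Finset.prod_congr rfl fun j _ => hφΘ j x))
    fun i => ⟨∑ j ∈ B, n j i, heven i, fun x => by
      simp only [hn, Finset.sum_add_distrib, ← Finset.sum_mul, Int.cast_sum]⟩
  refine not_exists_continuous_circle_sqrt
    ⟨fun w => g (Θ.symm (Function.update 1 j₀ w)), by fun_prop, fun w => ?_⟩
  rw [hsq, Homeomorph.apply_symm_apply, Finset.prod_update_of_mem hj₀]
  simp

end TorusCover

section SphereTorus

/-- `sphereTorus ι` as the product of the unit sphere of `ℂ²` and a torus. -/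
def sphereTorusHomeomorph (ι : Type) :
    sphereTorus ι ≃ₜ Metric.sphere (0 : WithLp 2 (ℂ × ℂ)) 1 × (ι → Circle) where
  toFun m := (⟨WithLp.toLp 2 m.1.1, by
      rw [mem_sphere_zero_iff_norm, ← sq_eq_sq₀ (norm_nonneg _) zero_le_one,
        WithLp.prod_norm_sq_eq_of_L2]
      exact m.2.1.trans (one_pow 2).symm⟩,
    fun i => ⟨m.1.2 i, mem_sphere_zero_iff_norm.2 (m.2.2 i)⟩)
  invFun p := ⟨(WithLp.ofLp p.1.1, fun i => p.2 i), by
      have hnorm := WithLp.prod_norm_sq_eq_of_L2 p.1.1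
      rw [mem_sphere_zero_iff_norm.1 p.1.2, one_pow] at hnorm
      exact hnorm.symm, fun i => (p.2 i).norm_coe⟩
  left_inv _ := rfl
  right_inv _ := rfl
  continuous_toFun := (Continuous.subtype_mk (by fun_prop) _).prodMk
    (continuous_pi fun i => Continuous.subtype_mk (by fun_prop) _)
  continuous_invFun := Continuous.subtype_mk (by fun_prop) _

theorem isEmpty_sphereTorus_homeomorph {ι κ : Type} [Fintype ι] [Fintype κ]
    (hcard : Fintype.card ι < Fintype.card κ) : IsEmpty (sphereTorus ι ≃ₜ (κ → Circle)) := by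
  have hdim : 2 < Module.finrank ℝ (WithLp 2 (ℂ × ℂ)) := by
    rw [(WithLp.linearEquiv 2 ℝ (ℂ × ℂ)).finrank_eq, Module.finrank_prod,
      Complex.finrank_real_complex]
    norm_num
  have hconn : PreconnectedSpace (Metric.sphere (0 : WithLp 2 (ℂ × ℂ)) 1) :=
    isPreconnected_iff_preconnectedSpace.1 (isPreconnected_sphere
      (by exact_mod_cast Module.lt_rank_of_lt_finrank (one_lt_two.trans hdim)) 0 1)
  have hempty : IsEmpty (Metric.sphere (0 : WithLp 2 (ℂ × ℂ)) 1 × (ι → Circle) ≃ₜ (κ → Circle)) :=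
    isEmpty_homeomorph_torus_of_exists_circle_log
      (fun _ hf => exists_circle_log_sphere_prod hdim hf) hcard
  exact Function.isEmpty (sphereTorusHomeomorph ι).symm.trans

end SphereTorus

end GelfandCetlin

open GelfandCetlin

theorem mainTheorem11 (n : ℕ) (l : Fin n → ℝ) (hl : Antitone l)
    (hproj : ¬ OrbitIsProjectiveSpace l) :
    ∃ (u : GCIndex n → ℝ) (d : ℕ),
      (gcFiber l u).Nonempty ∧ IsLagrangianIn l (gcFiber l u) d ∧
        ¬ Nonempty (gcFiber l u ≃ₜ (Fin d → Circle)) := by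
  have hcard := card_add_two_le_of_not_projective hproj
  obtain ⟨k, rfl⟩ : ∃ k, n = k + 3 := by
    rcases n with _ | n
    · exact absurd (hcard 0) (by simp)
    · have hpos : 0 < Fintype.card {i // l i = l 0} := Fintype.card_pos_iff.2 ⟨⟨0, rfl⟩⟩
      exact ⟨n - 2, by have := hcard (l 0); omega⟩
  obtain ⟨h, hsim, hbase⟩ := exists_isBasePoint k l hcard
  have hh : h.IsHermitian := hsim.isHermitian (isHermitian_diagonal_ofReal l)
  obtain ⟨ι, _, ⟨P⟩⟩ := hbase.exists_fiberParametrization hh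
  refine ⟨gelfandCetlin l ⟨h, hsim⟩, 3 + Fintype.card ι, ?_⟩
  rw [gcFiber_gelfandCetlin hsim]
  refine ⟨⟨h, self_mem_spectralFiber h⟩, ⟨fun x hx =>
    (unitarilySimilar_of_mem_spectralFiber hx).trans hsim, P.isSubmanifold, fun x hx X hX => ?_⟩,
    fun ⟨Θ⟩ => (isEmpty_sphereTorus_homeomorph (by simp)).false (P.homeomorph.trans Θ)⟩
  have hxh : x.IsHermitian := (unitarilySimilar_of_mem_spectralFiber hx).isHermitian hh
  rw [← spectralFiber_eq_of_mem hx]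
  exact lie_mem_tangentVectors_spectralFiber_iff hxh
    ((hbase.of_mem_spectralFiber hh hx).isNondegenerate hxh) hX
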